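/- **Soundness of quantum separation logic (QSL).** *States.* Fix a set of quantum variables. Each variable $q$ has a Hilbert space $\mathcal H_q$ with $\dim\mathcal H_q\ge 2$ (possibly infinite) and a distinguished vector $|0\rangle$ of an orthonormal basis. For a finite set $S$ of variables let $\mathcal H_S=\bigotimes_{q\in S}\mathcal H_q$ and let $\mathcal D(S)$ be the set of density operators on $\mathcal H_S$; a state $\rho\in\mathcal D(S)$ has domain $\mathrm{dom}(\rho)=S$, and $\mathcal D=\bigcup_S\mathcal D(S)$. Write $\rho|_S$ for the partial trace over $\mathrm{dom}(\rho)\setminus S$, and $\rho\preceq\rho'$ if $\mathrm{dom}(\rho)\subseteq\mathrm{dom}(\rho')$ and $\rho=\rho'|_{\mathrm{dom}(\rho)}$. For states with disjoint domains, $\rho_1\circ\rho_2=\rho_1\otimes\rho_2$; otherwise it is undefined. Operators on $\mathcal H_S$ are extended to larger sets of variables by tensoring with the identity. *Programs.* $P::=\mathbf{skip}\mid P_1;P_2\mid q:=|0\rangle\mid \bar q:=U[\bar q]\mid \mathbf{if}\,(\square m\cdot M[\bar q]=m\to P_m)\,\mathbf{fi}\mid\mathbf{while}\,M[\bar q]=1\,\mathbf{do}\,P\,\mathbf{od}$,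 with $U$ unitary and $M=\{M_m\}$ a finite projective measurement ($M_m$ projections, $\sum_mM_m=I$; outcomes $0,1$ for the loop). The transitions on pairs of a program and a partial density operator on $\mathcal H_V$, $V\supseteq\mathrm{var}(P)$, are: $\mathbf{skip}$ leaves $\rho$ unchanged, $q:=|0\rangle$ maps $\rho$ to $\sum_n|0\rangle_q\langle n|\rho|n\rangle_q\langle 0|$, $\bar q:=U[\bar q]$ maps $\rho$ to $U\rho U^\dagger$; $\mathbf{if}$ has for each $m$ a transition to $\langle P_m,M_m\rho M_m\rangle$; $\mathbf{while}$ has a transition to termination with $M_0\rho M_0$ and one to $\langle P;\mathbf{while},M_1\rho M_1\rangle$; $P_1;P_2$ runs $P_1$ first. $[\![P]\!]_V(\rho)$ is the sum of the multiset of all final operators $\rho'$ reached from $\langle P,\rho\rangle$. $P$ is *almost surely terminating* if $\mathrm{tr}([\![P]\!]_V(\rho))=\mathrm{tr}(\rho)$ for all $V\supseteq\mathrm{var}(P)$ and all $\rho\in\mathcal D(V)$. *Assertions.* BI formulas are built from atoms with $\top,\bot,\wedge,\vee,\to,*,-\!\!*$. Atoms, all with free variables $S$: $D[S]$, satisfied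 by $\rho$ iff $S\subseteq\mathrm{dom}(\rho)$; a projection (closed subspace) $K$ of $\mathcal H_S$, satisfied iff $S\subseteq\mathrm{dom}(\rho)$ and $\mathrm{supp}(\rho|_S)\subseteq K$; $U[S]$ for finite-dimensional $\mathcal H_S$, satisfied iff $S\subseteq\mathrm{dom}(\rho)$ and $\rho|_S=I_S/\dim\mathcal H_S$. Satisfaction of compound formulas is the standard BI one: $\top,\bot,\wedge,\vee$ as usual; $\rho\models\varphi\to\psi$ iff every $\rho'\succeq\rho$ with $\rho'\models\varphi$ has $\rho'\models\psi$; $\rho\models\varphi*\psi$ iff there are $y\models\varphi$, $z\models\psi$ with $y\circ z$ defined and $y\circ z\preceq\rho$; $\rho\models\varphi-\!\!*\,\psi$ iff for all $y\models\varphi$ with $\rho\circ y$ defined, $\rho\circ y\models\psi$. $\mathrm{free}(\varphi)$ is the set of all variables occurring in $\varphi$. A formula is *restrictive* if it contains neither $\to$ nor $-\!\!*$. It is *CM* if it is preserved by convex combinations of states with the same domain, and *SP* if, when it is satisfiable, there is a $\preceq$-least state satisfying it. It *covers* a set $X$ of variables if $X\subseteq\mathrm{dom}(\rho)$ for all $\rho\models\varphi$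 (restrictive formulas without $\vee$ cover $\mathrm{free}(\varphi)$). $\varphi\Rrightarrow\psi$ means that $D[\mathrm{free}(\varphi)\cup\mathrm{free}(\psi)]\to(\varphi\to\psi)$ is satisfied by all states. All pre- and postconditions of judgments, and the $\mu$ of Const and Frame, are restrictive. *Modifications* are partial operations on formulas. They fix $\top,\bot$, commute with $\wedge,\vee$, and are undefined in cases not listed. - $\varphi[\bar q:=U[\bar q]]$: $D[S]\mapsto D[S]$; $K\mapsto (U^\dagger\otimes I)K(U\otimes I)$ if $\bar q\subseteq S$, and $K\mapsto K$ if $\bar q\cap S=\emptyset$; $U[S]\mapsto U[S]$ if $\bar q\subseteq S$ or $\bar q\cap S=\emptyset$; $\varphi_1*\varphi_2$ is modified componentwise if for each $i$ either $\bar q\cap\mathrm{free}(\varphi_i)=\emptyset$, or $\bar q\subseteq\mathrm{free}(\varphi_i)$ and $\varphi_i$ covers $\bar q$. - $\varphi[q:=|0\rangle]$: $D[S]\mapsto D[S]$; $K\mapsto D[q]\wedge\lceil K\rceil_q$ if $q\in S$, where $\lceil K\rceil_q$ is the join of all closed subspaces $T$ of $\mathcal H_{S\setminus q}$ with $|0\rangle_q\langle0|\otimes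 T\subseteq K$, and $K\mapsto K$ otherwise; $U[S]\mapsto U[S]$ if $q\notin S$; $\varphi_1*\varphi_2$ becomes $\varphi_1'*\varphi_2'$ (with $\varphi_i'=\varphi_i[q:=|0\rangle]$) if $q$ is free in neither, and $(\varphi_1'\wedge\varphi_2')\wedge(D[\mathrm{free}(\varphi_1)\setminus q]*D[\mathrm{free}(\varphi_2)\setminus q])$ if $q$ is free in exactly one. - $\varphi[\mathcal E[\bar q]]$, for a trace-preserving quantum operation $\mathcal E(\rho)=\sum_iE_i\rho E_i^\dagger$ on $\bar q$ with $\sum_iE_i^\dagger E_i=I$: $K\mapsto\ker\big((\mathcal E^*\otimes\mathcal I)(K^\perp)\big)$ if $\bar q\subseteq S$, and $K\mapsto K$ if $\bar q\cap S=\emptyset$. *Proof system.* $\vdash\{\varphi\}P\{\psi\}$ is derivability by the following rules. - Skip: $\{\varphi\}\mathbf{skip}\{\varphi\}$. Init: $\{\varphi[q:=|0\rangle]\}\,q:=|0\rangle\,\{\varphi\}$ and Unit: $\{\varphi[\bar q:=U[\bar q]]\}\,\bar q:=U[\bar q]\,\{\varphi\}$, if the modification is defined. - Seq: from $\{\varphi\}P_1\{\psi\}$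 and $\{\psi\}P_2\{\mu\}$ infer $\{\varphi\}P_1;P_2\{\mu\}$. - RIf: from $\{\varphi*M_m\}P_m\{\psi\}$ for all $m$, and $\psi$ CM, infer $\{\varphi*D[\bar q]\}\,\mathbf{if}\cdots\mathbf{fi}\,\{\psi\}$. - RLoop: from $\{\varphi*M_1\}P\{\varphi*D[\bar q]\}$, and $\varphi$ CM, infer $\{\varphi*D[\bar q]\}\,\mathbf{while}\cdots\mathbf{od}\,\{\varphi\wedge M_0\}$. - Weak: from $\varphi\Rrightarrow\varphi'$, $\{\varphi'\}P\{\psi'\}$ and $\psi'\Rrightarrow\psi$ infer $\{\varphi\}P\{\psi\}$. - Conj and Disj: from $\{\varphi_1\}P\{\psi_1\}$ and $\{\varphi_2\}P\{\psi_2\}$ infer $\{\varphi_1\wedge\varphi_2\}P\{\psi_1\wedge\psi_2\}$, resp. $\{\varphi_1\vee\varphi_2\}P\{\psi_1\vee\psi_2\}$. - Const: from $\{\varphi\}P\{\psi\}$ and $\mathrm{free}(\mu)\cap\mathrm{var}(P)=\emptyset$ infer $\{\varphi\wedge\mu\}P\{\psi\wedge\mu\}$. - Frame: from $\{\varphi\}P\{\psi\}$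 and $\mathrm{free}(\mu)\cap\mathrm{var}(P)=\emptyset$ infer $\{\varphi*\mu\}P\{\psi*\mu\}$, provided that either $\psi$ is SP, or $\mathrm{free}(\psi)\cup\mathrm{var}(P)\subseteq\mathrm{free}(\varphi)$ and $\varphi$ covers $\mathrm{free}(\psi)\cup\mathrm{var}(P)$. - UnCR: from $\{\varphi\}P\{\psi\}$ and $\bar q\cap\mathrm{var}(P)=\emptyset$ infer $\{\varphi[\mathcal E[\bar q]]\}P\{\psi[\mathcal E[\bar q]]\}$, if both modifications are defined. **Theorem.** Let $P$ be an almost surely terminating program. If $\vdash\{\varphi\}P\{\psi\}$, then $\models\{\varphi\}P\{\psi\}$: for every finite set $V$ of variables that contains $\mathrm{free}(\varphi)$, $\mathrm{free}(\psi)$ and $\mathrm{var}(P)$, and every $\rho\in\mathcal D(V)$ with $\rho\models\varphi$, the operator $[\![P]\!]_V(\rho)$ is a state in $\mathcal D(V)$ and satisfies $\psi$. -/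

import Mathlib

open scoped InnerProductSpace

noncomputable section

/-- A system of quantum variables.  The state space of the variable `q` is the Hilbert space
`ℓ²(Label q)` (of any dimension), in which `Label q` labels an orthonormal basis;
`zero q` is the label of the basis state `|0⟩`. -/
class QuantumVariables.{u} (Var : Type u) where
  Label : Var → Type u
  zero : (q : Var) → Label q

namespace QSL

universe u

variable {Var : Type u} [DecidableEq Var] [QuantumVariables Var]

open QuantumVariables

/-! ### Hilbert spaces of sets of variables -/

/-- Labels of the product basis of the state space of a finite set of variables. -/
abbrev Basis (S : Finset Var) : Type u := (v : S) → Label v.1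

/-- The state space `⨂_{q ∈ S} ℓ²(Label q) = ℓ²(∏_{q ∈ S} Label q)`. -/
abbrev Hilb (S : Finset Var) : Type u := lp (fun _ : Basis S => ℂ) 2

/-- Bounded operators on the state space of `S`. -/
abbrev Op (S : Finset Var) : Type u := Hilb S →L[ℂ] Hilb S

/-- The product basis, as a Hilbert basis of the state space. -/
def stdBasis (S : Finset Var) : HilbertBasis (Basis S) ℂ (Hilb S) :=
  HilbertBasis.ofRepr (LinearIsometryEquiv.refl ℂ (Hilb S))

/-- The basis vector `|b⟩`. -/
def ket {S : Finset Var} (b : Basis S) : Hilb S := stdBasis S b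

/-- The label of the basis state `|0 ⋯ 0⟩`. -/
def zeros (S : Finset Var) : Basis S := fun v => zero v.1

/-- Labels on `S` and on `V \ S` together give labels on `V`. -/
def glue {S V : Finset Var} (a : Basis S) (c : Basis (V \ S)) : Basis V := fun v =>
  if hv : v.1 ∈ S then a ⟨v.1, hv⟩ else c ⟨v.1, Finset.mem_sdiff.mpr ⟨v.2, hv⟩⟩

theorem glue_injective {S V : Finset Var} (h : S ⊆ V) (c : Basis (V \ S)) :
    Function.Injective (fun a : Basis S => glue a c) := by
  intro a a' haa
  funext v
  have := congrFun haa ⟨v.1, h v.2⟩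
  simpa [glue, v.2] using this

/-- The isometry `|φ⟩ ↦ |φ⟩ ⊗ |c⟩` from the state space of `S` to the one of `V ⊇ S`, where
`c` labels a basis state of `V \ S`. -/
def slice {S V : Finset Var} (h : S ⊆ V) (c : Basis (V \ S)) : Hilb S →ₗᵢ[ℂ] Hilb V :=
  (((stdBasis V).orthonormal.comp _ (glue_injective h c)).orthogonalFamily).linearIsometry

/-- `slice h c` as a bounded operator. -/
def sliceL {S V : Finset Var} (h : S ⊆ V) (c : Basis (V \ S)) : Hilb S →L[ℂ] Hilb V :=
  (slice h c).toContinuousLinearMap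

open Classical in
/-- The sum of a family of operators in the strong operator topology (`0` if the family is not
summable in that topology). -/
def sotSum {S : Finset Var} {ι : Type u} (F : ι → Op S) : Op S :=
  if h : ∃ T : Op S, ∀ ψ, HasSum (fun i => F i ψ) (T ψ) then h.choose else 0

open Classical in
/-- The cylindrical extension `A ⊗ I_{V \ S} = ∑_c (I_S ⊗ |c⟩) A (I_S ⊗ ⟨c|)` of an operator on
`S` to `V ⊇ S` (only meaningful for `S ⊆ V`). -/
def cyl {S : Finset Var} (V : Finset Var) (A : Op S) : Op V :=
  if h : S ⊆ V then
    sotSum fun c : Basis (V \ S) =>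
      sliceL h c ∘L A ∘L ContinuousLinearMap.adjoint (sliceL h c)
  else 0

/-- The trace. -/
def trace {S : Finset Var} (A : Op S) : ℂ := ∑' b : Basis S, ⟪ket b, A (ket b)⟫_ℂ

/-- `σ` is the partial trace `tr_{V \ S}(ρ) = ∑_c (I_S ⊗ ⟨c|) ρ (I_S ⊗ |c⟩)`. -/
def IsPartialTrace {S V : Finset Var} (h : S ⊆ V) (ρ : Op V) (σ : Op S) : Prop :=
  HasSum (fun c : Basis (V \ S) =>
    ContinuousLinearMap.adjoint (sliceL h c) ∘L ρ ∘L sliceL h c) σ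

/-- The tensor product of operators on disjoint sets of variables, as an operator on the union. -/
def tensor {S T : Finset Var} (A : Op S) (B : Op T) : Op (S ∪ T) :=
  cyl (S ∪ T) A ∘L cyl (S ∪ T) B

/-! ### Quantum states -/

/-- The states with domain `S`: density operators on the state space of `S`. -/
structure State (S : Finset Var) where
  op : Op S
  isPositive : op.IsPositive
  hasTrace : HasSum (fun b : Basis S => ⟪ket b, op (ket b)⟫_ℂ) 1

/-- The order on states: `σ ≼ ρ` iff the domain of `σ` is contained in the one of `ρ` and `σ` is
the restriction of `ρ` to it. -/
def Below {S V : Finset Var} (σ : State S) (ρ : State V) : Prop :=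
  ∃ h : S ⊆ V, IsPartialTrace h ρ.op σ.op

/-- `w = y ∘ z` (in particular `y ∘ z` is defined). -/
def IsComp {S T : Finset Var} (y : State S) (z : State T) (w : State (S ∪ T)) : Prop :=
  Disjoint S T ∧ w.op = tensor y.op z.op

/-- The support of an operator: the orthocomplement of `{|φ⟩ : ⟨φ|A|φ⟩ = 0}`. -/
def supp {S : Finset Var} (A : Op S) : Submodule ℂ (Hilb S) :=
  (Submodule.span ℂ {φ : Hilb S | ⟪φ, A φ⟫_ℂ = 0})ᗮ

/-! ### Programs -/

/-- A projective measurement on `S` with `k` outcomes. -/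
structure Measurement (S : Finset Var) (k : ℕ) where
  op : Fin k → Op S
  isProj : ∀ m, IsStarProjection (op m)
  complete : ∑ m, op m = 1

/-- Quantum while-programs.  A register enters as the set of its variables, since operators on the
register are operators on the state space of that set. -/
inductive Prog (Var : Type u) [DecidableEq Var] [QuantumVariables Var] : Type u
  | skip : Prog Var
  | seq : Prog Var → Prog Var → Prog Var
  | init : Var → Prog Var
  | unit : (q : Finset Var) → unitary (Op q) → Prog Var
  | ifte : (q : Finset Var) → (k : ℕ) → Measurement q k → (Fin k → Prog Var) → Prog Var
  | while : (q : Finset Var) → Measurement q 2 → Prog Var → Prog Var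

/-- The variables of a program. -/
def Prog.vars : Prog Var → Finset Var
  | .skip => ∅
  | .seq P Q => P.vars ∪ Q.vars
  | .init q => {q}
  | .unit q _ => q
  | .ifte q _ _ P => q ∪ Finset.univ.biUnion fun m => (P m).vars
  | .while q _ P => q ∪ P.vars

/-- `A ρ A†`, where `A` acts on `S` and `ρ` is a (partial) density operator on `V ⊇ S`. -/
def act {S V : Finset Var} (A : Op S) (ρ : Op V) : Op V :=
  cyl V A ∘L ρ ∘L ContinuousLinearMap.adjoint (cyl V A)

/-- `ρ ↦ ∑ₙ |0⟩_q⟨n| ρ |n⟩_q⟨0|`. -/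
def resetOp (q : Var) {V : Finset Var} (ρ : Op V) : Op V :=
  ∑' n : Basis ({q} : Finset Var),
    act (InnerProductSpace.rankOne ℂ (ket (zeros ({q} : Finset Var))) (ket n)) ρ

/-- Configurations of domain `V`: the remaining program (`none` is the empty program) and a partial
density operator. -/
abbrev Config (V : Finset Var) : Type u := Option (Prog Var) × Op V

/-- The multiset of all one-step transitions from `⟨P, ρ⟩`, one for each measurement outcome. -/
def succs {V : Finset Var} : Prog Var → Op V → Multiset (Config V)
  | .skip, ρ => {(none, ρ)}
  | .seq P Q, ρ => (succs P ρ).map fun c =>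
      (some (match c.1 with
        | none => Q
        | some P' => .seq P' Q), c.2)
  | .init q, ρ => {(none, resetOp q ρ)}
  | .unit _ U, ρ => {(none, act U.1 ρ)}
  | .ifte _ _ M P, ρ => Finset.univ.val.map fun m => (some (P m), act (M.op m) ρ)
  | .while q M P, ρ =>
      {(none, act (M.op 0) ρ), (some (.seq P (.while q M P)), act (M.op 1) ρ)}

/-- One-step transitions of a configuration; configurations with empty program are terminal. -/
def step {V : Finset Var} : Config V → Multiset (Config V)
  | (none, _) => 0
  | (some P, ρ) => succs P ρ

/-- The multiset of configurations that are reached after exactly `n` steps. -/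
def run {V : Finset Var} (c : Config V) : ℕ → Multiset (Config V)
  | 0 => {c}
  | n + 1 => (run c n).bind step

/-- The output of a configuration, if its program is the empty one. -/
def output {V : Finset Var} : Config V → Option (Op V)
  | (none, ρ) => some ρ
  | (some _, _) => none

/-- The denotational semantics of domain `V`: the sum of the multiset
`{| ρ' : ⟨P, ρ⟩ →* ⟨↓, ρ'⟩ |}`, ordered by the number of steps. -/
def sem (V : Finset Var) (P : Prog Var) (ρ : Op V) : Op V :=
  ∑' n : ℕ, ((run (some P, ρ) n).filterMap output).sum

/-- `P` terminates almost surely: it preserves the trace of every input. -/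
def AlmostSurelyTerminating (P : Prog Var) : Prop :=
  ∀ V : Finset Var, P.vars ⊆ V → ∀ ρ : State V, trace (sem V P ρ.op) = trace ρ.op

/-! ### Assertions -/

/-- Formulas of the logic of bunched implications over the atomic propositions `D[S]`, closed
subspaces (projections) `K` of the state space of `S`, and uniformity `U[S]` for finite-dimensional
systems `S`. -/
inductive Form (Var : Type u) [DecidableEq Var] [QuantumVariables Var] : Type u
  | dom : Finset Var → Form Var
  | proj : (S : Finset Var) → ClosedSubmodule ℂ (Hilb S) → Form Var
  | unif : (S : Finset Var) → Finite (Basis S) → Form Var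
  | top : Form Var
  | bot : Form Var
  | and : Form Var → Form Var → Form Var
  | or : Form Var → Form Var → Form Var
  | imp : Form Var → Form Var → Form Var
  | star : Form Var → Form Var → Form Var
  | wand : Form Var → Form Var → Form Var

/-- The free variables of a formula. -/
def Form.free : Form Var → Finset Var
  | .dom S => S
  | .proj S _ => S
  | .unif S _ => S
  | .top => ∅
  | .bot => ∅
  | .and φ ψ => φ.free ∪ ψ.free
  | .or φ ψ => φ.free ∪ ψ.free
  | .imp φ ψ => φ.free ∪ ψ.free
  | .star φ ψ => φ.free ∪ ψ.free
  | .wand φ ψ => φ.free ∪ ψ.free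

/-- Satisfaction `ρ ⊨ φ`. -/
def Sat : Form Var → {V : Finset Var} → State V → Prop
  | .dom S, V, _ => S ⊆ V
  | .proj S K, _, ρ => ∃ σ : State S, Below σ ρ ∧ supp σ.op ≤ K.toSubmodule
  | .unif S _, V, ρ => ∃ h : S ⊆ V,
      IsPartialTrace h ρ.op ((Nat.card (Basis S) : ℂ)⁻¹ • (1 : Op S))
  | .top, _, _ => True
  | .bot, _, _ => False
  | .and φ ψ, _, ρ => Sat φ ρ ∧ Sat ψ ρ
  | .or φ ψ, _, ρ => Sat φ ρ ∨ Sat ψ ρ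
  | .imp φ ψ, _, ρ => ∀ (V' : Finset Var) (ρ' : State V'), Below ρ ρ' → Sat φ ρ' → Sat ψ ρ'
  | .star φ ψ, _, ρ => ∃ (S T : Finset Var) (y : State S) (z : State T) (w : State (S ∪ T)),
      IsComp y z w ∧ Below w ρ ∧ Sat φ y ∧ Sat ψ z
  | .wand φ ψ, V, ρ => ∀ (T : Finset Var) (y : State T) (w : State (V ∪ T)),
      IsComp ρ y w → Sat φ y → Sat ψ w

/-- `⊨ φ`: every state satisfies `φ`. -/
def Form.Valid (φ : Form Var) : Prop := ∀ (V : Finset Var) (ρ : State V), Sat φ ρ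

/-- Global implication `D[free φ ∪ free ψ] → (φ → ψ)`. -/
def gimp (φ ψ : Form Var) : Form Var := .imp (.dom (φ.free ∪ ψ.free)) (.imp φ ψ)

/-- The restrictive formulas: those without `→` and without the separating implication. -/
def Form.Res : Form Var → Prop
  | .dom _ => True
  | .proj _ _ => True
  | .unif _ _ => True
  | .top => True
  | .bot => True
  | .and φ ψ => φ.Res ∧ ψ.Res
  | .or φ ψ => φ.Res ∧ ψ.Res
  | .star φ ψ => φ.Res ∧ ψ.Res
  | .imp _ _ => False
  | .wand _ _ => False

/-- Closed under mixtures. -/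
def Form.CM (φ : Form Var) : Prop :=
  ∀ (V : Finset Var) (ρ ρ' : State V), Sat φ ρ → Sat φ ρ' → ∀ t : ℝ, 0 ≤ t → t ≤ 1 →
    ∃ σ : State V, σ.op = (t : ℂ) • ρ.op + ((1 - t : ℝ) : ℂ) • ρ'.op ∧ Sat φ σ

/-- Supported: if satisfied by some state at all, then there is a least such state. -/
def Form.SP (φ : Form Var) : Prop :=
  (∃ (V : Finset Var) (ρ : State V), Sat φ ρ) →
    ∃ (S : Finset Var) (σ : State S), Sat φ σ ∧
      ∀ (V : Finset Var) (ρ : State V), Sat φ ρ → Below σ ρ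

/-- Every state that satisfies `φ` has all variables of `X` in its domain.  Disjunction-free
formulas without implications have this property whenever `X ⊆ free φ`. -/
def Form.Covers (φ : Form Var) (X : Finset Var) : Prop :=
  ∀ (V : Finset Var) (ρ : State V), Sat φ ρ → X ⊆ V

/-! ### Modification of formulas -/

/-- The kernel of a bounded operator, as a closed subspace. -/
def closedKer {S : Finset Var} (A : Op S) : ClosedSubmodule ℂ (Hilb S) :=
  ⟨LinearMap.ker (A : Hilb S →ₗ[ℂ] Hilb S), A.isClosed_ker⟩

/-- The closed subspace `{|φ⟩ : P|φ⟩ = |φ⟩}` of a projection, as an atomic proposition. -/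
def projAtom {S : Finset Var} (P : Op S) : Form Var := .proj S (closedKer (P - 1))

/-- `⌈K⌉_q`: the join of all closed subspaces `T` of the state space of `S \ {q}` with
`|0⟩_q⟨0| ⊗ T ⊆ K`. -/
def initSubspace {S : Finset Var} (q : Var) (K : ClosedSubmodule ℂ (Hilb S)) :
    ClosedSubmodule ℂ (Hilb (S \ {q})) :=
  sSup {T | ∀ t ∈ T, slice Finset.sdiff_subset (zeros (S \ (S \ {q}))) t ∈ K}

open Classical in
/-- The modification `φ[q̄ := U[q̄]]` (`none` if it is undefined). -/
def modUnit (q : Finset Var) (U : Op q) : Form Var → Option (Form Var)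
  | .top => some .top
  | .bot => some .bot
  | .dom S => some (.dom S)
  | .proj S K =>
      if q ⊆ S then some (.proj S (K.comap (cyl S U)))
      else if Disjoint q S then some (.proj S K)
      else none
  | .unif S h => if q ⊆ S ∨ Disjoint q S then some (.unif S h) else none
  | .and φ ψ => do
      let φ' ← modUnit q U φ
      let ψ' ← modUnit q U ψ
      return .and φ' ψ'
  | .or φ ψ => do
      let φ' ← modUnit q U φ
      let ψ' ← modUnit q U ψ
      return .or φ' ψ'
  | .star φ ψ =>
      if ((q ⊆ φ.free ∧ φ.Covers q) ∨ Disjoint q φ.free) ∧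
          ((q ⊆ ψ.free ∧ ψ.Covers q) ∨ Disjoint q ψ.free) then do
        let φ' ← modUnit q U φ
        let ψ' ← modUnit q U ψ
        return .star φ' ψ'
      else none
  | .imp _ _ => none
  | .wand _ _ => none

/-- The modification `φ[q := |0⟩]` (`none` if it is undefined). -/
def modInit (q : Var) : Form Var → Option (Form Var)
  | .top => some .top
  | .bot => some .bot
  | .dom S => some (.dom S)
  | .proj S K =>
      if q ∈ S then some (.and (.dom {q}) (.proj (S \ {q}) (initSubspace q K)))
      else some (.proj S K)
  | .unif S h => if q ∈ S then none else some (.unif S h)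
  | .and φ ψ => do
      let φ' ← modInit q φ
      let ψ' ← modInit q ψ
      return .and φ' ψ'
  | .or φ ψ => do
      let φ' ← modInit q φ
      let ψ' ← modInit q ψ
      return .or φ' ψ'
  | .star φ ψ => do
      let φ' ← modInit q φ
      let ψ' ← modInit q ψ
      if q ∈ φ.free then
        if q ∈ ψ.free then none
        else return .and (.and φ' ψ') (.star (.dom (φ.free \ {q})) (.dom (ψ.free \ {q})))
      else
        if q ∈ ψ.free then
          return .and (.and φ' ψ') (.star (.dom (φ.free \ {q})) (.dom (ψ.free \ {q})))
        else return .star φ' ψ'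
  | .imp _ _ => none
  | .wand _ _ => none

/-- A quantum operation on `S` through Kraus operators with `∑ᵢ Eᵢ† Eᵢ = I` (the sum being taken
in the strong operator topology). -/
structure QuantumOperation (S : Finset Var) where
  ι : Type u
  kraus : ι → Op S
  complete : ∀ ψ : Hilb S,
    HasSum (fun i => (ContinuousLinearMap.adjoint (kraus i) ∘L kraus i) ψ) ψ

/-- The dual `(ℰ* ⊗ ℐ)(A) = ∑ᵢ (Eᵢ ⊗ I)† A (Eᵢ ⊗ I)` on `S`. -/
def QuantumOperation.dual {q : Finset Var} (E : QuantumOperation q) {S : Finset Var}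
    (A : Op S) : Op S :=
  sotSum fun i => ContinuousLinearMap.adjoint (cyl S (E.kraus i)) ∘L A ∘L cyl S (E.kraus i)

open Classical in
/-- The modification `φ[ℰ[q̄]]` (`none` if it is undefined).  For a projection `K` on `S ⊇ q̄` it is
the kernel of `(ℰ* ⊗ ℐ)(K^⊥)`. -/
def modOp (q : Finset Var) (E : QuantumOperation q) : Form Var → Option (Form Var)
  | .top => some .top
  | .bot => some .bot
  | .proj S K =>
      if q ⊆ S then some (.proj S (closedKer (E.dual (K.toSubmoduleᗮ).starProjection)))
      else if Disjoint q S then some (.proj S K)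
      else none
  | .and φ ψ => do
      let φ' ← modOp q E φ
      let ψ' ← modOp q E ψ
      return .and φ' ψ'
  | .or φ ψ => do
      let φ' ← modOp q E φ
      let ψ' ← modOp q E ψ
      return .or φ' ψ'
  | .dom _ => none
  | .unif _ _ => none
  | .imp _ _ => none
  | .star _ _ => none
  | .wand _ _ => none

/-! ### Judgments -/

/-- `V ⊨ {φ} P {ψ}`: each state with domain `V` that satisfies `φ` is mapped by the denotational
semantics of `P` to a state that satisfies `ψ`. -/
def ValidOn (V : Finset Var) (φ : Form Var) (P : Prog Var) (ψ : Form Var) : Prop :=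
  ∀ ρ : State V, Sat φ ρ → ∃ σ : State V, σ.op = sem V P ρ.op ∧ Sat ψ σ

/-- `⊨ {φ} P {ψ}`: validity with respect to every finite set of variables that contains all
variables of `φ`, `ψ` and `P`. -/
def ValidTriple (φ : Form Var) (P : Prog Var) (ψ : Form Var) : Prop :=
  ∀ V : Finset Var, φ.free ⊆ V → ψ.free ⊆ V → P.vars ⊆ V → ValidOn V φ P ψ

/-- `⊢ {φ} P {ψ}`: the proof system of quantum separation logic, for judgments with restrictive
pre- and postconditions. -/
inductive Derivable : Form Var → Prog Var → Form Var → Prop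
  | skip {φ : Form Var} : φ.Res → Derivable φ .skip φ
  | init {q : Var} {φ φ' : Form Var} : φ.Res → modInit q φ = some φ' →
      Derivable φ' (.init q) φ
  | unit {q : Finset Var} {U : unitary (Op q)} {φ φ' : Form Var} : φ.Res →
      modUnit q (U : Op q) φ = some φ' → Derivable φ' (.unit q U) φ
  | seq {φ ψ μ : Form Var} {P Q : Prog Var} : Derivable φ P ψ → Derivable ψ Q μ →
      Derivable φ (.seq P Q) μ
  | rif {q : Finset Var} {k : ℕ} {M : Measurement q k} {P : Fin k → Prog Var}
      {φ ψ : Form Var} : (∀ m, Derivable (.star φ (projAtom (M.op m))) (P m) ψ) → ψ.CM →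
      Derivable (.star φ (.dom q)) (.ifte q k M P) ψ
  | rloop {q : Finset Var} {M : Measurement q 2} {P : Prog Var} {φ : Form Var} :
      Derivable (.star φ (projAtom (M.op 1))) P (.star φ (.dom q)) → φ.CM →
      Derivable (.star φ (.dom q)) (.while q M P) (.and φ (projAtom (M.op 0)))
  | weak {φ φ' ψ ψ' : Form Var} {P : Prog Var} : φ.Res → ψ.Res →
      (gimp φ φ').Valid → Derivable φ' P ψ' → (gimp ψ' ψ).Valid → Derivable φ P ψ
  | conj {φ₁ φ₂ ψ₁ ψ₂ : Form Var} {P : Prog Var} : Derivable φ₁ P ψ₁ → Derivable φ₂ P ψ₂ →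
      Derivable (.and φ₁ φ₂) P (.and ψ₁ ψ₂)
  | disj {φ₁ φ₂ ψ₁ ψ₂ : Form Var} {P : Prog Var} : Derivable φ₁ P ψ₁ → Derivable φ₂ P ψ₂ →
      Derivable (.or φ₁ φ₂) P (.or ψ₁ ψ₂)
  | const {φ ψ μ : Form Var} {P : Prog Var} : μ.Res → Derivable φ P ψ →
      Disjoint μ.free P.vars → Derivable (.and φ μ) P (.and ψ μ)
  | frame {φ ψ μ : Form Var} {P : Prog Var} : μ.Res → Derivable φ P ψ →
      Disjoint μ.free P.vars →
      (ψ.free ∪ P.vars ⊆ φ.free ∧ φ.Covers (ψ.free ∪ P.vars)) ∨ ψ.SP →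
      Derivable (.star φ μ) P (.star ψ μ)
  | uncr {q : Finset Var} {E : QuantumOperation q} {φ ψ φ' ψ' : Form Var} {P : Prog Var} :
      Derivable φ P ψ → Disjoint q P.vars → modOp q E φ = some φ' → modOp q E ψ = some ψ' →
      Derivable φ' P ψ'

end QSL

end

/-!
Soundness is proved by induction on derivations, for an invariant that survives the passage to the
components of a program. Three choices make the induction work.

*Weights instead of states.* All statements about a positive trace-class operator `ρ` are expressed
through the weights `ev ρ X = tr (X ρ X†) ∈ [0, ∞]`. They turn restriction into evaluation at
cylindrical operators (`below_iff`), composition of states into a product formula (`isComp_iff`), and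
sums of operators into sums in `[0, ∞]`, where no convergence has to be discussed. In these terms,
`SatOn ρ φ W` says that the restriction of `ρ` to `W` satisfies `φ`, without forming the restriction
or normalizing `ρ`; for states it agrees with satisfaction (`sat_iff_satOn`). It depends only on
weights of operators on `W ∩ free φ` (`SatOn.inter_free`, `SatOn.transfer`), it is closed under limits
(`SatOn.of_tendsto`), and under sums if `φ` is closed under mixtures (`SatOn.sum`).

*Paths.* Unfolding the transition system shows that `⟦P⟧(ρ) = ∑ₚ Kₚ ρ Kₚ†`, where `p` runs over the
terminating paths of `P` and the operators `Kₚ` act on the variables of `P` (`ev_sem`,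
`kraus_eq_cyl`). Hence a program commutes with every operation on other variables, and it preserves
the restriction of its input to those if no trace is lost (`ev_sem_of_disjoint`).

*Termination per input.* The components of an almost surely terminating program need not terminate
on all inputs, so `Sound` asks for a satisfying output only if the trace of the given input is
preserved. As no program increases the trace, preservation by a compound program forces preservation
by its components on their respective inputs.

The rules are then verified one at a time. For the frame rule (`sound_frame`) with a covering
precondition, the program acts inside the system that satisfies the precondition, and independence
from the frame is kept. With a supported postcondition, conditioning the frame `T` on the outcome of
any operator `B` gives an output of the program on a conditioned input, which therefore extends the
least state that satisfies the postcondition; so that state is independent of `T`, and disjoint from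
`T` because all spaces have dimension at least two (`disjoint_of_ev_eq`). The output of a loop
(`sound_rloop`) is the limit of the outputs after finitely many iterations. The modifications of
formulas express that an observable in the output is an observable in the input: for unitary
transformations (`SatOn.conj_unitary`), initializations (`SatOn.init`), and quantum operations on
variables outside the program (`satOn_modOp_iff`, `sound_uncr`).
-/

open scoped InnerProductSpace
noncomputable section

set_option linter.unusedSectionVars false

namespace QSL

open QuantumVariables
open Filter Topology
open scoped ENNReal ComplexOrder
open ContinuousLinearMap (adjoint)

universe u

variable {Var : Type u} [DecidableEq Var] [QuantumVariables Var]
variable {S T V W : Finset Var}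

/-! ### The product basis -/

theorem enorm_sq_eq_ofReal {E : Type*} [NormedAddCommGroup E] (x : E) :
    ‖x‖ₑ ^ 2 = ENNReal.ofReal (‖x‖ ^ 2) := by
  rw [ENNReal.ofReal_pow (norm_nonneg x), ofReal_norm]

theorem ket_eq (b : Basis S) : (ket b : Hilb S) = stdBasis S b := rfl

theorem ket_orthonormal : Orthonormal ℂ (ket : Basis S → Hilb S) := (stdBasis S).orthonormal

open Classical in
theorem inner_ket_ket (a b : Basis S) : ⟪ket a, ket b⟫_ℂ = if a = b then 1 else 0 :=
  (orthonormal_iff_ite.mp ket_orthonormal) a b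

theorem norm_ket (b : Basis S) : ‖(ket b : Hilb S)‖ = 1 := ket_orthonormal.1 b

theorem dense_span_ket : Dense (Submodule.span ℂ (Set.range (ket : Basis S → Hilb S)) : Set (Hilb S)) := by
  have := (stdBasis S).dense_span
  rwa [← Submodule.dense_iff_topologicalClosure_eq_top] at this

theorem clm_ext_ket {F : Type*} [NormedAddCommGroup F] [NormedSpace ℂ F] {A B : Hilb S →L[ℂ] F}
    (h : ∀ b : Basis S, A (ket b) = B (ket b)) : A = B :=
  ContinuousLinearMap.ext_on dense_span_ket (by rintro _ ⟨b, rfl⟩; exact h b)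

theorem ext_inner_ket {x y : Hilb S} (h : ∀ b : Basis S, ⟪ket b, x⟫_ℂ = ⟪ket b, y⟫_ℂ) : x = y := by
  apply (stdBasis S).repr.injective
  ext b
  rw [HilbertBasis.repr_apply_apply, HilbertBasis.repr_apply_apply]
  exact h b

/-- Parseval's identity for the product basis. -/
theorem enorm_sq_eq_tsum (x : Hilb S) : ‖x‖ₑ ^ 2 = ∑' b : Basis S, ‖⟪ket b, x⟫_ℂ‖ₑ ^ 2 := by
  have h := (stdBasis S).hasSum_inner_mul_inner x x
  have h' : HasSum (fun b : Basis S => ‖⟪ket b, x⟫_ℂ‖ ^ 2) (‖x‖ ^ 2) := by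
    rw [inner_self_eq_norm_sq_to_K] at h
    have h3 : (fun b : Basis S => ⟪x, stdBasis S b⟫_ℂ * ⟪stdBasis S b, x⟫_ℂ) =
        fun b => ((‖⟪ket b, x⟫_ℂ‖ ^ 2 : ℝ) : ℂ) := by
      funext b
      rw [← inner_conj_symm x, RCLike.conj_mul, ket_eq]
      norm_cast
    rw [h3] at h
    refine Complex.hasSum_ofReal.mp ?_
    rw [Complex.ofReal_pow]
    exact h
  simp_rw [enorm_sq_eq_ofReal]
  rw [← h'.tsum_eq, ENNReal.ofReal_tsum_of_nonneg (fun _ => by positivity) h'.summable]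

/-- The squared Hilbert–Schmidt norms of an operator and of its adjoint agree. -/
theorem tsum_enorm_sq_adjoint (A : Hilb S →L[ℂ] Hilb T) :
    ∑' b : Basis S, ‖A (ket b)‖ₑ ^ 2 = ∑' c : Basis T, ‖adjoint A (ket c)‖ₑ ^ 2 := by
  simp_rw [enorm_sq_eq_tsum]
  rw [ENNReal.tsum_comm]
  refine tsum_congr fun c => tsum_congr fun b => ?_
  rw [ContinuousLinearMap.adjoint_inner_right, ← inner_conj_symm, RCLike.enorm_conj]

/-! ### Positive operators and weights -/

/-- `B ρ B†`. -/
def conj (B : Hilb V →L[ℂ] Hilb W) (ρ : Op V) : Op W := B ∘L ρ ∘L adjoint B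

/-- The quadratic form `⟨ψ|ρ|ψ⟩` of a positive operator, with values in `[0, ∞]`. -/
def qf (ρ : Op V) (ψ : Hilb V) : ℝ≥0∞ := ENNReal.ofReal (RCLike.re ⟪ψ, ρ ψ⟫_ℂ)

/-- The trace of a positive operator, with values in `[0, ∞]`. -/
def etr (ρ : Op V) : ℝ≥0∞ := ∑' b : Basis V, qf ρ (ket b)

/-- The weight `tr(X ρ X†)`, that is, the expectation of `X† X` in `ρ`. -/
def ev (ρ : Op V) (X : Hilb V →L[ℂ] Hilb W) : ℝ≥0∞ := etr (conj X ρ)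

/-- Positive operators of finite trace. -/
structure IsTC (ρ : Op V) : Prop where
  pos : ρ.IsPositive
  fin : etr ρ ≠ ∞

theorem act_eq (A : Op S) (ρ : Op V) : act A ρ = conj (cyl V A) ρ := rfl

theorem qf_conj (B : Hilb V →L[ℂ] Hilb W) (ρ : Op V) (ψ : Hilb W) :
    qf (conj B ρ) ψ = qf ρ (adjoint B ψ) := by
  simp [qf, conj, ContinuousLinearMap.adjoint_inner_left]

theorem conj_conj {U : Finset Var} (C : Hilb W →L[ℂ] Hilb U) (B : Hilb V →L[ℂ] Hilb W) (ρ : Op V) :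
    conj C (conj B ρ) = conj (C ∘L B) ρ := by
  simp [conj, ContinuousLinearMap.adjoint_comp, ContinuousLinearMap.comp_assoc]

theorem conj_one (ρ : Op V) : conj (1 : Op V) ρ = ρ := by
  have : adjoint (1 : Op V) = 1 := star_one (Op V)
  rw [conj, this]
  rfl

theorem isPositive_conj (B : Hilb V →L[ℂ] Hilb W) {ρ : Op V} (h : ρ.IsPositive) :
    (conj B ρ).IsPositive := h.conj_adjoint B

theorem ev_conj {U : Finset Var} (ρ : Op V) (B : Hilb V →L[ℂ] Hilb W) (X : Hilb W →L[ℂ] Hilb U) :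
    ev (conj B ρ) X = ev ρ (X ∘L B) := by rw [ev, conj_conj, ev]

theorem ev_one (ρ : Op V) : ev ρ (1 : Op V) = etr ρ := by rw [ev, conj_one]

/-- Stated for an abstract C⋆-algebra, which spares unification in the algebra of operators. -/
theorem exists_eq_star_mul_self {A : Type*} [CStarAlgebra A] [PartialOrder A] [StarOrderedRing A]
    {a : A} (h : 0 ≤ a) : ∃ b, a = star b * b :=
  CStarAlgebra.nonneg_iff_eq_star_mul_self.mp h

theorem exists_sqrt {ρ : Op V} (h : ρ.IsPositive) : ∃ R : Op V, ρ = adjoint R ∘L R := by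
  rw [← ContinuousLinearMap.nonneg_iff_isPositive] at h
  exact exists_eq_star_mul_self h

theorem qf_sqrt (R : Hilb V →L[ℂ] Hilb W) (ψ : Hilb V) : qf (adjoint R ∘L R) ψ = ‖R ψ‖ₑ ^ 2 := by
  rw [qf, ContinuousLinearMap.comp_apply, ContinuousLinearMap.adjoint_inner_right,
    inner_self_eq_norm_sq, ENNReal.ofReal_pow (norm_nonneg _), ofReal_norm]

/-- Weights in `R† R` are squared Hilbert–Schmidt norms, so they can be compared vector by vector. -/
theorem ev_sqrt (R : Op V) (X : Hilb V →L[ℂ] Hilb W) :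
    ev (adjoint R ∘L R) X = ∑' b : Basis V, ‖X (adjoint R (ket b))‖ₑ ^ 2 := by
  rw [ev, etr]
  simp_rw [qf_conj, qf_sqrt]
  have := tsum_enorm_sq_adjoint (X ∘L adjoint R)
  simp only [ContinuousLinearMap.adjoint_comp, ContinuousLinearMap.adjoint_adjoint] at this
  simpa using this.symm

/-- The expectation in `ρ` of a sum of operators `Xᵢ† Xᵢ`, expressed through the weights. -/
theorem ev_eq_tsum {ρ : Op V} (h : ρ.IsPositive) {ι : Type*} {T : ι → Finset Var}
    (X : (i : ι) → Hilb V →L[ℂ] Hilb (T i)) (Y : Hilb V →L[ℂ] Hilb W)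
    (hXY : ∀ ψ, ∑' i, ‖X i ψ‖ₑ ^ 2 = ‖Y ψ‖ₑ ^ 2) : ∑' i, ev ρ (X i) = ev ρ Y := by
  obtain ⟨R, rfl⟩ := exists_sqrt h
  simp_rw [ev_sqrt]
  rw [ENNReal.tsum_comm]
  simp_rw [hXY]

theorem tsum_ev_le {ρ : Op V} (h : ρ.IsPositive) {ι : Type*} {T : ι → Finset Var}
    (X : (i : ι) → Hilb V →L[ℂ] Hilb (T i)) (Y : Hilb V →L[ℂ] Hilb W) (C : ℝ≥0∞)
    (hXY : ∀ ψ, ∑' i, ‖X i ψ‖ₑ ^ 2 ≤ C * ‖Y ψ‖ₑ ^ 2) : ∑' i, ev ρ (X i) ≤ C * ev ρ Y := by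
  obtain ⟨R, rfl⟩ := exists_sqrt h
  simp_rw [ev_sqrt]
  rw [ENNReal.tsum_comm, ← ENNReal.tsum_mul_left]
  exact ENNReal.tsum_le_tsum fun b => hXY _

theorem ev_congr {ρ : Op V} (h : ρ.IsPositive) (X : Hilb V →L[ℂ] Hilb W) (Y : Hilb V →L[ℂ] Hilb T)
    (hXY : ∀ ψ, ‖X ψ‖ₑ = ‖Y ψ‖ₑ) : ev ρ X = ev ρ Y := by
  have := ev_eq_tsum h (fun _ : Unit => X) Y (by simp [hXY])
  simpa using this

theorem ev_le {ρ : Op V} (h : ρ.IsPositive) (X : Hilb V →L[ℂ] Hilb W) (Y : Hilb V →L[ℂ] Hilb T)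
    (C : ℝ≥0∞) (hXY : ∀ ψ, ‖X ψ‖ₑ ^ 2 ≤ C * ‖Y ψ‖ₑ ^ 2) : ev ρ X ≤ C * ev ρ Y := by
  have := tsum_ev_le h (fun _ : Unit => X) Y C (by simpa using hXY)
  simpa using this

theorem ev_comp_le {ρ : Op V} (h : ρ.IsPositive) (Z : Hilb T →L[ℂ] Hilb W) (Y : Hilb V →L[ℂ] Hilb T) :
    ev ρ (Z ∘L Y) ≤ ‖Z‖ₑ ^ 2 * ev ρ Y := by
  refine ev_le h _ _ _ fun ψ => ?_
  rw [← mul_pow]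
  gcongr
  exact Z.le_opENorm _

theorem ev_le_etr {ρ : Op V} (h : ρ.IsPositive) (X : Hilb V →L[ℂ] Hilb W) :
    ev ρ X ≤ ‖X‖ₑ ^ 2 * etr ρ := by
  rw [← ev_one]
  exact ev_comp_le h X (1 : Op V)

theorem ev_ne_top {ρ : Op V} (h : IsTC ρ) (X : Hilb V →L[ℂ] Hilb W) : ev ρ X ≠ ∞ := by
  refine ne_top_of_le_ne_top ?_ (ev_le_etr h.pos X)
  exact ENNReal.mul_ne_top (by simp) h.fin

theorem IsTC.conj {ρ : Op V} (h : IsTC ρ) (X : Hilb V →L[ℂ] Hilb W) : IsTC (conj X ρ) :=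
  ⟨isPositive_conj X h.pos, ev_ne_top h X⟩

theorem ofReal_qf {ρ : Op V} (h : ρ.IsPositive) (ψ : Hilb V) :
    ((qf ρ ψ).toReal : ℂ) = ⟪ψ, ρ ψ⟫_ℂ := by
  have := h.inner_nonneg_right ψ
  rw [qf, ENNReal.toReal_ofReal (h.re_inner_nonneg_right ψ)]
  exact (RCLike.nonneg_iff_exists_ofReal.mp this).elim fun r hr => by rw [← hr.2]; simp

/-- Positive operators are determined by their quadratic forms. -/
theorem eq_of_qf_eq {ρ σ : Op V} (hρ : ρ.IsPositive) (hσ : σ.IsPositive)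
    (h : ∀ ψ, qf ρ ψ = qf σ ψ) : ρ = σ := by
  have : (ρ : Hilb V →ₗ[ℂ] Hilb V) = σ := by
    rw [← ext_inner_map]
    intro x
    have := ofReal_qf hρ x
    rw [h, ofReal_qf hσ x] at this
    have h2 := congrArg (starRingEnd ℂ) this
    rw [inner_conj_symm, inner_conj_symm] at h2
    exact h2.symm
  exact ContinuousLinearMap.coe_injective this

theorem qf_eq_ev {ρ : Op V} (h : ρ.IsPositive) (ψ : Hilb V) (c : Basis W) :
    ev ρ (InnerProductSpace.rankOne ℂ (ket c : Hilb W) ψ) = qf ρ ψ := by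
  obtain ⟨R, rfl⟩ := exists_sqrt h
  rw [ev_sqrt, qf_sqrt, enorm_sq_eq_tsum]
  refine tsum_congr fun b => ?_
  rw [InnerProductSpace.rankOne_apply, enorm_smul, ContinuousLinearMap.adjoint_inner_right]
  have : ‖(ket c : Hilb W)‖ₑ = 1 := by rw [← ofReal_norm, norm_ket]; simp
  rw [this, mul_one, ← inner_conj_symm, RCLike.enorm_conj]

theorem etr_ne_zero_iff {ρ : Op V} (h : ρ.IsPositive) : etr ρ ≠ 0 ↔ ρ ≠ 0 := by
  rw [not_iff_not]
  constructor
  · intro h0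
    obtain ⟨R, rfl⟩ := exists_sqrt h
    simp only [etr, ENNReal.tsum_eq_zero] at h0
    have : R = 0 := clm_ext_ket fun b => by simpa [qf_sqrt] using h0 b
    simp [this]
  · rintro rfl
    simp [etr, qf]

theorem qf_add {ρ σ : Op V} (hρ : ρ.IsPositive) (hσ : σ.IsPositive) (ψ : Hilb V) :
    qf (ρ + σ) ψ = qf ρ ψ + qf σ ψ := by
  rw [qf, qf, qf, ← ENNReal.ofReal_add (hρ.re_inner_nonneg_right ψ) (hσ.re_inner_nonneg_right ψ)]
  simp

theorem etr_add {ρ σ : Op V} (hρ : ρ.IsPositive) (hσ : σ.IsPositive) :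
    etr (ρ + σ) = etr ρ + etr σ := by
  simp_rw [etr, qf_add hρ hσ]
  exact ENNReal.tsum_add

theorem conj_add (X : Hilb V →L[ℂ] Hilb W) (ρ σ : Op V) : conj X (ρ + σ) = conj X ρ + conj X σ := by
  simp [conj, ContinuousLinearMap.add_comp, ContinuousLinearMap.comp_add]

theorem ev_add {ρ σ : Op V} (hρ : ρ.IsPositive) (hσ : σ.IsPositive) (X : Hilb V →L[ℂ] Hilb W) :
    ev (ρ + σ) X = ev ρ X + ev σ X := by
  rw [ev, conj_add, etr_add (isPositive_conj X hρ) (isPositive_conj X hσ), ev, ev]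

theorem IsTC.add {ρ σ : Op V} (hρ : IsTC ρ) (hσ : IsTC σ) : IsTC (ρ + σ) :=
  ⟨hρ.pos.add hσ.pos, by rw [etr_add hρ.pos hσ.pos]; exact ENNReal.add_ne_top.mpr ⟨hρ.fin, hσ.fin⟩⟩

theorem IsTC.zero : IsTC (0 : Op V) := ⟨ContinuousLinearMap.isPositive_zero, by simp [etr, qf]⟩

theorem qf_smul {r : ℝ} (hr : 0 ≤ r) (ρ : Op V) (ψ : Hilb V) :
    qf ((r : ℂ) • ρ) ψ = ENNReal.ofReal r * qf ρ ψ := by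
  rw [qf, qf, ← ENNReal.ofReal_mul hr]
  rw [smul_apply, inner_smul_right]
  simp

theorem etr_smul {r : ℝ} (hr : 0 ≤ r) (ρ : Op V) :
    etr ((r : ℂ) • ρ) = ENNReal.ofReal r * etr ρ := by
  simp_rw [etr, qf_smul hr, ENNReal.tsum_mul_left]

theorem ev_smul {r : ℝ} (hr : 0 ≤ r) (ρ : Op V) (X : Hilb V →L[ℂ] Hilb W) :
    ev ((r : ℂ) • ρ) X = ENNReal.ofReal r * ev ρ X := by
  rw [ev, ev, ← etr_smul hr, conj, conj, ContinuousLinearMap.smul_comp,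
    ContinuousLinearMap.comp_smul]

theorem IsTC.smul {r : ℝ} (hr : 0 ≤ r) {ρ : Op V} (h : IsTC ρ) : IsTC ((r : ℂ) • ρ) :=
  ⟨h.pos.smul_of_nonneg (by exact_mod_cast hr), by
    rw [etr_smul hr]; exact ENNReal.mul_ne_top ENNReal.ofReal_ne_top h.fin⟩

/-- The operator norm of a positive operator is at most its trace. -/
theorem enorm_le_etr {ρ : Op V} (h : ρ.IsPositive) : ‖ρ‖ₑ ≤ etr ρ := by
  obtain ⟨R, rfl⟩ := exists_sqrt h
  have key : ‖R‖ₑ ^ 2 ≤ etr (adjoint R ∘L R) := by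
    rcases eq_or_ne (etr (adjoint R ∘L R)) ∞ with h | hfin
    · simp [h]
    have h1 : ∀ ψ, ‖R ψ‖ ≤ (etr (adjoint R ∘L R)).toReal.sqrt * ‖ψ‖ := by
      intro ψ
      have h2 : ‖R ψ‖ₑ ^ 2 ≤ etr (adjoint R ∘L R) * ‖ψ‖ₑ ^ 2 := by
        rw [← qf_sqrt, etr]
        simp_rw [qf_sqrt]
        rw [tsum_enorm_sq_adjoint, enorm_sq_eq_tsum, ← ENNReal.tsum_mul_right]
        refine ENNReal.tsum_le_tsum fun b => ?_
        rw [← mul_pow, ← ContinuousLinearMap.adjoint_inner_left]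
        gcongr
        rw [← ofReal_norm, ← ofReal_norm, ← ofReal_norm, ← ENNReal.ofReal_mul (norm_nonneg _)]
        exact ENNReal.ofReal_le_ofReal (norm_inner_le_norm _ _)
      have h3 := ENNReal.toReal_mono (ENNReal.mul_ne_top hfin (by simp)) h2
      simp only [ENNReal.toReal_pow, toReal_enorm, ENNReal.toReal_mul] at h3
      have h4 := Real.sqrt_le_sqrt h3
      rwa [Real.sqrt_sq (norm_nonneg _), Real.sqrt_mul ENNReal.toReal_nonneg,
        Real.sqrt_sq (norm_nonneg _)] at h4
    have h5 := ContinuousLinearMap.opNorm_le_bound R (Real.sqrt_nonneg _) h1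
    have h6 : ‖R‖ ^ 2 ≤ (etr (adjoint R ∘L R)).toReal := by
      rw [← Real.sq_sqrt (ENNReal.toReal_nonneg (a := etr (adjoint R ∘L R)))]
      gcongr
    rw [← ofReal_norm, ← ENNReal.ofReal_pow (norm_nonneg _)]
    exact ENNReal.ofReal_le_of_le_toReal h6
  refine le_trans ?_ key
  rw [sq, ← ofReal_norm, ← ofReal_norm, ← ENNReal.ofReal_mul (norm_nonneg _)]
  apply ENNReal.ofReal_le_ofReal
  refine (ContinuousLinearMap.opNorm_comp_le _ _).trans ?_
  rw [LinearIsometryEquiv.norm_map]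

/-- A family of positive operators whose traces have a finite sum is norm-summable; the sum is
positive of finite trace, and its quadratic form is computed termwise. -/
theorem exists_hasSum_of_etr {ι : Type*} {F : ι → Op V} (hF : ∀ i, (F i).IsPositive)
    (hfin : ∑' i, etr (F i) ≠ ∞) : ∃ σ : Op V, HasSum F σ ∧ IsTC σ ∧
      ∀ ψ, qf σ ψ = ∑' i, qf (F i) ψ := by
  have hs : Summable F := by
    apply Summable.of_enorm
    exact ne_top_of_le_ne_top hfin (ENNReal.tsum_le_tsum fun i => enorm_le_etr (hF i))
  obtain ⟨σ, hσ⟩ := hs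
  have hin : ∀ x y : Hilb V, HasSum (fun i => ⟪x, F i y⟫_ℂ) ⟪x, σ y⟫_ℂ := by
    intro x y
    have h1 : HasSum (fun i => F i y) (σ y) := (ContinuousLinearMap.apply ℂ (Hilb V) y).hasSum hσ
    exact (innerSL ℂ x).hasSum h1
  have hre : ∀ x : Hilb V, HasSum (fun i => RCLike.re ⟪x, F i x⟫_ℂ) (RCLike.re ⟪x, σ x⟫_ℂ) :=
    fun x => (RCLike.reCLM (K := ℂ)).hasSum (hin x x)
  have hpos : σ.IsPositive := by
    rw [ContinuousLinearMap.isPositive_iff]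
    refine ⟨fun x y => ?_, fun x => ?_⟩
    · have h1 := hin x y
      have h2 := (hin y x).map (starRingEnd ℂ) RCLike.continuous_conj
      simp only [Function.comp_def, inner_conj_symm] at h2
      have h3 : (fun i => ⟪F i x, y⟫_ℂ) = fun i => ⟪x, F i y⟫_ℂ := by
        funext i; exact (hF i).inner_left_eq_inner_right x y
      rw [h3] at h2
      exact h2.unique h1
    · have h1 : HasSum (fun i => ⟪F i x, x⟫_ℂ) ⟪σ x, x⟫_ℂ := by
        have := (hin x x).map (starRingEnd ℂ) RCLike.continuous_conj
        simpa only [Function.comp_def, inner_conj_symm] using this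
      exact h1.nonneg fun i => (hF i).inner_nonneg_left x
  have hq : ∀ ψ, qf σ ψ = ∑' i, qf (F i) ψ := by
    intro ψ
    rw [qf, ← (hre ψ).tsum_eq,
      ENNReal.ofReal_tsum_of_nonneg (fun i => (hF i).re_inner_nonneg_right ψ) (hre ψ).summable]
    rfl
  refine ⟨σ, hσ, ⟨hpos, ?_⟩, hq⟩
  rw [etr]
  simp_rw [hq]
  rw [ENNReal.tsum_comm]
  exact hfin

/-! ### Slices and cylindrical extensions -/

/-- Restriction of labels to a smaller set of variables. -/
def res (h : S ⊆ V) (x : Basis V) : Basis S := fun v => x ⟨v.1, h v.2⟩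

theorem glue_res (h : S ⊆ V) (x : Basis V) :
    glue (res h x) (res (Finset.sdiff_subset : V \ S ⊆ V) x) = x := by
  funext v
  by_cases hv : v.1 ∈ S <;> simp [glue, res, hv]

theorem res_glue (h : S ⊆ V) (a : Basis S) (c : Basis (V \ S)) : res h (glue a c) = a := by
  funext v
  simp [glue, res, v.2]

theorem rest_glue (a : Basis S) (c : Basis (V \ S)) :
    res (Finset.sdiff_subset : V \ S ⊆ V) (glue a c) = c := by
  funext v
  have : v.1 ∉ S := (Finset.mem_sdiff.mp v.2).2
  simp [glue, res, this]

/-- Labels on `V ⊇ S` are pairs of labels on `S` and on `V \ S`. -/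
def glueEquiv (h : S ⊆ V) : Basis S × Basis (V \ S) ≃ Basis V where
  toFun p := glue p.1 p.2
  invFun x := (res h x, res Finset.sdiff_subset x)
  left_inv p := by simp [res_glue, rest_glue]
  right_inv x := glue_res h x

theorem glue_inj (h : S ⊆ V) {a a' : Basis S} {c c' : Basis (V \ S)} :
    glue a c = glue a' c' ↔ a = a' ∧ c = c' := by
  rw [← Prod.mk_inj]
  exact (glueEquiv h).injective.eq_iff (a := (a, c)) (b := (a', c'))

theorem sliceL_ket (h : S ⊆ V) (c : Basis (V \ S)) (a : Basis S) :
    sliceL h c (ket a) = ket (glue a c) := by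
  classical
  have h1 : (ket a : Hilb S) = lp.single 2 a (1 : ℂ) := by
    rw [ket_eq, ← (stdBasis S).repr_symm_single]
    rfl
  rw [h1]
  change slice h c _ = _
  rw [slice, OrthogonalFamily.linearIsometry_apply_single]
  simp [ket_eq]

theorem sliceL_eq_slice (h : S ⊆ V) (c : Basis (V \ S)) (x : Hilb S) :
    sliceL h c x = slice h c x := rfl

theorem adjoint_sliceL_comp_self (h : S ⊆ V) (c : Basis (V \ S)) (x : Hilb S) :
    adjoint (sliceL h c) (sliceL h c x) = x := by
  refine ext_inner_left ℂ fun y => ?_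
  rw [ContinuousLinearMap.adjoint_inner_right]
  exact (slice h c).inner_map_map y x

theorem adjoint_sliceL_comp_ne (h : S ⊆ V) {c d : Basis (V \ S)} (hcd : c ≠ d) (x : Hilb S) :
    adjoint (sliceL h c) (sliceL h d x) = 0 := by
  have : adjoint (sliceL h c) ∘L sliceL h d = 0 := by
    refine clm_ext_ket fun b => ext_inner_ket fun a => ?_
    rw [ContinuousLinearMap.comp_apply, ContinuousLinearMap.adjoint_inner_right, sliceL_ket,
      sliceL_ket, inner_ket_ket, if_neg]
    · simp
    · rw [glue_inj h]
      exact fun hh => hcd hh.2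
  exact DFunLike.congr_fun this x

theorem enorm_sq_eq_tsum_slice (h : S ⊆ V) (ψ : Hilb V) :
    ‖ψ‖ₑ ^ 2 = ∑' c : Basis (V \ S), ‖adjoint (sliceL h c) ψ‖ₑ ^ 2 := by
  simp_rw [enorm_sq_eq_tsum]
  rw [← (glueEquiv h).tsum_eq, ENNReal.tsum_prod', ENNReal.tsum_comm]
  refine tsum_congr fun c => tsum_congr fun a => ?_
  rw [ContinuousLinearMap.adjoint_inner_right, sliceL_ket]
  rfl

theorem ext_slice (h : S ⊆ V) {x y : Hilb V}
    (hxy : ∀ c, adjoint (sliceL h c) x = adjoint (sliceL h c) y) : x = y := by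
  refine ext_inner_ket fun b => ?_
  rw [← glue_res h b, ← sliceL_ket h, ← ContinuousLinearMap.adjoint_inner_right, hxy,
    ContinuousLinearMap.adjoint_inner_right]

theorem orthogonalFamily_slice (h : S ⊆ V) :
    OrthogonalFamily ℂ (fun _ : Basis (V \ S) => Hilb S) (fun c => slice h c) := by
  intro c d hcd x y
  change ⟪sliceL h c x, sliceL h d y⟫_ℂ = 0
  rw [← ContinuousLinearMap.adjoint_inner_right, adjoint_sliceL_comp_ne h hcd, inner_zero_right]

/-- The cylindrical extension exists: its defining sum converges strongly. -/
theorem exists_cyl (h : S ⊆ V) (A : Op S) : ∃ T : Op V, ∀ ψ, HasSum (fun c : Basis (V \ S) =>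
    (sliceL h c ∘L A ∘L adjoint (sliceL h c)) ψ) (T ψ) := by
  have hle : ∀ ψ : Hilb V, ∑' c, ‖A (adjoint (sliceL h c) ψ)‖ₑ ^ 2 ≤ ‖A‖ₑ ^ 2 * ‖ψ‖ₑ ^ 2 := by
    intro ψ
    rw [enorm_sq_eq_tsum_slice h ψ, ← ENNReal.tsum_mul_left]
    refine ENNReal.tsum_le_tsum fun c => ?_
    rw [← mul_pow]
    gcongr
    exact A.le_opENorm _
  have hsum : ∀ ψ : Hilb V, Summable fun c : Basis (V \ S) =>
      (sliceL h c ∘L A ∘L adjoint (sliceL h c)) ψ := by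
    intro ψ
    refine ((orthogonalFamily_slice h).summable_iff_norm_sq_summable
      (fun c => A (adjoint (sliceL h c) ψ))).mpr ?_
    have hne : ∑' c, ‖A (adjoint (sliceL h c) ψ)‖ₑ ^ 2 ≠ ∞ :=
      ne_top_of_le_ne_top (ENNReal.mul_ne_top (by simp) (by simp)) (hle ψ)
    have := ENNReal.summable_toReal hne
    simpa using this
  let L : Hilb V →ₗ[ℂ] Hilb V :=
    { toFun := fun ψ => ∑' c : Basis (V \ S), (sliceL h c ∘L A ∘L adjoint (sliceL h c)) ψ
      map_add' := fun x y => by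
        simp_rw [map_add]
        exact (hsum x).tsum_add (hsum y)
      map_smul' := fun r x => by
        simp_rw [map_smul]
        exact (hsum x).tsum_const_smul r }
  have hL : ∀ ψ c, adjoint (sliceL h c) (L ψ) = A (adjoint (sliceL h c) ψ) := by
    intro ψ c
    have h1 := (adjoint (sliceL h c)).hasSum (hsum ψ).hasSum
    refine h1.unique ?_
    convert hasSum_single c ?_ using 1
    · simp [adjoint_sliceL_comp_self]
    · intro d hd
      simp [adjoint_sliceL_comp_ne h hd.symm]
  have hb : ∀ ψ, ‖L ψ‖ ≤ ‖A‖ * ‖ψ‖ := by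
    intro ψ
    have h1 := hle ψ
    simp_rw [← hL] at h1
    rw [← enorm_sq_eq_tsum_slice, ← mul_pow] at h1
    have h2 := (ENNReal.pow_le_pow_left_iff (by norm_num)).mp h1
    have h3 := ENNReal.toReal_mono (ENNReal.mul_ne_top (by simp) (by simp)) h2
    simpa using h3
  exact ⟨L.mkContinuous ‖A‖ hb, fun ψ => (hsum ψ).hasSum⟩

theorem hasSum_cyl (h : S ⊆ V) (A : Op S) (ψ : Hilb V) : HasSum (fun c : Basis (V \ S) =>
    (sliceL h c ∘L A ∘L adjoint (sliceL h c)) ψ) (cyl V A ψ) := by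
  rw [cyl, dif_pos h, sotSum, dif_pos (exists_cyl h A)]
  exact (exists_cyl h A).choose_spec ψ

/-- The cylindrical extension is characterized by commuting with slicing. -/
theorem adjoint_sliceL_cyl (h : S ⊆ V) (A : Op S) (c : Basis (V \ S)) (ψ : Hilb V) :
    adjoint (sliceL h c) (cyl V A ψ) = A (adjoint (sliceL h c) ψ) := by
  have h1 := (adjoint (sliceL h c)).hasSum (hasSum_cyl h A ψ)
  refine h1.unique ?_
  convert hasSum_single c ?_ using 1
  · simp [adjoint_sliceL_comp_self]
  · intro d hd
    simp [adjoint_sliceL_comp_ne h hd.symm]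

theorem eq_cyl (h : S ⊆ V) {A : Op S} {X : Op V}
    (hX : ∀ c ψ, adjoint (sliceL h c) (X ψ) = A (adjoint (sliceL h c) ψ)) : X = cyl V A := by
  ext1 ψ
  exact ext_slice h fun c => by rw [hX, adjoint_sliceL_cyl]

theorem cyl_sliceL (h : S ⊆ V) (A : Op S) (c : Basis (V \ S)) (x : Hilb S) :
    cyl V A (sliceL h c x) = sliceL h c (A x) := by
  refine ext_slice h fun d => ?_
  rw [adjoint_sliceL_cyl]
  rcases eq_or_ne d c with rfl | hd
  · rw [adjoint_sliceL_comp_self, adjoint_sliceL_comp_self]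
  · rw [adjoint_sliceL_comp_ne h hd, adjoint_sliceL_comp_ne h hd, map_zero]

theorem enorm_sq_cyl (h : S ⊆ V) (A : Op S) (ψ : Hilb V) :
    ‖cyl V A ψ‖ₑ ^ 2 = ∑' c : Basis (V \ S), ‖A (adjoint (sliceL h c) ψ)‖ₑ ^ 2 := by
  simp_rw [enorm_sq_eq_tsum_slice h, adjoint_sliceL_cyl]

theorem cyl_one (h : S ⊆ V) : cyl V (1 : Op S) = 1 := (eq_cyl h fun _ _ => rfl).symm

theorem cyl_mul (h : S ⊆ V) (A B : Op S) : cyl V (A * B) = cyl V A * cyl V B :=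
  (eq_cyl h fun c ψ => by
    rw [mul_apply_eq_comp, mul_apply_eq_comp, adjoint_sliceL_cyl,
      adjoint_sliceL_cyl]).symm

theorem adjoint_cyl (h : S ⊆ V) (A : Op S) : adjoint (cyl V A) = cyl V (adjoint A) :=
  eq_cyl h fun c ψ => by
    refine ext_inner_left ℂ fun x => ?_
    rw [ContinuousLinearMap.adjoint_inner_right, ContinuousLinearMap.adjoint_inner_right,
      cyl_sliceL, ContinuousLinearMap.adjoint_inner_right, ContinuousLinearMap.adjoint_inner_right]

theorem sliceL_trans (h : S ⊆ W) (h' : W ⊆ V) (c : Basis (V \ S)) :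
    sliceL (h.trans h') c = sliceL h' (res (Finset.sdiff_subset_sdiff subset_rfl h) c) ∘L
      sliceL h (res (Finset.sdiff_subset_sdiff h' subset_rfl) c) := by
  refine clm_ext_ket fun a => ?_
  rw [ContinuousLinearMap.comp_apply, sliceL_ket, sliceL_ket, sliceL_ket]
  congr 1
  funext v
  by_cases hS : v.1 ∈ S
  · simp [glue, hS, h hS]
  · by_cases hW : v.1 ∈ W <;> simp [glue, hS, hW, res]

theorem cyl_cyl (h : S ⊆ W) (h' : W ⊆ V) (A : Op S) : cyl V (cyl W A) = cyl V A :=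
  eq_cyl (h.trans h') fun c ψ => by
    rw [sliceL_trans h h', ContinuousLinearMap.adjoint_comp, ContinuousLinearMap.comp_apply,
      ContinuousLinearMap.comp_apply, adjoint_sliceL_cyl, adjoint_sliceL_cyl]

theorem adjoint_sliceL_ket (h : S ⊆ V) (c : Basis (V \ S)) (x : Basis V) [Decidable (res Finset.sdiff_subset x = c)] :
    adjoint (sliceL h c) (ket x) = if res Finset.sdiff_subset x = c then ket (res h x) else 0 := by
  conv_lhs => rw [← glue_res h x, ← sliceL_ket h]
  split_ifs with hc
  · rw [hc, adjoint_sliceL_comp_self]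
  · rw [adjoint_sliceL_comp_ne h (Ne.symm hc)]

/-! ### Matrix entries and tensor products -/

/-- The matrix entry `⟨x|A|y⟩`. -/
def entry (A : Op S) (x y : Basis S) : ℂ := ⟪ket x, A (ket y)⟫_ℂ

theorem ext_entry {A B : Op S} (h : ∀ x y, entry A x y = entry B x y) : A = B :=
  clm_ext_ket fun y => ext_inner_ket fun x => h x y

open Classical in
/-- The entries of `A ⊗ I`. -/
theorem entry_cyl (h : S ⊆ V) (A : Op S) (x y : Basis V) : entry (cyl V A) x y =
    if ∀ v : V, v.1 ∉ S → x v = y v then entry A (res h x) (res h y) else 0 := by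
  rw [entry]
  conv_lhs => rw [← glue_res h x, ← sliceL_ket h, ← ContinuousLinearMap.adjoint_inner_right,
    adjoint_sliceL_cyl, adjoint_sliceL_ket]
  have : (res (Finset.sdiff_subset : V \ S ⊆ V) y = res Finset.sdiff_subset x) ↔
      ∀ v : V, v.1 ∉ S → x v = y v := by
    constructor
    · intro hh v hv
      exact (congrFun hh ⟨v.1, Finset.mem_sdiff.mpr ⟨v.2, hv⟩⟩).symm
    · intro hh
      funext v
      exact (hh ⟨v.1, _⟩ (Finset.mem_sdiff.mp v.2).2).symm
  simp only [this]
  split_ifs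
  · rfl
  · simp

theorem hasSum_entry_mul (A B : Op S) (x y : Basis S) :
    HasSum (fun z => entry A x z * entry B z y) (entry (A * B) x y) := by
  have := (stdBasis S).hasSum_inner_mul_inner (adjoint A (ket x)) (B (ket y))
  simp only [ContinuousLinearMap.adjoint_inner_left] at this
  exact this

open Classical in
/-- The entries of `A ⊗ B ⊗ I`. -/
theorem entry_cyl_mul_cyl (hS : S ⊆ V) (hT : T ⊆ V) (hST : Disjoint S T) (A : Op S) (B : Op T)
    (x y : Basis V) : entry (cyl V A * cyl V B) x y =
      if ∀ v : V, v.1 ∉ S → v.1 ∉ T → x v = y v then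
        entry A (res hS x) (res hS y) * entry B (res hT x) (res hT y) else 0 := by
  refine (hasSum_entry_mul _ _ x y).unique ?_
  let z : Basis V := fun v => if v.1 ∈ S then y v else x v
  convert hasSum_single z ?_ using 1
  · have h1 : ∀ v : V, v.1 ∉ S → x v = z v := fun v hv => by simp [z, hv]
    have h2 : res hS z = res hS y := by funext v; simp [z, res, v.2]
    have h3 : res hT z = res hT x := by
      funext v
      simp [z, res, Finset.disjoint_right.mp hST v.2]
    rw [entry_cyl hS, entry_cyl hT, if_pos h1, h2, h3]
    have h4 : (∀ v : V, v.1 ∉ T → z v = y v) ↔ ∀ v : V, v.1 ∉ S → v.1 ∉ T → x v = y v := by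
      constructor
      · intro hh v h5 h6
        rw [← hh v h6]
        simp [z, h5]
      · intro hh v h6
        by_cases h5 : v.1 ∈ S
        · simp [z, h5]
        · simp [z, h5, hh v h5 h6]
    simp only [h4]
    split_ifs <;> simp
  · intro w hw
    rw [entry_cyl hS, entry_cyl hT]
    by_contra hne
    apply hw
    have h1 : ∀ v : V, v.1 ∉ S → x v = w v := by
      by_contra hh
      rw [if_neg hh, zero_mul] at hne
      exact hne rfl
    have h2 : ∀ v : V, v.1 ∉ T → w v = y v := by
      by_contra hh
      rw [if_neg hh, mul_zero] at hne
      exact hne rfl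
    funext v
    by_cases h5 : v.1 ∈ S
    · simp [z, h5, h2 v (Finset.disjoint_left.mp hST h5)]
    · simp [z, h5, h1 v h5]

theorem cyl_commute (hS : S ⊆ V) (hT : T ⊆ V) (hST : Disjoint S T) (A : Op S) (B : Op T) :
    cyl V A * cyl V B = cyl V B * cyl V A := by
  classical
  refine ext_entry fun x y => ?_
  rw [entry_cyl_mul_cyl hS hT hST, entry_cyl_mul_cyl hT hS hST.symm]
  have : (∀ v : V, v.1 ∉ S → v.1 ∉ T → x v = y v) ↔ ∀ v : V, v.1 ∉ T → v.1 ∉ S → x v = y v :=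
    forall_congr' fun _ => ⟨fun h a b => h b a, fun h a b => h b a⟩
  simp only [this, mul_comm]

theorem ofReal_qf_ket {ρ : Op V} (h : ρ.IsPositive) (x : Basis V) :
    qf ρ (ket x) = ‖entry ρ x x‖ₑ := by
  have h1 : entry ρ x x = _ := (ofReal_qf h (ket x)).symm
  rw [h1, ← ofReal_norm, Complex.norm_real, Real.norm_of_nonneg ENNReal.toReal_nonneg,
    ENNReal.ofReal_toReal]
  simp [qf]

/-- Labels on a disjoint union are pairs of labels. -/
def unionEquiv (hST : Disjoint S T) : Basis S × Basis T ≃ Basis (S ∪ T) where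
  toFun p := fun v => if h : v.1 ∈ S then p.1 ⟨v.1, h⟩ else
    p.2 ⟨v.1, (Finset.mem_union.mp v.2).resolve_left h⟩
  invFun x := (res Finset.subset_union_left x, res Finset.subset_union_right x)
  left_inv p := by
    ext v
    · simp [res, v.2]
    · simp [res, Finset.disjoint_right.mp hST v.2]
  right_inv x := by
    funext v
    by_cases hv : v.1 ∈ S <;> simp [res, hv]

theorem etr_tensor (hST : Disjoint S T) {A : Op S} {B : Op T} (hA : A.IsPositive)
    (hB : B.IsPositive) (hAB : (tensor A B).IsPositive) : etr (tensor A B) = etr A * etr B := by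
  classical
  rw [etr, ← (unionEquiv hST).tsum_eq, ENNReal.tsum_prod', etr, ← ENNReal.tsum_mul_right]
  refine tsum_congr fun a => ?_
  rw [etr, ← ENNReal.tsum_mul_left]
  refine tsum_congr fun b => ?_
  rw [ofReal_qf_ket hAB, ofReal_qf_ket hA, ofReal_qf_ket hB]
  change ‖entry (cyl (S ∪ T) A * cyl (S ∪ T) B) _ _‖ₑ = _
  have h1 := (unionEquiv hST).left_inv (a, b)
  rw [entry_cyl_mul_cyl Finset.subset_union_left Finset.subset_union_right hST, if_pos, enorm_mul]
  · have h2 : res Finset.subset_union_left ((unionEquiv hST) (a, b)) = a := congrArg Prod.fst h1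
    have h3 : res Finset.subset_union_right ((unionEquiv hST) (a, b)) = b := congrArg Prod.snd h1
    rw [h2, h3]
  · intros; rfl

theorem isPositive_tensor (hST : Disjoint S T) {A : Op S} {B : Op T} (hA : A.IsPositive)
    (hB : B.IsPositive) : (tensor A B).IsPositive := by
  obtain ⟨R, rfl⟩ := exists_sqrt hA
  obtain ⟨Q, rfl⟩ := exists_sqrt hB
  have l := (Finset.subset_union_left : S ⊆ S ∪ T)
  have r := (Finset.subset_union_right : T ⊆ S ∪ T)
  have : tensor (adjoint R ∘L R) (adjoint Q ∘L Q) =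
      adjoint (cyl (S ∪ T) R * cyl (S ∪ T) Q) ∘L (cyl (S ∪ T) R * cyl (S ∪ T) Q) := by
    change cyl (S ∪ T) (adjoint R * R) * cyl (S ∪ T) (adjoint Q * Q) = _ * _
    have e : adjoint (cyl (S ∪ T) R * cyl (S ∪ T) Q) =
        cyl (S ∪ T) (adjoint Q) * cyl (S ∪ T) (adjoint R) := by
      rw [← adjoint_cyl r, ← adjoint_cyl l]
      exact ContinuousLinearMap.adjoint_comp _ _
    rw [e, cyl_mul l, cyl_mul r, ← cyl_commute l r hST (adjoint R) (adjoint Q)]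
    simp only [mul_assoc]
    rw [← mul_assoc (cyl _ R), cyl_commute l r hST R (adjoint Q), mul_assoc]
  rw [this]
  exact ContinuousLinearMap.isPositive_adjoint_comp_self _

theorem conj_tensor (hST : Disjoint S T) (A ρ : Op S) (B σ : Op T) :
    conj (cyl (S ∪ T) A * cyl (S ∪ T) B) (tensor ρ σ) = tensor (conj A ρ) (conj B σ) := by
  have l := (Finset.subset_union_left : S ⊆ S ∪ T)
  have r := (Finset.subset_union_right : T ⊆ S ∪ T)
  have e : adjoint (cyl (S ∪ T) A * cyl (S ∪ T) B) =
      cyl (S ∪ T) (adjoint A) * cyl (S ∪ T) (adjoint B) := by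
    rw [cyl_commute l r hST, ← adjoint_cyl r, ← adjoint_cyl l]
    exact ContinuousLinearMap.adjoint_comp _ _
  change (cyl (S ∪ T) A * cyl (S ∪ T) B) * ((cyl (S ∪ T) ρ * cyl (S ∪ T) σ) * adjoint _) =
    cyl (S ∪ T) (A * (ρ * adjoint A)) * cyl (S ∪ T) (B * (σ * adjoint B))
  rw [e, cyl_mul l, cyl_mul l, cyl_mul r, cyl_mul r]
  have c := fun (X : Op S) (Y : Op T) => cyl_commute l r hST X Y
  have c' := fun (X : Op S) (Y : Op T) (Z : Op (S ∪ T)) => by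
    have := congrArg (· * Z) (c X Y)
    simpa only [mul_assoc] using this
  simp only [mul_assoc, ← c']

/-! ### Restriction of states -/

/-- Positive operators are determined by their weights. -/
theorem eq_of_ev_eq {ρ σ : Op V} (hρ : ρ.IsPositive) (hσ : σ.IsPositive)
    (h : ∀ A : Op V, ev ρ A = ev σ A) : ρ = σ :=
  eq_of_qf_eq hρ hσ fun ψ => by
    rw [← qf_eq_ev hρ ψ (zeros V), ← qf_eq_ev hσ ψ (zeros V), h]

theorem ev_cyl_eq_tsum {ρ : Op V} (hρ : ρ.IsPositive) (h : S ⊆ V) (A : Op S) :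
    ev ρ (cyl V A) = ∑' c, ev ρ (A ∘L adjoint (sliceL h c)) := by
  refine (ev_eq_tsum hρ (fun c => A ∘L adjoint (sliceL h c)) _ fun ψ => ?_).symm
  rw [enorm_sq_cyl h]
  rfl

/-- Partial traces exist: their defining sums converge in norm. -/
theorem exists_isPartialTrace (h : S ⊆ V) {ρ : Op V} (hρ : IsTC ρ) :
    ∃ σ : Op S, IsPartialTrace h ρ σ ∧ IsTC σ ∧ ∀ A : Op S, ev σ A = ev ρ (cyl V A) := by
  have h1 : ∑' c, etr (conj (adjoint (sliceL h c)) ρ) = etr ρ := by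
    rw [← ev_one, ← cyl_one h, ev_cyl_eq_tsum hρ.pos h]
    rfl
  obtain ⟨σ, hσ, hσ', hq⟩ := exists_hasSum_of_etr
    (fun c => isPositive_conj (adjoint (sliceL h c)) hρ.pos) (by rw [h1]; exact hρ.fin)
  refine ⟨σ, ?_, hσ', fun A => ?_⟩
  · simpa only [IsPartialTrace, conj, ContinuousLinearMap.adjoint_adjoint] using hσ
  · rw [ev_cyl_eq_tsum hρ.pos h, ev, etr]
    simp_rw [qf_conj, hq, qf_conj]
    rw [ENNReal.tsum_comm]
    refine tsum_congr fun c => tsum_congr fun b => ?_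
    rw [qf_conj, ContinuousLinearMap.adjoint_comp, ContinuousLinearMap.comp_apply]

/-- A partial trace assigns the same weights to operators on the smaller set of variables. -/
theorem ev_of_isPartialTrace {h : S ⊆ V} {ρ : Op V} (hρ : IsTC ρ) {σ : Op S}
    (hσ : IsPartialTrace h ρ σ) (A : Op S) : ev σ A = ev ρ (cyl V A) := by
  obtain ⟨τ, h1, _, h3⟩ := exists_isPartialTrace h hρ
  rw [hσ.unique h1, h3]

theorem hasSum_trace {ρ : Op V} (hρ : IsTC ρ) :
    HasSum (fun b : Basis V => ⟪ket b, ρ (ket b)⟫_ℂ) ((etr ρ).toReal : ℂ) := by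
  simp_rw [← ofReal_qf hρ.pos]
  rw [Complex.hasSum_ofReal, etr, ENNReal.tsum_toReal_eq (fun b => by simp [qf])]
  exact (ENNReal.summable_toReal hρ.fin).hasSum

theorem State.etr_eq_one (ρ : State V) : etr ρ.op = 1 := by
  have h := ρ.hasTrace
  simp_rw [← ofReal_qf ρ.isPositive] at h
  rw [← Complex.ofReal_one, Complex.hasSum_ofReal] at h
  rw [etr, ← ENNReal.ofReal_one, ← h.tsum_eq,
    ENNReal.ofReal_tsum_of_nonneg (fun _ => ENNReal.toReal_nonneg) h.summable]
  refine tsum_congr fun b => ?_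
  rw [ENNReal.ofReal_toReal]
  simp [qf]

theorem State.isTC (ρ : State V) : IsTC ρ.op := ⟨ρ.isPositive, by simp [ρ.etr_eq_one]⟩

/-- A positive operator of trace one as a state. -/
def mkState {ρ : Op V} (hρ : IsTC ρ) (h : etr ρ = 1) : State V :=
  ⟨ρ, hρ.pos, by simpa [h] using hasSum_trace hρ⟩

theorem State.ext_op {ρ σ : State V} (h : ρ.op = σ.op) : ρ = σ := by
  cases ρ; cases σ; congr

theorem exists_restrict (ρ : State V) (h : S ⊆ V) : ∃ σ : State S, Below σ ρ := by
  obtain ⟨σ, h1, h2, h3⟩ := exists_isPartialTrace h ρ.isTC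
  refine ⟨mkState h2 ?_, h, h1⟩
  rw [← ev_one, h3, cyl_one h, ev_one, ρ.etr_eq_one]

/-- The order on states in terms of weights. -/
theorem below_iff {σ : State S} {ρ : State V} :
    Below σ ρ ↔ S ⊆ V ∧ ∀ A : Op S, ev σ.op A = ev ρ.op (cyl V A) := by
  constructor
  · rintro ⟨h, hp⟩
    exact ⟨h, ev_of_isPartialTrace ρ.isTC hp⟩
  · rintro ⟨h, hA⟩
    obtain ⟨τ, hτ, hp⟩ := exists_restrict ρ h
    have : σ = τ := State.ext_op <| eq_of_ev_eq σ.isPositive τ.isPositive fun A => by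
      rw [hA, ev_of_isPartialTrace ρ.isTC hp]
    exact this ▸ ⟨hτ, hp⟩

/-! ### Products of states -/

theorem cyl_smul (h : S ⊆ V) (r : ℂ) (A : Op S) : cyl V (r • A) = r • cyl V A :=
  (eq_cyl h fun c ψ => by simp [adjoint_sliceL_cyl]).symm

theorem eq_iff_res (x y : Basis (S ∪ T)) : x = y ↔
    res Finset.subset_union_left x = res Finset.subset_union_left y ∧
      res Finset.subset_union_right x = res Finset.subset_union_right y := by
  refine ⟨fun h => by rw [h]; exact ⟨rfl, rfl⟩, fun ⟨h1, h2⟩ => ?_⟩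
  funext v
  rcases Finset.mem_union.mp v.2 with hv | hv
  · exact congrFun h1 ⟨v.1, hv⟩
  · exact congrFun h2 ⟨v.1, hv⟩

/-- A positive operator on a disjoint union is determined by the weights of product operators. -/
theorem eq_of_ev_cyl_mul_cyl (hST : Disjoint S T) {w t : Op (S ∪ T)} (hw : w.IsPositive)
    (ht : t.IsPositive) (h : ∀ (A : Op S) (B : Op T), ev w (cyl (S ∪ T) A * cyl (S ∪ T) B) =
      ev t (cyl (S ∪ T) A * cyl (S ∪ T) B)) : w = t := by
  classical
  have l := (Finset.subset_union_left : S ⊆ S ∪ T)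
  have r := (Finset.subset_union_right : T ⊆ S ∪ T)
  let o : Basis (S ∪ T) := zeros _
  -- the product vector `φ ⊗ k`
  let p : Hilb S → Hilb T → Hilb (S ∪ T) := fun φ k =>
    cyl (S ∪ T) (InnerProductSpace.rankOne ℂ φ (ket (res l o)))
      (cyl (S ∪ T) (InnerProductSpace.rankOne ℂ k (ket (res r o))) (ket o))
  have entry_p : ∀ φ k x y, entry (cyl (S ∪ T) (InnerProductSpace.rankOne ℂ φ (ket (res l o))) *
      cyl (S ∪ T) (InnerProductSpace.rankOne ℂ k (ket (res r o)))) x y =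
      if y = o then ⟪ket (res l x), φ⟫_ℂ * ⟪ket (res r x), k⟫_ℂ else 0 := by
    intro φ k x y
    rw [entry_cyl_mul_cyl l r hST, if_pos]
    · simp only [entry, InnerProductSpace.rankOne_apply, inner_smul_right, inner_ket_ket]
      have h0 := eq_iff_res y o
      by_cases h1 : res l o = res l y
      · by_cases h2 : res r o = res r y
        · rw [if_pos h1, if_pos h2, if_pos (h0.mpr ⟨h1.symm, h2.symm⟩), one_mul, one_mul]
        · rw [if_neg h2, if_neg fun hh => h2 (h0.mp hh).2.symm, zero_mul, mul_zero]
      · rw [if_neg h1, if_neg fun hh => h1 (h0.mp hh).1.symm, zero_mul, zero_mul]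
    · intro v h1 h2
      exact absurd v.2 fun hh => (Finset.mem_union.mp hh).elim h1 h2
  have inner_p : ∀ φ k x, ⟪ket x, p φ k⟫_ℂ = ⟪ket (res l x), φ⟫_ℂ * ⟪ket (res r x), k⟫_ℂ :=
    fun φ k x => (entry_p φ k x o).trans (if_pos rfl)
  have qf_p : ∀ φ k, qf w (p φ k) = qf t (p φ k) := by
    have key : ∀ u : Op (S ∪ T), ∀ φ k, ev u (cyl (S ∪ T) (InnerProductSpace.rankOne ℂ (ket (res l o)) φ) *
        cyl (S ∪ T) (InnerProductSpace.rankOne ℂ (ket (res r o)) k)) = qf u (p φ k) := by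
      intro u φ k
      have hadj : adjoint (cyl (S ∪ T) (InnerProductSpace.rankOne ℂ (ket (res l o)) φ) *
        cyl (S ∪ T) (InnerProductSpace.rankOne ℂ (ket (res r o)) k)) =
          cyl (S ∪ T) (InnerProductSpace.rankOne ℂ φ (ket (res l o))) *
          cyl (S ∪ T) (InnerProductSpace.rankOne ℂ k (ket (res r o))) := by
        rw [cyl_commute l r hST, ← InnerProductSpace.adjoint_rankOne (ket (res l o)) φ,
          ← adjoint_cyl l, ← InnerProductSpace.adjoint_rankOne (ket (res r o)) k, ← adjoint_cyl r]
        exact ContinuousLinearMap.adjoint_comp _ _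
      rw [ev, etr, tsum_eq_single o]
      · rw [qf_conj, hadj]; rfl
      · intro y hy
        rw [qf_conj, hadj]
        have : (cyl (S ∪ T) (InnerProductSpace.rankOne ℂ φ (ket (res l o))) *
          cyl (S ∪ T) (InnerProductSpace.rankOne ℂ k (ket (res r o)))) (ket y) = 0 :=
          ext_inner_ket fun x => by
            rw [inner_zero_right]
            exact (entry_p φ k x y).trans (if_neg hy)
        rw [this]
        simp [qf]
    intro φ k
    rw [← key, ← key, h]
  let D : Hilb (S ∪ T) →ₗ[ℂ] Hilb (S ∪ T) := ((w - t : Op (S ∪ T)) : _ →ₗ[ℂ] _)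
  have hD : ∀ φ k, ⟪D (p φ k), p φ k⟫_ℂ = 0 := by
    intro φ k
    have h1 := ofReal_qf hw (p φ k)
    have h2 := ofReal_qf ht (p φ k)
    rw [qf_p, h2] at h1
    rw [← inner_conj_symm]
    simp [D, inner_sub_right, h1]
  have p_add : ∀ φ φ' k, p (φ + φ') k = p φ k + p φ' k := fun φ φ' k =>
    ext_inner_ket fun x => by simp only [inner_add_right, inner_p, add_mul]
  have p_smul : ∀ (c : ℂ) φ k, p (c • φ) k = c • p φ k := fun c φ k =>
    ext_inner_ket fun x => by simp only [inner_smul_right, inner_p, mul_assoc]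
  have p_add' : ∀ φ k k', p φ (k + k') = p φ k + p φ k' := fun φ k k' =>
    ext_inner_ket fun x => by simp only [inner_add_right, inner_p, mul_add]
  have p_smul' : ∀ (c : ℂ) φ k, p φ (c • k) = c • p φ k := fun c φ k =>
    ext_inner_ket fun x => by simp only [inner_smul_right, inner_p]; ring
  have p_sub : ∀ φ φ' k, p (φ - φ') k = p φ k - p φ' k := fun φ φ' k =>
    ext_inner_ket fun x => by simp only [inner_sub_right, inner_p, sub_mul]
  -- polarization in the first factor, then in the second one
  have h1 : ∀ φ φ' k, ⟪D (p φ' k), p φ k⟫_ℂ = 0 := by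
    intro φ φ' k
    rw [inner_map_polarization, ← p_add, ← p_sub, ← p_smul, ← p_add, ← p_sub, hD, hD, hD, hD]
    simp
  have h2 : ∀ φ φ' k k', ⟪D (p φ' k'), p φ k⟫_ℂ = 0 := by
    intro φ φ' k k'
    have e1 := h1 φ φ' (k + k')
    have e2 := h1 φ φ' (k + Complex.I • k')
    simp only [p_add', p_smul', map_add, map_smul, inner_add_left, inner_add_right,
      inner_smul_left, inner_smul_right, h1, Complex.conj_I] at e1 e2
    have e3 := congrArg (Complex.I * ·) e2
    simp only [mul_add] at e3
    ring_nf at e3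
    simp only [Complex.I_sq] at e3
    linear_combination (e1 + e3) / 2
  refine ext_entry fun x y => ?_
  have ket_p : ∀ x, ket x = p (ket (res l x)) (ket (res r x)) := by
    intro x
    refine ext_inner_ket fun y => ?_
    rw [inner_p, inner_ket_ket, inner_ket_ket, inner_ket_ket]
    by_cases h1 : res l y = res l x
    · by_cases h2 : res r y = res r x
      · rw [if_pos h1, if_pos h2, if_pos ((eq_iff_res y x).mpr ⟨h1, h2⟩), one_mul]
      · rw [if_neg h2, if_neg fun hh => h2 ((eq_iff_res y x).mp hh).2, mul_zero]
    · rw [if_neg h1, if_neg fun hh => h1 ((eq_iff_res y x).mp hh).1, zero_mul]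
  have h3 := h2 (ket (res l x)) (ket (res l y)) (ket (res r x)) (ket (res r y))
  rw [← ket_p, ← ket_p] at h3
  have h5 : ⟪ket x, w (ket y) - t (ket y)⟫_ℂ = 0 := inner_eq_zero_symm.mp h3
  rwa [inner_sub_right, sub_eq_zero] at h5

theorem ev_tensor (hST : Disjoint S T) {y : Op S} {z : Op T} (hy : y.IsPositive)
    (hz : z.IsPositive) (A : Op S) (B : Op T) :
    ev (tensor y z) (cyl (S ∪ T) A * cyl (S ∪ T) B) = ev y A * ev z B := by
  rw [ev, conj_tensor hST, etr_tensor hST (isPositive_conj A hy) (isPositive_conj B hz)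
    (isPositive_tensor hST (isPositive_conj A hy) (isPositive_conj B hz))]
  rfl

/-- Composition of states in terms of weights. -/
theorem isComp_iff {y : State S} {z : State T} {w : State (S ∪ T)} : IsComp y z w ↔
    Disjoint S T ∧ ∀ (A : Op S) (B : Op T),
      ev w.op (cyl (S ∪ T) A * cyl (S ∪ T) B) = ev y.op A * ev z.op B := by
  refine and_congr_right fun hST => ⟨fun h A B => ?_, fun h => ?_⟩
  · rw [h, ev_tensor hST y.isPositive z.isPositive]
  · refine eq_of_ev_cyl_mul_cyl hST w.isPositive
      (isPositive_tensor hST y.isPositive z.isPositive) fun A B => ?_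
    rw [h, ev_tensor hST y.isPositive z.isPositive]

/-! ### Projections -/

/-- The projection onto the orthocomplement of `K`. -/
def perp (K : ClosedSubmodule ℂ (Hilb S)) : Op S := (K.toSubmoduleᗮ).starProjection

theorem perp_apply_eq_zero {K : ClosedSubmodule ℂ (Hilb S)} {x : Hilb S} :
    perp K x = 0 ↔ x ∈ K := by
  have : CompleteSpace K.toSubmodule := K.isClosed.completeSpace_coe
  rw [perp, Submodule.starProjection_apply_eq_zero_iff, Submodule.orthogonal_orthogonal]
  rfl

/-- A positive operator is supported in `K` iff the weight of `K^⊥` vanishes. -/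
theorem supp_le_iff {σ : Op S} (hσ : σ.IsPositive) {K : ClosedSubmodule ℂ (Hilb S)} :
    supp σ ≤ K.toSubmodule ↔ ev σ (perp K) = 0 := by
  have : CompleteSpace K.toSubmodule := K.isClosed.completeSpace_coe
  obtain ⟨R, rfl⟩ := exists_sqrt hσ
  have hset : ∀ φ : Hilb S, ⟪φ, (adjoint R ∘L R) φ⟫_ℂ = 0 ↔ R φ = 0 := by
    intro φ
    rw [ContinuousLinearMap.comp_apply, ContinuousLinearMap.adjoint_inner_right, inner_self_eq_zero]
  have hsupp : supp (adjoint R ∘L R) = (LinearMap.ker (R : Hilb S →ₗ[ℂ] Hilb S))ᗮ := by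
    rw [supp]
    congr 1
    refine le_antisymm (Submodule.span_le.mpr fun φ hφ => ?_) fun φ hφ => ?_
    · exact (hset φ).mp hφ
    · exact Submodule.subset_span ((hset φ).mpr hφ)
  rw [hsupp, ev_sqrt, ENNReal.tsum_eq_zero]
  have h1 : (∀ b, ‖perp K (adjoint R (ket b))‖ₑ ^ 2 = 0) ↔ ∀ ψ, adjoint R ψ ∈ K := by
    constructor
    · intro h ψ
      have : perp K ∘L adjoint R = 0 := clm_ext_ket fun b => by simpa using h b
      exact perp_apply_eq_zero.mp (DFunLike.congr_fun this ψ)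
    · intro h b
      simp [perp_apply_eq_zero.mpr (h (ket b))]
  rw [h1]
  constructor
  · intro h ψ
    refine h ?_
    rw [Submodule.mem_orthogonal]
    intro φ hφ
    rw [ContinuousLinearMap.adjoint_inner_right]
    have : R φ = 0 := hφ
    rw [this, inner_zero_left]
  · intro h
    have h2 : K.toSubmoduleᗮ ≤ LinearMap.ker (R : Hilb S →ₗ[ℂ] Hilb S) := by
      intro φ hφ
      change R φ = 0
      refine ext_inner_right ℂ fun ψ => ?_
      rw [← ContinuousLinearMap.adjoint_inner_right, inner_zero_left]
      exact inner_eq_zero_symm.mp ((Submodule.mem_orthogonal _ _).mp hφ _ (h ψ))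
    calc _ ≤ K.toSubmoduleᗮᗮ := Submodule.orthogonal_le h2
      _ = K.toSubmodule := Submodule.orthogonal_orthogonal _

/-! ### Independence -/

/-- The systems `S` and `T` are independent in `ρ`: up to normalization, the weight of a product
operator is the product of the weights.  For states this says `ρ|_{S ∪ T} = ρ|_S ⊗ ρ|_T`. -/
def Indep (S T : Finset Var) (ρ : Op V) : Prop :=
  ∀ (A : Op S) (B : Op T),
    ev ρ (cyl V A * cyl V B) * etr ρ = ev ρ (cyl V A) * ev ρ (cyl V B)

theorem Indep.mono {ρ : Op V} {S' T' : Finset Var} (h : Indep S T ρ) (hS : S ⊆ V) (hT : T ⊆ V)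
    (hS' : S' ⊆ S) (hT' : T' ⊆ T) : Indep S' T' ρ := fun A B => by
  rw [← cyl_cyl hS' hS, ← cyl_cyl hT' hT]
  exact h _ _

theorem Indep.symm {ρ : Op V} (h : Indep S T ρ) (hS : S ⊆ V) (hT : T ⊆ V) (hST : Disjoint S T) :
    Indep T S ρ := fun A B => by
  rw [← cyl_commute hS hT hST, h, mul_comm]

/-! ### Satisfaction by unnormalized operators -/

/-- Satisfaction of a restrictive formula by the restriction to `W` of a nonzero positive
trace-class operator `ρ` on `V ⊇ W`.  It is expressed through the weights of operators in `ρ`, so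
no restriction and no normalization of `ρ` is formed; implications are not covered. -/
def SatOn (ρ : Op V) : Form Var → Finset Var → Prop
  | .dom S, W => S ⊆ W
  | .proj S K, W => S ⊆ W ∧ ev ρ (cyl V (perp K)) = 0
  | .unif S _, W => S ⊆ W ∧ ∀ A : Op S,
      ev ρ (cyl V A) * (Nat.card (Basis S) : ℝ≥0∞) = ev (1 : Op S) A * etr ρ
  | .top, _ => True
  | .bot, _ => False
  | .and φ ψ, W => SatOn ρ φ W ∧ SatOn ρ ψ W
  | .or φ ψ, W => SatOn ρ φ W ∨ SatOn ρ ψ W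
  | .imp _ _, _ => False
  | .star φ ψ, W => ∃ S T, S ⊆ W ∧ T ⊆ W ∧ Disjoint S T ∧ Indep S T ρ ∧ SatOn ρ φ S ∧ SatOn ρ ψ T
  | .wand _ _, _ => False

theorem SatOn.mono {ρ : Op V} {φ : Form Var} {W W' : Finset Var} (h : SatOn ρ φ W) (hW : W ⊆ W') :
    SatOn ρ φ W' := by
  induction φ with
  | dom S => exact Finset.Subset.trans h hW
  | proj S K => exact ⟨h.1.trans hW, h.2⟩
  | unif S K => exact ⟨h.1.trans hW, h.2⟩
  | top => trivial
  | bot => exact h.elim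
  | and φ ψ ih1 ih2 => exact ⟨ih1 h.1, ih2 h.2⟩
  | or φ ψ ih1 ih2 => exact h.imp ih1 ih2
  | imp => exact h.elim
  | star φ ψ =>
    obtain ⟨S, T, hS, hT, hh⟩ := h
    exact ⟨S, T, hS.trans hW, hT.trans hW, hh⟩
  | wand => exact h.elim

/-- Satisfaction depends only on the free variables. -/
theorem SatOn.inter_free {ρ : Op V} {φ : Form Var} {W : Finset Var} (h : SatOn ρ φ W)
    (hW : W ⊆ V) : SatOn ρ φ (W ∩ φ.free) := by
  induction φ generalizing W with
  | dom S => exact Finset.subset_inter h subset_rfl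
  | proj S K => exact ⟨Finset.subset_inter h.1 subset_rfl, h.2⟩
  | unif S K => exact ⟨Finset.subset_inter h.1 subset_rfl, h.2⟩
  | top => trivial
  | bot => exact h.elim
  | and φ ψ ih1 ih2 =>
    exact ⟨(ih1 h.1 hW).mono (Finset.inter_subset_inter subset_rfl Finset.subset_union_left),
      (ih2 h.2 hW).mono (Finset.inter_subset_inter subset_rfl Finset.subset_union_right)⟩
  | or φ ψ ih1 ih2 =>
    exact h.imp
      (fun h => (ih1 h hW).mono (Finset.inter_subset_inter subset_rfl Finset.subset_union_left))
      (fun h => (ih2 h hW).mono (Finset.inter_subset_inter subset_rfl Finset.subset_union_right))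
  | imp => exact h.elim
  | star φ ψ ih1 ih2 =>
    obtain ⟨S, T, hS, hT, hd, hi, h1, h2⟩ := h
    exact ⟨S ∩ φ.free, T ∩ ψ.free, Finset.inter_subset_inter hS Finset.subset_union_left,
      Finset.inter_subset_inter hT Finset.subset_union_right,
      hd.mono Finset.inter_subset_left Finset.inter_subset_left,
      hi.mono (hS.trans hW) (hT.trans hW) Finset.inter_subset_left Finset.inter_subset_left,
      ih1 h1 (hS.trans hW), ih2 h2 (hT.trans hW)⟩
  | wand => exact h.elim

/-- Satisfaction on `W` depends only on the weights of operators on `W`, and only up to scaling. -/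
theorem SatOn.transfer {V' : Finset Var} {ρ : Op V} {ρ' : Op V'} {φ : Form Var} {W : Finset Var}
    (h : SatOn ρ φ W) (hW : W ⊆ V) (hW' : W ⊆ V') {c : ℝ≥0∞}
    (hc : ∀ A : Op W, ev ρ' (cyl V' A) = c * ev ρ (cyl V A)) : SatOn ρ' φ W := by
  have hsub : ∀ S, S ⊆ W → ∀ A : Op S, ev ρ' (cyl V' A) = c * ev ρ (cyl V A) := fun _ hS _ => by
    rw [← cyl_cyl hS hW, ← cyl_cyl hS hW', hc]
  have hetr : etr ρ' = c * etr ρ := by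
    rw [← ev_one, ← ev_one, ← cyl_one hW, ← cyl_one hW', hc]
  clear hc
  induction φ generalizing W with
  | dom S => exact h
  | proj S K => exact ⟨h.1, by rw [hsub _ h.1, h.2, mul_zero]⟩
  | unif S K =>
    refine ⟨h.1, fun A => ?_⟩
    rw [hsub _ h.1, mul_assoc, h.2, hetr, mul_left_comm]
  | top => trivial
  | bot => exact h.elim
  | and φ ψ ih1 ih2 => exact ⟨ih1 h.1 hW hW' hsub, ih2 h.2 hW hW' hsub⟩
  | or φ ψ ih1 ih2 => exact h.imp (ih1 · hW hW' hsub) (ih2 · hW hW' hsub)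
  | imp => exact h.elim
  | star φ ψ ih1 ih2 =>
    obtain ⟨S, T, hS, hT, hd, hi, h1, h2⟩ := h
    refine ⟨S, T, hS, hT, hd, fun A B => ?_,
      ih1 h1 (hS.trans hW) (hS.trans hW') (fun S' hS' => hsub S' (hS'.trans hS)),
      ih2 h2 (hT.trans hW) (hT.trans hW') (fun S' hS' => hsub S' (hS'.trans hT))⟩
    have hm : ev ρ' (cyl V' A * cyl V' B) = c * ev ρ (cyl V A * cyl V B) := by
      rw [← cyl_cyl hS hW, ← cyl_cyl hS hW', ← cyl_cyl hT hW, ← cyl_cyl hT hW',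
        ← cyl_mul hW, ← cyl_mul hW', hsub _ subset_rfl]
    rw [hm, hsub _ hS, hsub _ hT, hetr, mul_mul_mul_comm, hi, mul_mul_mul_comm]
  | wand => exact h.elim

theorem SatOn.transfer_eq {V' : Finset Var} {ρ : Op V} {ρ' : Op V'} {φ : Form Var} {W : Finset Var}
    (h : SatOn ρ φ W) (hW : W ⊆ V) (hW' : W ⊆ V')
    (hc : ∀ A : Op W, ev ρ' (cyl V' A) = ev ρ (cyl V A)) : SatOn ρ' φ W :=
  h.transfer hW hW' (c := 1) (by simpa using hc)

theorem SatOn.smul {ρ : Op V} {φ : Form Var} (h : SatOn ρ φ W) (hW : W ⊆ V) {r : ℝ} (hr : 0 ≤ r) :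
    SatOn ((r : ℂ) • ρ) φ W :=
  h.transfer hW hW fun _ => ev_smul hr ρ _

theorem cyl_self (A : Op V) : cyl V A = A := by
  classical
  refine ext_entry fun x y => ?_
  rw [entry_cyl subset_rfl, if_pos fun v hv => absurd v.2 hv]
  rfl

theorem basis_nonempty (S : Finset Var) : Nonempty (Basis S) := ⟨zeros S⟩

/-- For states and restrictive formulas the two notions of satisfaction agree. -/
theorem sat_iff_satOn {φ : Form Var} (hφ : φ.Res) (ρ : State V) : Sat φ ρ ↔ SatOn ρ.op φ V := by
  induction φ generalizing V with
  | dom S => exact Iff.rfl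
  | proj S K =>
    constructor
    · rintro ⟨σ, hσ, hs⟩
      obtain ⟨h, hev⟩ := below_iff.mp hσ
      exact ⟨h, by rw [← hev]; exact (supp_le_iff σ.isPositive).mp hs⟩
    · rintro ⟨h, h0⟩
      obtain ⟨σ, hσ⟩ := exists_restrict ρ h
      exact ⟨σ, hσ, (supp_le_iff σ.isPositive).mpr (by rw [(below_iff.mp hσ).2, h0])⟩
  | unif S hfin =>
    have hfin := hfin
    have hne := basis_nonempty S
    have hcard : (Nat.card (Basis S) : ℝ≥0∞) ≠ 0 := by
      exact_mod_cast (Nat.card_pos (α := Basis S)).ne'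
    have hcast : ((Nat.card (Basis S) : ℂ)⁻¹ • (1 : Op S)) =
        (((Nat.card (Basis S) : ℝ)⁻¹ : ℝ) : ℂ) • (1 : Op S) := by push_cast; rfl
    have hinv : ENNReal.ofReal (Nat.card (Basis S) : ℝ)⁻¹ = (Nat.card (Basis S) : ℝ≥0∞)⁻¹ := by
      rw [ENNReal.ofReal_inv_of_pos (by exact_mod_cast Nat.card_pos (α := Basis S)),
        ENNReal.ofReal_natCast]
    have hr : (0 : ℝ) ≤ (Nat.card (Basis S) : ℝ)⁻¹ := by positivity
    refine Iff.trans (exists_congr fun h => ?_) exists_prop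
    rw [hcast]
    constructor
    · intro hp A
      rw [← ev_of_isPartialTrace ρ.isTC hp, ev_smul hr, ρ.etr_eq_one, mul_one, hinv, mul_right_comm,
        ENNReal.inv_mul_cancel hcard (by simp), one_mul]
    · intro hA
      obtain ⟨σ, hσ, hp⟩ := exists_restrict ρ h
      have : σ.op = (((Nat.card (Basis S) : ℝ)⁻¹ : ℝ) : ℂ) • (1 : Op S) := by
        refine eq_of_ev_eq σ.isPositive
          (ContinuousLinearMap.isPositive_one.smul_of_nonneg (by exact_mod_cast hr)) fun A => ?_
        have h2 := hA A
        rw [ρ.etr_eq_one, mul_one] at h2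
        rw [ev_smul hr, ev_of_isPartialTrace ρ.isTC hp, ← h2, hinv, mul_left_comm,
          ENNReal.inv_mul_cancel hcard (by simp), mul_one]
      exact this ▸ hp
  | top => exact Iff.rfl
  | bot => exact Iff.rfl
  | and φ ψ ih1 ih2 => exact and_congr (ih1 hφ.1 ρ) (ih2 hφ.2 ρ)
  | or φ ψ ih1 ih2 => exact or_congr (ih1 hφ.1 ρ) (ih2 hφ.2 ρ)
  | imp => exact hφ.elim
  | star φ ψ ih1 ih2 =>
    constructor
    · rintro ⟨S, T, y, z, w, hc, hw, hy, hz⟩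
      obtain ⟨hd, hprod⟩ := isComp_iff.mp hc
      obtain ⟨hU, hev⟩ := below_iff.mp hw
      have l := (Finset.subset_union_left : S ⊆ S ∪ T)
      have r := (Finset.subset_union_right : T ⊆ S ∪ T)
      have hyw : ∀ A : Op S, ev ρ.op (cyl V A) = ev y.op A := fun A => by
        have := hprod A 1
        rwa [cyl_one r, mul_one, hev, cyl_cyl l hU, ev_one, z.etr_eq_one, mul_one] at this
      have hzw : ∀ B : Op T, ev ρ.op (cyl V B) = ev z.op B := fun B => by
        have := hprod 1 B
        rwa [cyl_one l, one_mul, hev, cyl_cyl r hU, ev_one, y.etr_eq_one, one_mul] at this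
      refine ⟨S, T, l.trans hU, r.trans hU, hd, fun A B => ?_, ?_, ?_⟩
      · rw [ρ.etr_eq_one, mul_one, hyw, hzw, ← hprod, hev, cyl_mul hU, cyl_cyl l hU, cyl_cyl r hU]
      · exact ((ih1 hφ.1 y).mp hy).transfer_eq subset_rfl (l.trans hU) fun A => by
          rw [hyw, cyl_self]
      · exact ((ih2 hφ.2 z).mp hz).transfer_eq subset_rfl (r.trans hU) fun A => by
          rw [hzw, cyl_self]
    · rintro ⟨S, T, hS, hT, hd, hi, h1, h2⟩
      have l := (Finset.subset_union_left : S ⊆ S ∪ T)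
      have r := (Finset.subset_union_right : T ⊆ S ∪ T)
      have hU := Finset.union_subset hS hT
      obtain ⟨y, hy⟩ := exists_restrict ρ hS
      obtain ⟨z, hz⟩ := exists_restrict ρ hT
      obtain ⟨w, hw⟩ := exists_restrict ρ hU
      refine ⟨S, T, y, z, w, isComp_iff.mpr ⟨hd, fun A B => ?_⟩, hw, ?_, ?_⟩
      · have := hi A B
        rw [ρ.etr_eq_one, mul_one] at this
        rw [(below_iff.mp hw).2, (below_iff.mp hy).2, (below_iff.mp hz).2, ← this, cyl_mul hU,
          cyl_cyl l hU, cyl_cyl r hU]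
      · exact (ih1 hφ.1 y).mpr (h1.transfer_eq hS subset_rfl fun A => by
          rw [cyl_self, (below_iff.mp hy).2])
      · exact (ih2 hφ.2 z).mpr (h2.transfer_eq hT subset_rfl fun A => by
          rw [cyl_self, (below_iff.mp hz).2])
  | wand => exact hφ.elim

theorem frequently_exists_finset {α : Type*} {l : Filter ℕ} {s : Finset α} {p : α → ℕ → Prop}
    (h : ∃ᶠ n in l, ∃ a ∈ s, p a n) : ∃ a ∈ s, ∃ᶠ n in l, p a n := by
  by_contra hh
  push Not at hh
  have := (Filter.eventually_all_finset s).mpr hh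
  exact h (this.mono fun n hn ⟨a, ha, hp⟩ => hn a ha hp)

/-- Satisfaction is closed under limits. -/
theorem SatOn.of_tendsto {ρ : Op V} (hρ : IsTC ρ) {τ : ℕ → Op V}
    (hτ : ∀ X : Op V, Tendsto (fun n => ev (τ n) X) atTop (𝓝 (ev ρ X))) {φ : Form Var}
    (h : ∃ᶠ n in atTop, SatOn (τ n) φ W) : SatOn ρ φ W := by
  have hetr : Tendsto (fun n => etr (τ n)) atTop (𝓝 (etr ρ)) := by
    simpa only [ev_one] using hτ 1
  induction φ generalizing W with
  | dom S => exact h.exists.choose_spec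
  | proj S K =>
    refine ⟨h.exists.choose_spec.1, ?_⟩
    exact tendsto_nhds_unique_of_frequently_eq (hτ _) tendsto_const_nhds (h.mono fun n hn => hn.2)
  | unif S hfin =>
    refine ⟨h.exists.choose_spec.1, fun A => ?_⟩
    refine tendsto_nhds_unique_of_frequently_eq
      (ENNReal.Tendsto.mul_const (hτ (cyl V A)) (Or.inr (by simp)))
      (ENNReal.Tendsto.const_mul hetr (Or.inr ?_)) (h.mono fun n hn => hn.2 A)
    have := hfin
    have : Fintype (Basis S) := Fintype.ofFinite _
    refine ev_ne_top ⟨ContinuousLinearMap.isPositive_one, ?_⟩ A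
    rw [etr, tsum_fintype]
    exact ENNReal.sum_ne_top.mpr fun b _ => by simp [qf]
  | top => trivial
  | bot => exact h.exists.choose_spec
  | and φ ψ ih1 ih2 => exact ⟨ih1 (h.mono fun n hn => hn.1), ih2 (h.mono fun n hn => hn.2)⟩
  | or φ ψ ih1 ih2 => exact (Filter.frequently_or_distrib.mp h).imp ih1 ih2
  | imp => exact h.exists.choose_spec
  | star φ ψ ih1 ih2 =>
    -- one of the finitely many pairs of subsets of `W` occurs infinitely often
    have h' : ∃ᶠ n in atTop, ∃ p ∈ W.powerset ×ˢ W.powerset, Disjoint p.1 p.2 ∧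
        Indep p.1 p.2 (τ n) ∧ SatOn (τ n) φ p.1 ∧ SatOn (τ n) ψ p.2 :=
      h.mono fun n ⟨S, T, hS, hT, hh⟩ => ⟨(S, T), by simp [hS, hT], hh⟩
    obtain ⟨⟨S, T⟩, hST, hf⟩ := frequently_exists_finset h'
    rw [Finset.mem_product, Finset.mem_powerset, Finset.mem_powerset] at hST
    refine ⟨S, T, hST.1, hST.2, hf.exists.choose_spec.1, fun A B => ?_,
      ih1 (hf.mono fun n hn => hn.2.2.1), ih2 (hf.mono fun n hn => hn.2.2.2)⟩
    refine tendsto_nhds_unique_of_frequently_eq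
      (ENNReal.Tendsto.mul (hτ (cyl V A * cyl V B)) (Or.inr hρ.fin) hetr
        (Or.inr (ev_ne_top hρ _)))
      (ENNReal.Tendsto.mul (hτ (cyl V A)) (Or.inr (ev_ne_top hρ _)) (hτ (cyl V B))
        (Or.inr (ev_ne_top hρ _))) (hf.mono fun n hn => hn.2.1 A B)
  | wand => exact h.exists.choose_spec

/-! ### Normalization and mixtures -/

/-- The state proportional to a nonzero positive trace-class operator. -/
theorem exists_normalized {ρ : Op V} (hρ : IsTC ρ) (h0 : etr ρ ≠ 0) : ∃ σ : State V,
    σ.op = (((etr ρ).toReal⁻¹ : ℝ) : ℂ) • ρ ∧ ρ = (((etr ρ).toReal : ℝ) : ℂ) • σ.op ∧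
      ∀ X : Op V, ev ρ X = etr ρ * ev σ.op X := by
  have hpos : 0 < (etr ρ).toReal := ENNReal.toReal_pos h0 hρ.fin
  have hinv := inv_nonneg.mpr hpos.le
  have h1 : ρ = (((etr ρ).toReal : ℝ) : ℂ) • (((etr ρ).toReal⁻¹ : ℝ) : ℂ) • ρ := by
    rw [smul_smul, ← Complex.ofReal_mul, mul_inv_cancel₀ hpos.ne']
    simp
  have h2 : etr ((((etr ρ).toReal⁻¹ : ℝ) : ℂ) • ρ) = 1 := by
    rw [etr_smul hinv, ENNReal.ofReal_inv_of_pos hpos, ENNReal.ofReal_toReal hρ.fin,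
      ENNReal.inv_mul_cancel h0 hρ.fin]
  refine ⟨mkState (hρ.smul hinv) h2, rfl, h1, fun X => ?_⟩
  conv_lhs => rw [h1, ev_smul hpos.le]
  congr 1
  exact ENNReal.ofReal_toReal hρ.fin

theorem satOn_iff_of_normalized {ρ : Op V} {σ : State V}
    (h1 : σ.op = (((etr ρ).toReal⁻¹ : ℝ) : ℂ) • ρ) (h2 : ρ = (((etr ρ).toReal : ℝ) : ℂ) • σ.op)
    {φ : Form Var} (hW : W ⊆ V) : SatOn ρ φ W ↔ SatOn σ.op φ W := by
  constructor
  · intro h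
    rw [h1]
    exact h.smul hW (inv_nonneg.mpr ENNReal.toReal_nonneg)
  · intro h
    rw [h2]
    exact h.smul hW ENNReal.toReal_nonneg

/-- A formula that is closed under mixtures is closed under sums of nonzero operators. -/
theorem SatOn.add {φ : Form Var} (hφ : φ.Res) (hcm : φ.CM) {ρ ρ' : Op V} (hρ : IsTC ρ)
    (hρ' : IsTC ρ') (h0 : etr ρ ≠ 0) (h0' : etr ρ' ≠ 0) (h : SatOn ρ φ V) (h' : SatOn ρ' φ V) :
    SatOn (ρ + ρ') φ V := by
  obtain ⟨σ, h1, h2, -⟩ := exists_normalized hρ h0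
  obtain ⟨σ', h1', h2', -⟩ := exists_normalized hρ' h0'
  have hpos : 0 < (etr ρ).toReal := ENNReal.toReal_pos h0 hρ.fin
  have hpos' : 0 < (etr ρ').toReal := ENNReal.toReal_pos h0' hρ'.fin
  set a := (etr ρ).toReal
  set b := (etr ρ').toReal
  have hs : Sat φ σ := (sat_iff_satOn hφ σ).mpr (h1 ▸ h.smul subset_rfl (inv_nonneg.mpr hpos.le))
  have hs' : Sat φ σ' :=
    (sat_iff_satOn hφ σ').mpr (h1' ▸ h'.smul subset_rfl (inv_nonneg.mpr hpos'.le))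
  obtain ⟨τ, hτ, hsat⟩ := hcm V σ σ' hs hs' (a / (a + b)) (by positivity)
    (by rw [div_le_one (by positivity)]; linarith)
  have : ρ + ρ' = ((a + b : ℝ) : ℂ) • τ.op := by
    have hab : (a + b : ℝ) ≠ 0 := by positivity
    have e1 : (a + b) * (a / (a + b)) = a := by field_simp
    have e2 : (a + b) * (1 - a / (a + b)) = b := by field_simp; ring
    rw [hτ, smul_add, smul_smul, smul_smul, ← Complex.ofReal_mul, ← Complex.ofReal_mul, e1, e2,
      ← h2, ← h2']
  rw [this]
  exact ((sat_iff_satOn hφ τ).mp hsat).smul subset_rfl (by positivity)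

theorem isTC_sum {ι : Type*} (s : Finset ι) {F : ι → Op V} (hF : ∀ i ∈ s, IsTC (F i)) :
    IsTC (∑ i ∈ s, F i) := by
  classical
  induction s using Finset.induction_on with
  | empty => simpa using IsTC.zero
  | insert a s ha ih =>
    rw [Finset.sum_insert ha]
    exact (hF a (by simp)).add (ih fun i hi => hF i (by simp [hi]))

theorem SatOn.sum {φ : Form Var} (hφ : φ.Res) (hcm : φ.CM) {ι : Type*} (s : Finset ι)
    {F : ι → Op V} (hF : ∀ i ∈ s, IsTC (F i)) (h : ∀ i ∈ s, etr (F i) ≠ 0 → SatOn (F i) φ V)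
    (h0 : etr (∑ i ∈ s, F i) ≠ 0) : SatOn (∑ i ∈ s, F i) φ V := by
  classical
  induction s using Finset.induction_on with
  | empty => exact absurd (by simp [etr, qf]) h0
  | insert a s ha ih =>
    have hs : IsTC (∑ i ∈ s, F i) := isTC_sum s fun i hi => hF i (by simp [hi])
    have haF := hF a (by simp)
    have ih' := ih (fun i hi => hF i (by simp [hi])) fun i hi => h i (by simp [hi])
    rw [Finset.sum_insert ha] at h0 ⊢
    by_cases h1 : etr (F a) = 0
    · have h2 : F a = 0 := by
        by_contra hne
        exact (etr_ne_zero_iff haF.pos).mpr hne h1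
      rw [h2, zero_add] at h0 ⊢
      exact ih' h0
    · by_cases h2 : etr (∑ i ∈ s, F i) = 0
      · have h3 : ∑ i ∈ s, F i = 0 := by
          by_contra hne
          exact (etr_ne_zero_iff hs.pos).mpr hne h2
        rw [h3, add_zero]
        exact h a (by simp) h1
      · exact SatOn.add hφ hcm haF hs h1 h2 (h a (by simp) h1) (ih' h2)

/-! ### Paths of programs -/

/-- The terminating paths of a program: a path records the outcomes of all measurements, and of the
implicit measurements in initializations.  A path of a loop is the list of the paths of its
iterations. -/
def Path : Prog Var → Type u
  | .skip => PUnit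
  | .seq P Q => Path P × Path Q
  | .init q => Basis ({q} : Finset Var)
  | .unit _ _ => PUnit
  | .ifte _ _ _ P => Σ m, Path (P m)
  | .while _ _ P => List (Path P)

/-- The operator on `V` that a program applies along a path. -/
def kraus (V : Finset Var) : (P : Prog Var) → Path P → Op V
  | .skip, _ => 1
  | .seq P Q, p => kraus V Q p.2 * kraus V P p.1
  | .init q, n => cyl V
      (InnerProductSpace.rankOne ℂ (ket (zeros ({q} : Finset Var))) (ket (S := {q}) n))
  | .unit _ U, _ => cyl V U.1
  | .ifte _ _ M P, p => kraus V (P p.1) p.2 * cyl V (M.op p.1)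
  | .while _ M P, l => List.rec (motive := fun _ => Op V) (cyl V (M.op 0))
      (fun a _ X => X * (kraus V P a * cyl V (M.op 1))) l

/-- The number of steps of a path. -/
def pathLength : (P : Prog Var) → Path P → ℕ
  | .skip, _ => 1
  | .seq P Q, p => pathLength P p.1 + pathLength Q p.2
  | .init _, _ => 1
  | .unit _ _, _ => 1
  | .ifte _ _ _ P, p => pathLength (P p.1) p.2 + 1
  | .while _ _ P, l => List.rec (motive := fun _ => ℕ) 1
      (fun a _ n => pathLength P a + n + 1) l

theorem pathLength_pos (P : Prog Var) (p : Path P) : 0 < pathLength P p := by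
  induction P with
  | skip => exact one_pos
  | seq P Q ih1 ih2 => exact Nat.add_pos_left (ih1 _) _
  | init => exact one_pos
  | unit => exact one_pos
  | ifte => exact Nat.succ_pos _
  -- the loop
  | _ q M P ih =>
    cases (p : List (Path P)) with
    | nil => exact one_pos
    | cons a l => exact Nat.succ_pos _

/-- Operators along paths are local: they act on the variables of the program. -/
theorem kraus_eq_cyl (P : Prog Var) (hW : P.vars ⊆ W) (hV : W ⊆ V) (p : Path P) :
    kraus V P p = cyl V (kraus W P p) := by
  induction P with
  | skip => exact (cyl_one hV).symm
  | seq P Q ih1 ih2 =>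
    have h1 : P.vars ⊆ W := Finset.subset_union_left.trans hW
    have h2 : Q.vars ⊆ W := Finset.subset_union_right.trans hW
    change kraus V Q p.2 * kraus V P p.1 = cyl V (kraus W Q p.2 * kraus W P p.1)
    rw [ih1 h1, ih2 h2, cyl_mul hV]
  | init q => exact (cyl_cyl hW hV _).symm
  | unit q U => exact (cyl_cyl hW hV _).symm
  | ifte q k M P ih =>
    have h1 : q ⊆ W := Finset.subset_union_left.trans hW
    have h2 : (P p.1).vars ⊆ W :=
      ((Finset.subset_biUnion_of_mem (fun m => (P m).vars) (Finset.mem_univ p.1)).trans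
        Finset.subset_union_right).trans hW
    change kraus V (P p.1) p.2 * cyl V (M.op p.1) = cyl V (kraus W (P p.1) p.2 * cyl W (M.op p.1))
    rw [ih p.1 h2, cyl_mul hV, cyl_cyl h1 hV]
  -- the loop
  | _ q M P ih =>
    have h1 : q ⊆ W := Finset.subset_union_left.trans hW
    have h2 : P.vars ⊆ W := Finset.subset_union_right.trans hW
    have : ∀ l : List (Path P),
        kraus V (.while q M P) l = cyl V (kraus W (.while q M P) l) := by
      intro l
      induction l with
      | nil => exact (cyl_cyl h1 hV _).symm
      | cons a l ihl =>
        change kraus V (.while q M P) l * (kraus V P a * cyl V (M.op 1)) =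
          cyl V (kraus W (.while q M P) l * (kraus W P a * cyl W (M.op 1)))
        rw [ihl, ih h2, cyl_mul hV, cyl_mul hV, cyl_cyl h1 hV]
    exact this p

theorem tsum_list {α : Type*} (f : List α → ℝ≥0∞) :
    ∑' l, f l = f [] + ∑' (a : α) (l : List α), f (a :: l) := by
  let e : Unit ⊕ (α × List α) ≃ List α :=
    { toFun := fun o => o.elim (fun _ => []) fun p => p.1 :: p.2
      invFun := fun l => match l with
        | [] => Sum.inl ()
        | a :: l => Sum.inr (a, l)
      left_inv := fun o => by rcases o with _ | ⟨a, l⟩ <;> rfl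
      right_inv := fun l => by rcases l with _ | ⟨a, l⟩ <;> rfl }
  rw [← e.tsum_eq, Summable.tsum_sum ENNReal.summable ENNReal.summable, tsum_fintype,
    ENNReal.tsum_prod']
  simp [e]

theorem enorm_sq_rankOne (c : Basis S) (n : Basis S) (φ : Hilb S) :
    ‖InnerProductSpace.rankOne ℂ (ket c) (ket n) φ‖ₑ ^ 2 = ‖⟪ket n, φ⟫_ℂ‖ₑ ^ 2 := by
  have : ‖(ket c : Hilb S)‖ₑ = 1 := by rw [← ofReal_norm, norm_ket]; simp
  rw [InnerProductSpace.rankOne_apply, enorm_smul, this, mul_one]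

/-- The operators `|c⟩⟨n|` form a resolution of the identity. -/
theorem tsum_enorm_sq_reset (h : S ⊆ V) (c : Basis S) (ψ : Hilb V) :
    ∑' n : Basis S, ‖cyl V (InnerProductSpace.rankOne ℂ (ket c) (ket n)) ψ‖ₑ ^ 2 = ‖ψ‖ₑ ^ 2 := by
  simp_rw [enorm_sq_cyl h, enorm_sq_rankOne]
  rw [ENNReal.tsum_comm, enorm_sq_eq_tsum_slice h]
  refine tsum_congr fun d => ?_
  rw [← enorm_sq_eq_tsum]

theorem enorm_cyl_unitary (h : S ⊆ V) (U : unitary (Op S)) (ψ : Hilb V) :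
    ‖cyl V U.1 ψ‖ₑ = ‖ψ‖ₑ := by
  have h1 : adjoint (cyl V U.1) ∘L cyl V U.1 = 1 := by
    rw [adjoint_cyl h, ← cyl_one h]
    have : adjoint U.1 * U.1 = 1 := Unitary.coe_star_mul_self U
    rw [← this, cyl_mul h]
    rfl
  have h2 : ‖cyl V U.1 ψ‖ₑ ^ 2 = ‖ψ‖ₑ ^ 2 := by
    rw [← qf_sqrt, h1, ← conj_one (1 : Op V)]
    rw [conj_one, qf]
    rw [one_apply_eq_self, inner_self_eq_norm_sq, ENNReal.ofReal_pow (norm_nonneg _), ofReal_norm]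
  exact le_antisymm ((ENNReal.pow_le_pow_left_iff two_ne_zero).mp h2.le)
    ((ENNReal.pow_le_pow_left_iff two_ne_zero).mp h2.ge)

theorem adjoint_mul_self_of_isProj {k : ℕ} (M : Measurement S k) (m : Fin k) :
    adjoint (M.op m) * M.op m = M.op m := by
  have h := M.isProj m
  have h1 : adjoint (M.op m) = M.op m := h.isSelfAdjoint
  rw [h1]
  exact h.isIdempotentElem

theorem sum_enorm_sq_measurement {k : ℕ} (M : Measurement S k) (h : S ⊆ V) (ψ : Hilb V) :
    ∑ m, ‖cyl V (M.op m) ψ‖ₑ ^ 2 = ‖ψ‖ₑ ^ 2 := by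
  have hS : ∀ φ : Hilb S, ∑ m, ‖M.op m φ‖ₑ ^ 2 = ‖φ‖ₑ ^ 2 := by
    intro φ
    have h1 : ∀ m, ‖M.op m φ‖ ^ 2 = RCLike.re ⟪φ, M.op m φ⟫_ℂ := by
      intro m
      conv_rhs => rw [← adjoint_mul_self_of_isProj M m]
      rw [mul_apply_eq_comp, ContinuousLinearMap.adjoint_inner_right, inner_self_eq_norm_sq]
    have h2 : ∑ m, ‖M.op m φ‖ ^ 2 = ‖φ‖ ^ 2 := by
      simp_rw [h1]
      rw [← map_sum, ← inner_sum, ← sum_apply, M.complete,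
        one_apply_eq_self, inner_self_eq_norm_sq]
    simp_rw [enorm_sq_eq_ofReal]
    rw [← h2, ENNReal.ofReal_sum_of_nonneg fun _ _ => by positivity]
  simp_rw [enorm_sq_cyl h]
  rw [enorm_sq_eq_tsum_slice h ψ, ← tsum_fintype (L := .unconditional _), ENNReal.tsum_comm]
  refine tsum_congr fun c => ?_
  rw [tsum_fintype, hS]

/-- The operators along the paths of a program form a contractive family. -/
theorem tsum_enorm_sq_kraus_le (P : Prog Var) (h : P.vars ⊆ V) (ψ : Hilb V) :
    ∑' p, ‖kraus V P p ψ‖ₑ ^ 2 ≤ ‖ψ‖ₑ ^ 2 := by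
  induction P generalizing ψ with
  | skip =>
    change ∑' _ : PUnit, _ ≤ _
    simp [kraus]
  | seq P Q ih1 ih2 =>
    have h1 : P.vars ⊆ V := Finset.subset_union_left.trans h
    have h2 : Q.vars ⊆ V := Finset.subset_union_right.trans h
    change ∑' p : Path P × Path Q, ‖kraus V Q p.2 (kraus V P p.1 ψ)‖ₑ ^ 2 ≤ _
    rw [ENNReal.tsum_prod']
    refine le_trans (ENNReal.tsum_le_tsum fun a => ?_) (ih1 h1 ψ)
    exact ih2 h2 (kraus V P a ψ)
  | init q => exact (tsum_enorm_sq_reset h _ ψ).le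
  | unit q U =>
    change ∑' _ : PUnit, ‖cyl V U.1 ψ‖ₑ ^ 2 ≤ _
    rw [tsum_fintype, Finset.univ_unique, Finset.sum_singleton]
    exact (congrArg (· ^ 2) (enorm_cyl_unitary h U ψ)).le
  | ifte q k M P ih =>
    have h1 : q ⊆ V := Finset.subset_union_left.trans h
    have h2 : ∀ m, (P m).vars ⊆ V := fun m =>
      ((Finset.subset_biUnion_of_mem (fun m => (P m).vars) (Finset.mem_univ m)).trans
        Finset.subset_union_right).trans h
    change ∑' p : Σ m, Path (P m), ‖kraus V (P p.1) p.2 (cyl V (M.op p.1) ψ)‖ₑ ^ 2 ≤ _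
    rw [ENNReal.tsum_sigma', tsum_fintype, ← sum_enorm_sq_measurement M h1 ψ]
    exact Finset.sum_le_sum fun m _ => ih m (h2 m) (cyl V (M.op m) ψ)
  -- the loop
  | _ q M P ih =>
    have h1 : q ⊆ V := Finset.subset_union_left.trans h
    have h2 : P.vars ⊆ V := Finset.subset_union_right.trans h
    -- the bound for the paths with at most `n` iterations
    have key : ∀ (n : ℕ) (ψ : Hilb V), (∑' l : List (Path P), if l.length < n then
        ‖kraus V (.while q M P) l ψ‖ₑ ^ 2 else 0) ≤ ‖ψ‖ₑ ^ 2 := by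
      intro n
      induction n with
      | zero => intro ψ; simp
      | succ n ihn =>
        intro ψ
        rw [tsum_list, ← sum_enorm_sq_measurement M h1 ψ, Fin.sum_univ_two]
        refine add_le_add ?_ ?_
        · simp [kraus]
        · refine le_trans (ENNReal.tsum_le_tsum fun a => ?_) (ih h2 (cyl V (M.op 1) ψ))
          refine le_trans (le_of_eq ?_) (ihn (kraus V P a (cyl V (M.op 1) ψ)))
          refine tsum_congr fun l => ?_
          simp only [List.length_cons, add_lt_add_iff_right]
          rfl
    change ∑' l : List (Path P), ‖kraus V (.while q M P) l ψ‖ₑ ^ 2 ≤ _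
    rw [ENNReal.tsum_eq_iSup_sum]
    refine iSup_le fun s => ?_
    refine le_trans ?_ (key (s.sup List.length + 1) ψ)
    refine le_trans (Finset.sum_le_sum fun l hl => ?_) (ENNReal.sum_le_tsum s)
    rw [if_pos (Nat.lt_succ_of_le (Finset.le_sup (f := List.length) hl))]

/-! ### The operational semantics -/

/-- The contribution to the quadratic form at `ψ` of the final operators that are reached from a
configuration after exactly `n` steps. -/
def pathSum {V : Finset Var} (c : Config V) (n : ℕ) (ψ : Hilb V) : ℝ≥0∞ :=
  match c with
  | (none, ρ) => if n = 0 then qf ρ ψ else 0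
  | (some P, ρ) => ∑' p : Path P, if pathLength P p = n then qf ρ (adjoint (kraus V P p) ψ) else 0

theorem adjoint_mul_apply (A B : Op V) (ψ : Hilb V) :
    adjoint (A * B) ψ = adjoint B (adjoint A ψ) := by
  have : adjoint (A * B) = adjoint B ∘L adjoint A := ContinuousLinearMap.adjoint_comp A B
  rw [this]; rfl

theorem pathSum_some_zero (P : Prog Var) (ρ : Op V) (ψ : Hilb V) : pathSum (some P, ρ) 0 ψ = 0 := by
  simp [pathSum, (pathLength_pos P _).ne']

/-- The configuration that runs `Q` after the program of the configuration `c`. -/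
def thenRun (Q : Prog Var) (c : Config V) : Config V :=
  (some (match c.1 with
    | none => Q
    | some P' => .seq P' Q), c.2)

/-- The paths of a composition that use the path `j` of `Q` are shifted by the length of `j`. -/
theorem pathSum_thenRun (Q : Prog Var) (c : Config V) (n : ℕ) (ψ : Hilb V) :
    pathSum (thenRun Q c) n ψ = ∑' j : Path Q, if pathLength Q j ≤ n then
      pathSum c (n - pathLength Q j) (adjoint (kraus V Q j) ψ) else 0 := by
  rcases c with ⟨_ | P, ρ⟩
  · refine tsum_congr fun j => ?_
    by_cases h : pathLength Q j = n
    · simp [pathSum, h]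
    · by_cases h' : pathLength Q j ≤ n
      · have : n - pathLength Q j ≠ 0 := by omega
        simp [pathSum, h, h', this]
      · simp [h, h']
  · change (∑' p : Path P × Path Q, if pathLength P p.1 + pathLength Q p.2 = n then
      qf ρ (adjoint (kraus V Q p.2 * kraus V P p.1) ψ) else 0) = _
    rw [ENNReal.tsum_prod', ENNReal.tsum_comm]
    refine tsum_congr fun j => ?_
    by_cases h' : pathLength Q j ≤ n
    · rw [if_pos h']
      refine tsum_congr fun i => ?_
      have : (pathLength P i + pathLength Q j = n) ↔ pathLength P i = n - pathLength Q j := by omega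
      simp only [this, adjoint_mul_apply]
    · rw [if_neg h', ENNReal.tsum_eq_zero]
      intro i
      exact if_neg fun hh : pathLength P i + pathLength Q j = n => h' (by omega)

theorem multiset_sum_tsum {α ι : Type*} (s : Multiset α) (f : α → ι → ℝ≥0∞) :
    (s.map fun a => ∑' i, f a i).sum = ∑' i, (s.map fun a => f a i).sum := by
  induction s using Multiset.induction_on with
  | empty => simp
  | cons a s ih => simp [ih, ENNReal.tsum_add]

theorem exists_hasSum_resetOp {q : Var} (h : {q} ⊆ V) {ρ : Op V} (hρ : IsTC ρ) :
    IsTC (resetOp q ρ) ∧ ∀ ψ, qf (resetOp q ρ) ψ =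
      ∑' n : Basis ({q} : Finset Var), qf ρ (adjoint (kraus V (.init q) n) ψ) := by
  have h1 : ∑' n : Basis ({q} : Finset Var), etr (conj (kraus V (.init q) n) ρ) = etr ρ := by
    have := ev_eq_tsum hρ.pos (fun n : Basis ({q} : Finset Var) => kraus V (.init q) n) (1 : Op V)
      (tsum_enorm_sq_reset h (zeros _))
    rwa [ev_one] at this
  obtain ⟨σ, h2, h3, h4⟩ := exists_hasSum_of_etr (F := fun n : Basis ({q} : Finset Var) =>
    conj (kraus V (.init q) n) ρ)
    (fun n => isPositive_conj _ hρ.pos) (by rw [h1]; exact hρ.fin)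
  have h5 : resetOp q ρ = σ := h2.tsum_eq
  rw [h5]
  refine ⟨h3, fun ψ => ?_⟩
  simp_rw [h4, qf_conj]

/-- Removing the first step of all paths corresponds to performing one transition. -/
theorem pathSum_succ (P : Prog Var) (h : P.vars ⊆ V) {ρ : Op V} (hρ : IsTC ρ) (n : ℕ)
    (ψ : Hilb V) :
    pathSum (some P, ρ) (n + 1) ψ = ((succs P ρ).map fun c => pathSum c n ψ).sum := by
  induction P generalizing n ψ with
  | skip =>
    change (∑' _ : PUnit, if 1 = n + 1 then qf ρ (adjoint (1 : Op V) ψ) else 0) = _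
    have : adjoint (1 : Op V) = 1 := star_one (Op V)
    simp [succs, pathSum, this]
  | seq P Q ih1 ih2 =>
    have h1 : P.vars ⊆ V := Finset.subset_union_left.trans h
    have e1 : succs (.seq P Q) ρ = (succs P ρ).map (thenRun Q) := rfl
    have e2 : ((some (.seq P Q), ρ) : Config V) = thenRun Q (some P, ρ) := rfl
    rw [e1, e2, Multiset.map_map, pathSum_thenRun]
    simp only [Function.comp_def, pathSum_thenRun]
    rw [multiset_sum_tsum]
    refine tsum_congr fun j => ?_
    by_cases h' : pathLength Q j ≤ n
    · rw [if_pos (h'.trans (Nat.le_succ n)), Nat.succ_sub h', ih1 h1]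
      simp only [if_pos h']
    · simp only [if_neg h']
      by_cases h'' : pathLength Q j = n + 1
      · simp [h'', pathSum_some_zero]
      · rw [if_neg (by omega)]
        simp
  | init q =>
    change (∑' m : Basis ({q} : Finset Var), if 1 = n + 1 then
      qf ρ (adjoint (kraus V (.init q) m) ψ) else 0) = _
    by_cases hn : n = 0 <;> simp [succs, pathSum, hn, (exists_hasSum_resetOp h hρ).2, eq_comm]
  | unit q U =>
    change (∑' _ : PUnit, if 1 = n + 1 then qf ρ (adjoint (cyl V U.1) ψ) else 0) = _
    simp [succs, pathSum, act_eq, qf_conj]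
  | ifte q k M P ih =>
    change (∑' p : Σ m, Path (P m), if pathLength (P p.1) p.2 + 1 = n + 1 then
      qf ρ (adjoint (kraus V (P p.1) p.2 * cyl V (M.op p.1)) ψ) else 0) = _
    rw [ENNReal.tsum_sigma', tsum_fintype]
    change _ = ((Finset.univ.val.map fun m => ((some (P m), act (M.op m) ρ) : Config V)).map
      fun c => pathSum c n ψ).sum
    rw [Multiset.map_map]
    refine Finset.sum_congr rfl fun m _ => ?_
    refine tsum_congr fun p => ?_
    simp only [add_left_inj, adjoint_mul_apply, act_eq, qf_conj]
  -- the loop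
  | _ q M P ih =>
    change (∑' l : List (Path P), if pathLength (.while q M P) l = n + 1 then
      qf ρ (adjoint (kraus V (.while q M P) l) ψ) else 0) = _
    rw [tsum_list]
    have e : succs (.while q M P) ρ =
      {(none, act (M.op 0) ρ), (some (.seq P (.while q M P)), act (M.op 1) ρ)} := rfl
    rw [e, Multiset.insert_eq_cons, Multiset.map_cons, Multiset.sum_cons, Multiset.map_singleton,
      Multiset.sum_singleton]
    refine congrArg₂ (· + ·) ?_ ?_
    · change (if 1 = n + 1 then qf ρ (adjoint (cyl V (M.op 0)) ψ) else 0) = _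
      simp [pathSum, act_eq, qf_conj]
    · change _ = ∑' p : Path P × List (Path P), if pathLength P p.1 + pathLength (.while q M P) p.2 = n
        then qf (act (M.op 1) ρ) (adjoint (kraus V (.while q M P) p.2 * kraus V P p.1) ψ) else 0
      rw [ENNReal.tsum_prod']
      refine tsum_congr fun a => tsum_congr fun l => ?_
      change (if pathLength P a + pathLength (.while q M P) l + 1 = n + 1 then
        qf ρ (adjoint (kraus V (.while q M P) l * (kraus V P a * cyl V (M.op 1))) ψ) else 0) = _
      simp only [add_left_inj, adjoint_mul_apply, act_eq, qf_conj]

/-- The configurations of interest: a positive trace-class operator, and a program with variables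
in its domain. -/
def GoodConfig (c : Config V) : Prop := IsTC c.2 ∧ ∀ P, c.1 = some P → P.vars ⊆ V

theorem goodConfig_succs (P : Prog Var) (h : P.vars ⊆ V) {ρ : Op V} (hρ : IsTC ρ) :
    ∀ c ∈ succs P ρ, GoodConfig c := by
  induction P with
  | skip =>
    intro c hc
    rw [succs, Multiset.mem_singleton] at hc
    subst hc
    exact ⟨hρ, by simp⟩
  | seq P Q ih1 ih2 =>
    have h1 : P.vars ⊆ V := Finset.subset_union_left.trans h
    have h2 : Q.vars ⊆ V := Finset.subset_union_right.trans h
    intro c hc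
    rw [succs, Multiset.mem_map] at hc
    obtain ⟨⟨_ | P', σ⟩, hd, rfl⟩ := hc
    · exact ⟨(ih1 h1 _ hd).1, fun R hR => by cases hR; exact h2⟩
    · exact ⟨(ih1 h1 _ hd).1, fun R hR => by
        cases hR; exact Finset.union_subset ((ih1 h1 _ hd).2 P' rfl) h2⟩
  | init q =>
    intro c hc
    rw [succs, Multiset.mem_singleton] at hc
    subst hc
    exact ⟨(exists_hasSum_resetOp h hρ).1, by simp⟩
  | unit q U =>
    intro c hc
    rw [succs, Multiset.mem_singleton] at hc
    subst hc
    exact ⟨hρ.conj _, by simp⟩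
  | ifte q k M P ih =>
    intro c hc
    rw [succs, Multiset.mem_map] at hc
    obtain ⟨m, -, rfl⟩ := hc
    refine ⟨hρ.conj _, fun R hR => ?_⟩
    cases hR
    exact ((Finset.subset_biUnion_of_mem (fun m => (P m).vars) (Finset.mem_univ m)).trans
        Finset.subset_union_right).trans h
  -- the loop
  | _ q M P ih =>
    intro c hc
    rw [succs, Multiset.insert_eq_cons, Multiset.mem_cons, Multiset.mem_singleton] at hc
    rcases hc with rfl | rfl
    · exact ⟨hρ.conj _, by simp⟩
    · refine ⟨hρ.conj _, fun R hR => ?_⟩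
      cases hR
      exact Finset.union_subset (Finset.subset_union_right.trans h) h

theorem goodConfig_step {c : Config V} (hc : GoodConfig c) : ∀ d ∈ step c, GoodConfig d := by
  rcases c with ⟨_ | P, ρ⟩
  · simp [step]
  · exact goodConfig_succs P (hc.2 P rfl) hc.1

theorem run_succ (c : Config V) (n : ℕ) : run c (n + 1) = (step c).bind fun d => run d n := by
  induction n with
  | zero =>
    simp only [run, Multiset.singleton_bind]
    exact (Multiset.map_id _).symm.trans (Multiset.bind_singleton (step c) id).symm
  | succ n ih =>
    rw [run, ih, Multiset.bind_assoc]
    rfl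

theorem goodConfig_run {c : Config V} (hc : GoodConfig c) (n : ℕ) : ∀ d ∈ run c n, GoodConfig d := by
  induction n with
  | zero =>
    intro d hd
    rw [run, Multiset.mem_singleton] at hd
    exact hd ▸ hc
  | succ n ih =>
    intro d hd
    rw [run, Multiset.mem_bind] at hd
    obtain ⟨e, he, hd⟩ := hd
    exact goodConfig_step (ih e he) d hd

theorem map_sum_bind {α β : Type*} (s : Multiset α) (f : α → Multiset β) (g : β → ℝ≥0∞) :
    ((s.bind f).map g).sum = (s.map fun a => ((f a).map g).sum).sum := by
  rw [Multiset.map_bind, Multiset.sum_bind]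

/-- The operational semantics agrees with the sum over paths, for each number of steps. -/
theorem sum_outputs {c : Config V} (hc : GoodConfig c) (n : ℕ) (ψ : Hilb V) :
    (((run c n).filterMap output).map fun σ => qf σ ψ).sum = pathSum c n ψ := by
  induction n generalizing c with
  | zero =>
    rcases c with ⟨_ | P, ρ⟩
    · rw [run, ← Multiset.cons_zero, Multiset.filterMap_cons_some output _ _ rfl]
      simp [pathSum]
    · rw [run, ← Multiset.cons_zero, Multiset.filterMap_cons_none _ _ rfl, pathSum_some_zero]
      simp
  | succ n ih =>
    rw [run_succ, Multiset.filterMap_bind, map_sum_bind]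
    rw [Multiset.map_congr rfl fun d hd => ih (goodConfig_step hc d hd)]
    rcases c with ⟨_ | P, ρ⟩
    · simp [step, pathSum]
    · exact (pathSum_succ P (hc.2 P rfl) hc.1 n ψ).symm

theorem isTC_multiset_sum (s : Multiset (Op V)) (h : ∀ σ ∈ s, IsTC σ) :
    IsTC s.sum ∧ ∀ ψ, qf s.sum ψ = (s.map fun σ => qf σ ψ).sum := by
  induction s using Multiset.induction_on with
  | empty => exact ⟨by simpa using IsTC.zero, by simp [qf]⟩
  | cons σ s ih =>
    obtain ⟨h1, h2⟩ := ih fun τ hτ => h τ (Multiset.mem_cons_of_mem hτ)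
    have h3 := h σ (Multiset.mem_cons_self σ s)
    rw [Multiset.sum_cons]
    refine ⟨h3.add h1, fun ψ => ?_⟩
    rw [qf_add h3.pos h1.pos, h2, Multiset.map_cons, Multiset.sum_cons]

theorem tsum_ev_kraus_le (P : Prog Var) (h : P.vars ⊆ V) {ρ : Op V} (hρ : ρ.IsPositive) :
    ∑' p, ev ρ (kraus V P p) ≤ etr ρ := by
  have := tsum_ev_le hρ (fun p => kraus V P p) (1 : Op V) 1
    (by simpa using tsum_enorm_sq_kraus_le P h)
  rwa [one_mul, ev_one] at this

/-- The denotational semantics as a sum over paths. -/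
theorem sem_spec (P : Prog Var) (h : P.vars ⊆ V) {ρ : Op V} (hρ : IsTC ρ) : IsTC (sem V P ρ) ∧
    ∀ ψ, qf (sem V P ρ) ψ = ∑' p, qf ρ (adjoint (kraus V P p) ψ) := by
  have hc : GoodConfig ((some P, ρ) : Config V) := ⟨hρ, fun R hR => by cases hR; exact h⟩
  have h1 : ∀ n, IsTC ((run (some P, ρ) n).filterMap output).sum ∧ ∀ ψ,
      qf ((run (some P, ρ) n).filterMap output).sum ψ = pathSum (some P, ρ) n ψ := by
    intro n
    have := isTC_multiset_sum ((run (some P, ρ) n).filterMap output) (by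
      intro σ hσ
      rw [Multiset.mem_filterMap] at hσ
      obtain ⟨⟨_ | P', τ⟩, hd, ho⟩ := hσ
      · cases ho
        exact (goodConfig_run hc n _ hd).1
      · cases ho)
    exact ⟨this.1, fun ψ => by rw [this.2, sum_outputs hc]⟩
  have h2 : ∀ ψ, ∑' n, pathSum (some P, ρ) n ψ = ∑' p, qf ρ (adjoint (kraus V P p) ψ) := by
    intro ψ
    simp only [pathSum]
    rw [ENNReal.tsum_comm]
    refine tsum_congr fun p => ?_
    rw [tsum_eq_single (pathLength P p) fun n hn => if_neg hn.symm, if_pos rfl]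
  have h3 : ∑' n, etr ((run (some P, ρ) n).filterMap output).sum ≤ etr ρ := by
    refine le_trans (le_of_eq ?_) (tsum_ev_kraus_le P h hρ.pos)
    simp only [etr, (h1 _).2, ev]
    rw [ENNReal.tsum_comm]
    simp only [h2]
    rw [ENNReal.tsum_comm]
    simp only [qf_conj]
  obtain ⟨σ, h4, h5, h6⟩ := exists_hasSum_of_etr (fun n => (h1 n).1.pos)
    (ne_top_of_le_ne_top hρ.fin h3)
  have h7 : sem V P ρ = σ := h4.tsum_eq
  rw [h7]
  refine ⟨h5, fun ψ => ?_⟩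
  rw [h6, ← h2]
  simp only [(h1 _).2]

/-- Weights in an output are sums over paths of weights in the input. -/
theorem ev_sem (P : Prog Var) (h : P.vars ⊆ V) {ρ : Op V} (hρ : IsTC ρ)
    (X : Hilb V →L[ℂ] Hilb W) : ev (sem V P ρ) X = ∑' p, ev ρ (X ∘L kraus V P p) := by
  simp only [ev, etr, qf_conj, (sem_spec P h hρ).2]
  rw [ENNReal.tsum_comm]
  refine tsum_congr fun p => tsum_congr fun b => ?_
  rw [ContinuousLinearMap.adjoint_comp, ContinuousLinearMap.comp_apply]

/-! ### Sound judgments -/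

/-- The invariant of the soundness proof.  Termination is required of the given input only, since
the components of an almost surely terminating program need not terminate on all inputs.  The
domain need not contain the free variables of the precondition. -/
def Sound (φ : Form Var) (P : Prog Var) (ψ : Form Var) : Prop :=
  ∀ V : Finset Var, P.vars ⊆ V → ψ.free ⊆ V → ∀ ρ : Op V, IsTC ρ → etr ρ ≠ 0 → SatOn ρ φ V →
    etr (sem V P ρ) = etr ρ → SatOn (sem V P ρ) ψ V

theorem etr_sem_le (P : Prog Var) (h : P.vars ⊆ V) {ρ : Op V} (hρ : IsTC ρ) :
    etr (sem V P ρ) ≤ etr ρ := by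
  rw [← ev_one, ev_sem P h hρ]
  exact tsum_ev_kraus_le P h hρ.pos

/-- Extension of an operator by the state `|0⋯0⟩` of the additional variables. -/
def extend (h : V ⊆ W) (ρ : Op V) : Op W := conj (sliceL h (zeros (W \ V))) ρ

theorem isTC_extend (h : V ⊆ W) {ρ : Op V} (hρ : IsTC ρ) : IsTC (extend h ρ) := hρ.conj _

theorem ev_sliceL_comp (h : V ⊆ W) {ρ : Op V} (hρ : ρ.IsPositive) (c : Basis (W \ V)) (X : Op V) :
    ev ρ (sliceL h c ∘L X) = ev ρ X :=
  ev_congr hρ _ _ fun ψ => by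
    rw [ContinuousLinearMap.comp_apply, sliceL_eq_slice, ← ofReal_norm, ← ofReal_norm,
      LinearIsometry.norm_map]

theorem ev_extend (h : V ⊆ W) {ρ : Op V} (hρ : ρ.IsPositive) (X : Op V) :
    ev (extend h ρ) (cyl W X) = ev ρ X := by
  rw [extend, ev_conj, ← ev_sliceL_comp h hρ (zeros (W \ V)) X]
  congr 1
  ext1 x
  exact cyl_sliceL h X _ x

theorem ev_sem_extend (P : Prog Var) (hP : P.vars ⊆ V) (h : V ⊆ W) {ρ : Op V} (hρ : IsTC ρ)
    (X : Op V) : ev (sem W P (extend h ρ)) (cyl W X) = ev (sem V P ρ) X := by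
  rw [ev_sem P (hP.trans h) (isTC_extend h hρ), ev_sem P hP hρ]
  refine tsum_congr fun p => ?_
  rw [kraus_eq_cyl P hP h]
  change ev (extend h ρ) (cyl W X * cyl W (kraus V P p)) = _
  rw [← cyl_mul h, ev_extend h hρ.pos]
  rfl

theorem etr_sem_extend (P : Prog Var) (hP : P.vars ⊆ V) (h : V ⊆ W) {ρ : Op V} (hρ : IsTC ρ) :
    etr (sem W P (extend h ρ)) = etr (sem V P ρ) := by
  rw [← ev_one, ← cyl_one h, ev_sem_extend P hP h hρ, ev_one]

theorem etr_extend (h : V ⊆ W) {ρ : Op V} (hρ : ρ.IsPositive) : etr (extend h ρ) = etr ρ := by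
  rw [← ev_one, ← cyl_one h, ev_extend h hρ, ev_one]

/-- It suffices to consider domains that contain a given finite set of variables: an input with a
smaller domain can be extended by `|0⋯0⟩`, which changes neither the weights on the smaller domain
nor their values in the output. -/
theorem sound_of_large {φ ψ : Form Var} {P : Prog Var} (F : Finset Var)
    (H : ∀ V : Finset Var, F ⊆ V → P.vars ⊆ V → ψ.free ⊆ V → ∀ ρ : Op V, IsTC ρ → etr ρ ≠ 0 →
      SatOn ρ φ V → etr (sem V P ρ) = etr ρ → SatOn (sem V P ρ) ψ V) : Sound φ P ψ := by
  intro V hP hψ ρ hρ h0 hsat hterm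
  have h : V ⊆ V ∪ F := Finset.subset_union_left
  have h1 : SatOn (extend h ρ) φ V := hsat.transfer_eq subset_rfl h fun A => by
    rw [ev_extend h hρ.pos, cyl_self]
  have h2 := H (V ∪ F) Finset.subset_union_right (hP.trans h) (hψ.trans h) (extend h ρ)
    (isTC_extend h hρ) (by rwa [etr_extend h hρ.pos]) (h1.mono h)
    (by rw [etr_sem_extend P hP h hρ, hterm, etr_extend h hρ.pos])
  have h3 : SatOn (sem (V ∪ F) P (extend h ρ)) ψ V :=
    (h2.inter_free subset_rfl).mono (Finset.inter_subset_right.trans hψ)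
  exact h3.transfer_eq h subset_rfl fun A => by
    rw [ev_sem_extend P hP h hρ, cyl_self]

/-! ### Operators that commute with a program -/

theorem kraus_commute (P : Prog Var) (hP : P.vars ⊆ V) (hT : T ⊆ V) (hd : Disjoint T P.vars)
    (B : Op T) (p : Path P) : cyl V B * kraus V P p = kraus V P p * cyl V B := by
  rw [kraus_eq_cyl P subset_rfl hP]
  exact cyl_commute hT hP hd _ _

/-- A program commutes with conditioning on variables that do not occur in it. -/
theorem sem_conj (P : Prog Var) (hP : P.vars ⊆ V) (hT : T ⊆ V) (hd : Disjoint T P.vars)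
    {ρ : Op V} (hρ : IsTC ρ) (B : Op T) :
    sem V P (conj (cyl V B) ρ) = conj (cyl V B) (sem V P ρ) := by
  refine eq_of_ev_eq (sem_spec P hP (hρ.conj _)).1.pos
    ((sem_spec P hP hρ).1.conj _).pos fun X => ?_
  rw [ev_sem P hP (hρ.conj _), ev_conj, ev_sem P hP hρ]
  refine tsum_congr fun p => ?_
  rw [ev_conj]
  change ev ρ (X * kraus V P p * cyl V B) = ev ρ (X * cyl V B * kraus V P p)
  rw [mul_assoc, mul_assoc, kraus_commute P hP hT hd]

theorem ennreal_eq_of_add_eq {a a' b b' : ℝ≥0∞} (ha : a ≤ a') (hb : b ≤ b') (h : a' + b' ≤ a + b)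
    (hfin : a' + b' ≠ ∞) : a = a' ∧ b = b' := by
  rw [ENNReal.add_ne_top] at hfin
  constructor
  · refine le_antisymm ha ?_
    have : a' + b' ≤ a + b' := h.trans (by gcongr)
    exact (ENNReal.add_le_add_iff_right hfin.2).mp this
  · refine le_antisymm hb ?_
    have : a' + b' ≤ a' + b := h.trans (by gcongr)
    exact (ENNReal.add_le_add_iff_left hfin.1).mp this

theorem ev_add_ev {ρ : Op V} (hρ : ρ.IsPositive) (X Y : Op V) (C : ℝ≥0∞)
    (h : ∀ ψ, ‖X ψ‖ₑ ^ 2 + ‖Y ψ‖ₑ ^ 2 = C * ‖ψ‖ₑ ^ 2) : ev ρ X + ev ρ Y = C * etr ρ := by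
  obtain ⟨R, rfl⟩ := exists_sqrt hρ
  rw [← ev_one, ev_sqrt, ev_sqrt, ev_sqrt, ← ENNReal.tsum_add, ← ENNReal.tsum_mul_left]
  simp_rw [h]
  rfl

/-- Every operator is part of a pair that is proportional to an isometry; the other member is the
square root of `‖A‖² - A† A`. -/
theorem exists_complement (A : Op S) :
    ∃ L : Op S, ∀ ψ, ‖A ψ‖ₑ ^ 2 + ‖L ψ‖ₑ ^ 2 = ‖A‖ₑ ^ 2 * ‖ψ‖ₑ ^ 2 := by
  have hin : ∀ ψ, ⟪((‖A‖ ^ 2 : ℝ) : ℂ) • ψ - adjoint A (A ψ), ψ⟫_ℂ =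
      ((‖A‖ ^ 2 * ‖ψ‖ ^ 2 - ‖A ψ‖ ^ 2 : ℝ) : ℂ) := by
    intro ψ
    rw [inner_sub_left, inner_smul_left, ContinuousLinearMap.adjoint_inner_left,
      inner_self_eq_norm_sq_to_K, inner_self_eq_norm_sq_to_K]
    simp
  have hpos : (((‖A‖ ^ 2 : ℝ) : ℂ) • (1 : Op S) - adjoint A ∘L A).IsPositive := by
    rw [ContinuousLinearMap.isPositive_iff_complex]
    intro ψ
    have h1 : ⟪(((‖A‖ ^ 2 : ℝ) : ℂ) • (1 : Op S) - adjoint A ∘L A) ψ, ψ⟫_ℂ = _ := hin ψ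
    rw [h1]
    have h2 : ‖A ψ‖ ^ 2 ≤ (‖A‖ * ‖ψ‖) ^ 2 := by gcongr; exact A.le_opNorm ψ
    rw [mul_pow] at h2
    exact ⟨congrArg Complex.ofReal (Complex.ofReal_re _),
      (sub_nonneg.mpr h2).trans_eq (Complex.ofReal_re _).symm⟩
  obtain ⟨L, hL⟩ := exists_sqrt hpos
  refine ⟨L, fun ψ => ?_⟩
  have h1 : ‖L ψ‖ ^ 2 = ‖A‖ ^ 2 * ‖ψ‖ ^ 2 - ‖A ψ‖ ^ 2 := by
    have h2 : ⟪(adjoint L ∘L L) ψ, ψ⟫_ℂ = ((‖A‖ ^ 2 * ‖ψ‖ ^ 2 - ‖A ψ‖ ^ 2 : ℝ) : ℂ) := by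
      rw [← hL]
      exact hin ψ
    rw [ContinuousLinearMap.comp_apply, ContinuousLinearMap.adjoint_inner_left,
      inner_self_eq_norm_sq_to_K] at h2
    exact Complex.ofReal_injective ((Complex.ofReal_pow _ _).trans h2)
  rw [enorm_sq_eq_ofReal (A ψ), enorm_sq_eq_ofReal (L ψ), enorm_sq_eq_ofReal ψ,
    enorm_sq_eq_ofReal A, ← ENNReal.ofReal_add (by positivity) (by positivity),
    ← ENNReal.ofReal_mul (by positivity), h1]
  congr 1
  ring

/-- A program that terminates on `ρ` preserves the restriction of `ρ` to variables that do not occur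
in it: no weight can increase, and the weights of `A` and of its complement `L` have the same sum
before and after the program. -/
theorem ev_sem_of_disjoint (P : Prog Var) (hP : P.vars ⊆ V) (hT : T ⊆ V) (hd : Disjoint T P.vars)
    {ρ : Op V} (hρ : IsTC ρ) (hterm : etr (sem V P ρ) = etr ρ) (A : Op T) :
    ev (sem V P ρ) (cyl V A) = ev ρ (cyl V A) := by
  have hle : ∀ B : Op T, ev (sem V P ρ) (cyl V B) ≤ ev ρ (cyl V B) := fun B => by
    rw [ev, ← sem_conj P hP hT hd hρ]
    exact etr_sem_le P hP (hρ.conj _)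
  obtain ⟨L, hL⟩ := exists_complement A
  have hL' : ∀ ψ, ‖cyl V A ψ‖ₑ ^ 2 + ‖cyl V L ψ‖ₑ ^ 2 = ‖A‖ₑ ^ 2 * ‖ψ‖ₑ ^ 2 := fun ψ => by
    rw [enorm_sq_cyl hT, enorm_sq_cyl hT, ← ENNReal.tsum_add, enorm_sq_eq_tsum_slice hT,
      ← ENNReal.tsum_mul_left]
    simp_rw [hL]
  have h1 := ev_add_ev hρ.pos _ _ _ hL'
  have h2 := ev_add_ev (sem_spec P hP hρ).1.pos _ _ _ hL'
  rw [hterm] at h2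
  exact (ennreal_eq_of_add_eq (hle A) (hle L) (by rw [h1, h2])
    (ENNReal.add_ne_top.mpr ⟨ev_ne_top hρ _, ev_ne_top hρ _⟩)).1

/-! ### Conditioning on an independent system -/

/-- Conditioning on a system that is independent of `S` does not affect satisfaction on `S`. -/
theorem SatOn.conj_of_indep {ρ : Op V} {φ : Form Var} (hρ : IsTC ρ) (h0 : etr ρ ≠ 0) (hS : S ⊆ V)
    (hi : Indep S T ρ) (h : SatOn ρ φ S) (B : Op T) : SatOn (conj (cyl V B) ρ) φ S :=
  h.transfer hS hS (c := ev ρ (cyl V B) / etr ρ) fun A => by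
    rw [ev_conj, ENNReal.div_eq_inv_mul, mul_assoc, mul_comm (ev ρ (cyl V B)), ← hi,
      mul_comm _ (etr ρ), ← mul_assoc, ENNReal.inv_mul_cancel h0 hρ.fin, one_mul]
    rfl

/-- Conditioning on one of two independent systems keeps them independent. -/
theorem Indep.conj_right {ρ : Op V} (hρ : IsTC ρ) (h0 : etr ρ ≠ 0) (hT : T ⊆ V) (hi : Indep S T ρ)
    (B : Op T) : Indep S T (conj (cyl V B) ρ) := by
  intro A C
  have e1 : ev (conj (cyl V B) ρ) (cyl V A * cyl V C) = ev ρ (cyl V A * cyl V (C * B)) := by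
    rw [ev_conj, cyl_mul hT, ← mul_assoc]; rfl
  have e2 : ev (conj (cyl V B) ρ) (cyl V A) = ev ρ (cyl V A * cyl V B) := by rw [ev_conj]; rfl
  have e3 : ev (conj (cyl V B) ρ) (cyl V C) = ev ρ (cyl V (C * B)) := by
    rw [ev_conj, cyl_mul hT]; rfl
  have e4 : etr (conj (cyl V B) ρ) = ev ρ (cyl V B) := rfl
  rw [e1, e2, e3, e4]
  refine (ENNReal.mul_left_inj h0 hρ.fin).mp ?_
  calc _ = ev ρ (cyl V A * cyl V (C * B)) * etr ρ * ev ρ (cyl V B) := by ring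
    _ = ev ρ (cyl V A * cyl V B) * etr ρ * ev ρ (cyl V (C * B)) := by rw [hi, hi]; ring
    _ = _ := by ring

/-! ### Structural rules -/

theorem sem_seq (P Q : Prog Var) (hP : P.vars ⊆ V) (hQ : Q.vars ⊆ V) {ρ : Op V} (hρ : IsTC ρ) :
    sem V (.seq P Q) ρ = sem V Q (sem V P ρ) := by
  have hPQ : (Prog.seq P Q).vars ⊆ V := Finset.union_subset hP hQ
  have h1 := (sem_spec P hP hρ).1
  refine eq_of_ev_eq (sem_spec _ hPQ hρ).1.pos (sem_spec Q hQ h1).1.pos fun X => ?_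
  rw [ev_sem _ hPQ hρ, ev_sem Q hQ h1]
  simp_rw [ev_sem P hP hρ]
  change ∑' p : Path P × Path Q, ev ρ (X ∘L (kraus V Q p.2 * kraus V P p.1)) = _
  rw [ENNReal.tsum_prod', ENNReal.tsum_comm]
  rfl

theorem sem_skip {ρ : Op V} (hρ : IsTC ρ) : sem V .skip ρ = ρ := by
  have h : (Prog.skip : Prog Var).vars ⊆ V := Finset.empty_subset V
  refine eq_of_ev_eq (sem_spec _ h hρ).1.pos hρ.pos fun X => ?_
  rw [ev_sem _ h hρ]
  change ∑' _ : PUnit, ev ρ (X ∘L (1 : Op V)) = _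
  rw [tsum_fintype, Finset.univ_unique, Finset.sum_singleton]
  rfl

theorem sound_skip (φ : Form Var) : Sound φ .skip φ := fun V _ _ ρ hρ _ hsat _ => by
  rwa [sem_skip hρ]

theorem sound_seq {φ ψ μ : Form Var} {P Q : Prog Var} (h1 : Sound φ P ψ) (h2 : Sound ψ Q μ) :
    Sound φ (.seq P Q) μ := by
  refine sound_of_large ψ.free fun V hψ hPQ hμ ρ hρ h0 hsat hterm => ?_
  have hP : P.vars ⊆ V := Finset.subset_union_left.trans hPQ
  have hQ : Q.vars ⊆ V := Finset.subset_union_right.trans hPQ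
  rw [sem_seq P Q hP hQ hρ] at hterm ⊢
  have hσ := (sem_spec P hP hρ).1
  have e : etr (sem V P ρ) = etr ρ :=
    le_antisymm (etr_sem_le P hP hρ) (hterm ▸ etr_sem_le Q hQ hσ)
  exact h2 V hQ hμ _ hσ (by rwa [e]) (h1 V hP hψ ρ hρ h0 hsat e) (by rw [hterm, e])

theorem below_refl (ρ : State V) : Below ρ ρ := below_iff.mpr ⟨subset_rfl, fun A => by rw [cyl_self]⟩

theorem satOn_of_gimp {φ ψ : Form Var} (hφ : φ.Res) (hψ : ψ.Res) (h : (gimp φ ψ).Valid)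
    (hφV : φ.free ⊆ V) (hψV : ψ.free ⊆ V) {ρ : Op V} (hρ : IsTC ρ) (h0 : etr ρ ≠ 0)
    (hsat : SatOn ρ φ V) : SatOn ρ ψ V := by
  obtain ⟨σ, h1, h2, -⟩ := exists_normalized hρ h0
  rw [satOn_iff_of_normalized h1 h2 subset_rfl, ← sat_iff_satOn (by assumption)] at hsat ⊢
  exact h V σ V σ (below_refl σ) (Finset.union_subset hφV hψV) V σ (below_refl σ) hsat

theorem sound_weak {φ φ' ψ ψ' : Form Var} {P : Prog Var} (hφ : φ.Res) (hφ' : φ'.Res) (hψ : ψ.Res)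
    (hψ' : ψ'.Res) (h1 : (gimp φ φ').Valid) (h : Sound φ' P ψ') (h2 : (gimp ψ' ψ).Valid) :
    Sound φ P ψ := by
  refine sound_of_large (φ.free ∪ φ'.free ∪ ψ'.free) fun V hF hP hψV ρ hρ h0 hsat hterm => ?_
  have f1 : φ.free ⊆ V :=
    (Finset.subset_union_left.trans Finset.subset_union_left).trans hF
  have f2 : φ'.free ⊆ V :=
    (Finset.subset_union_right.trans Finset.subset_union_left).trans hF
  have f3 : ψ'.free ⊆ V := Finset.subset_union_right.trans hF
  exact satOn_of_gimp hψ' hψ h2 f3 hψV (sem_spec P hP hρ).1 (by rwa [hterm])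
    (h V hP f3 ρ hρ h0 (satOn_of_gimp hφ hφ' h1 f1 f2 hρ h0 hsat) hterm)

theorem sound_conj {φ₁ φ₂ ψ₁ ψ₂ : Form Var} {P : Prog Var} (h1 : Sound φ₁ P ψ₁)
    (h2 : Sound φ₂ P ψ₂) : Sound (.and φ₁ φ₂) P (.and ψ₁ ψ₂) :=
  fun V hP hψ ρ hρ h0 hsat hterm =>
    ⟨h1 V hP (Finset.subset_union_left.trans hψ) ρ hρ h0 hsat.1 hterm,
      h2 V hP (Finset.subset_union_right.trans hψ) ρ hρ h0 hsat.2 hterm⟩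

theorem sound_disj {φ₁ φ₂ ψ₁ ψ₂ : Form Var} {P : Prog Var} (h1 : Sound φ₁ P ψ₁)
    (h2 : Sound φ₂ P ψ₂) : Sound (.or φ₁ φ₂) P (.or ψ₁ ψ₂) :=
  fun V hP hψ ρ hρ h0 hsat hterm =>
    hsat.imp (fun hs => h1 V hP (Finset.subset_union_left.trans hψ) ρ hρ h0 hs hterm)
      (fun hs => h2 V hP (Finset.subset_union_right.trans hψ) ρ hρ h0 hs hterm)

theorem satOn_sem_of_disjoint {μ : Form Var} {P : Prog Var} (hP : P.vars ⊆ V)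
    (hd : Disjoint μ.free P.vars) {ρ : Op V} (hρ : IsTC ρ) (hterm : etr (sem V P ρ) = etr ρ)
    (hW : W ⊆ V) (h : SatOn ρ μ W) : SatOn (sem V P ρ) μ W := by
  have hsub : W ∩ μ.free ⊆ V := Finset.inter_subset_left.trans hW
  refine SatOn.mono ((h.inter_free hW).transfer_eq hsub hsub fun A => ?_) Finset.inter_subset_left
  exact ev_sem_of_disjoint P hP hsub (hd.mono_left Finset.inter_subset_right) hρ hterm A

theorem sound_const {φ ψ μ : Form Var} {P : Prog Var} (h : Sound φ P ψ)
    (hd : Disjoint μ.free P.vars) : Sound (.and φ μ) P (.and ψ μ) :=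
  fun V hP hψ ρ hρ h0 hsat hterm =>
    ⟨h V hP (Finset.subset_union_left.trans hψ) ρ hρ h0 hsat.1 hterm,
      satOn_sem_of_disjoint hP hd hρ hterm subset_rfl hsat.2⟩

/-! ### The frame rule -/

/-- A system on which a formula holds contains all variables that the formula covers. -/
theorem subset_of_covers {φ : Form Var} (hφ : φ.Res) {X : Finset Var} (hc : φ.Covers X)
    {ρ : Op V} (hρ : IsTC ρ) (h0 : etr ρ ≠ 0) (hS : S ⊆ V) (h : SatOn ρ φ S) : X ⊆ S := by
  obtain ⟨τ, h1, h2, -⟩ := exists_normalized hρ h0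
  rw [satOn_iff_of_normalized h1 h2 hS] at h
  obtain ⟨σ, hσ⟩ := exists_restrict τ hS
  refine hc S σ ((sat_iff_satOn hφ σ).mpr (h.transfer_eq hS subset_rfl fun A => ?_))
  rw [cyl_self, (below_iff.mp hσ).2]

open Classical in
theorem cyl_rankOne_ket (h : S ⊆ V) (a : Basis S) (x : Basis V) :
    cyl V (InnerProductSpace.rankOne ℂ (ket a) (ket a)) (ket x) =
      if res h x = a then ket x else 0 := by
  conv_lhs => rw [← glue_res h x, ← sliceL_ket h, cyl_sliceL]
  rw [InnerProductSpace.rankOne_apply, inner_ket_ket]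
  by_cases ha : res h x = a
  · rw [if_pos ha.symm, if_pos ha, one_smul, ← ha, sliceL_ket h, glue_res h]
  · rw [if_neg (Ne.symm ha), if_neg ha, zero_smul, map_zero]

/-- The systems `S` and `T` are disjoint if conditioning on `T` does not affect `S`: otherwise
a common variable could be moved to either of two basis states. -/
theorem disjoint_of_ev_eq (hdim : ∀ q : Var, Nontrivial (Label q)) {ρ : Op V} (hρ : IsTC ρ)
    (h0 : etr ρ ≠ 0) (hS : S ⊆ V) (hT : T ⊆ V) {w : Op S → ℝ≥0∞}
    (h : ∀ (A : Op S) (B : Op T), ev ρ (cyl V A * cyl V B) = ev ρ (cyl V B) * w A) :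
    Disjoint S T := by
  classical
  rw [Finset.disjoint_left]
  intro v hvS hvT
  have hv : {v} ⊆ S := Finset.singleton_subset_iff.mpr hvS
  have hv' : {v} ⊆ T := Finset.singleton_subset_iff.mpr hvT
  -- `|k⟩⟨b|` moves `T` to the basis state `|k⟩`
  let K : Basis T → Basis T → Op T := fun k b => InnerProductSpace.rankOne ℂ (ket k) (ket b)
  have hsum : ∀ k, ∑' b, ev ρ (cyl V (K k b)) = etr ρ := fun k => by
    rw [← ev_one]
    exact ev_eq_tsum hρ.pos _ _ (tsum_enorm_sq_reset hT k)
  let k₁ : Basis T := zeros T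
  have := hdim v
  obtain ⟨c, hc⟩ := exists_ne (zero v)
  let k₂ : Basis T := Function.update k₁ ⟨v, hvT⟩ c
  have hne : ∀ k, ∃ b, ev ρ (cyl V (K k b)) ≠ 0 := fun k => by
    by_contra hh
    push Not at hh
    apply h0
    rw [← hsum k]
    simp [hh]
  -- the projection that distinguishes `k₁` and `k₂` at the common variable `v`
  let Q : Op ({v} : Finset Var) :=
    InnerProductSpace.rankOne ℂ (ket (res hv' k₁)) (ket (res hv' k₁))
  have hQ : ∀ k b, cyl T Q * K k b = if res hv' k = res hv' k₁ then K k b else 0 := by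
    intro k b
    ext1 x
    change cyl T Q (InnerProductSpace.rankOne ℂ (ket k) (ket b) x) = _
    rw [InnerProductSpace.rankOne_apply, map_smul, cyl_rankOne_ket hv']
    split_ifs
    · rfl
    · rw [smul_zero]; rfl
  have hkey : ∀ k b, ev ρ (cyl V (cyl T Q * K k b)) = ev ρ (cyl V (K k b)) * w (cyl S Q) := by
    intro k b
    rw [← h, cyl_mul hT, cyl_cyl hv' hT, cyl_cyl hv hS]
  obtain ⟨b₁, hb₁⟩ := hne k₁
  obtain ⟨b₂, hb₂⟩ := hne k₂
  have h1 := hkey k₁ b₁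
  have h2 := hkey k₂ b₂
  rw [hQ, if_pos rfl] at h1
  rw [hQ, if_neg] at h2
  · have hcyl : cyl V (0 : Op T) = 0 := by
      simpa using cyl_smul hT (0 : ℂ) (0 : Op T)
    have hz : ev ρ (cyl V (0 : Op T)) = 0 := by
      rw [hcyl]
      simp [ev, etr, conj, qf]
    rw [hz, eq_comm, mul_eq_zero, or_iff_right hb₂] at h2
    rw [h2, mul_zero] at h1
    exact hb₁ h1
  · intro hh
    have := congrFun hh ⟨v, Finset.mem_singleton_self v⟩
    simp only [res, k₂, Function.update_self] at this
    exact hc this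

/-- The frame `μ` holds on a system `T` outside the program, so its part of the conjunction is
preserved. The other part holds on the system `S` of the precondition if that contains `P`, and on the
domain of the least state satisfying `ψ` if `ψ` is supported. -/
theorem sound_frame (hdim : ∀ q : Var, Nontrivial (Label q)) {φ ψ μ : Form Var} {P : Prog Var}
    (hφ : φ.Res) (hψ : ψ.Res) (h : Sound φ P ψ) (hd : Disjoint μ.free P.vars)
    (hside : (ψ.free ∪ P.vars ⊆ φ.free ∧ φ.Covers (ψ.free ∪ P.vars)) ∨ ψ.SP) :
    Sound (.star φ μ) P (.star ψ μ) := by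
  intro V hP hfree ρ hρ h0 hsat hterm
  have hψV : ψ.free ⊆ V := Finset.subset_union_left.trans hfree
  obtain ⟨S, T₀, hS, hT₀, hST₀, hi₀, hsφ, hsμ⟩ := hsat
  -- the frame may be restricted to its free variables, which the program does not touch
  have hsμ := hsμ.inter_free hT₀
  obtain ⟨T, hTdef⟩ : ∃ T, T = T₀ ∩ μ.free := ⟨_, rfl⟩
  rw [← hTdef] at hsμ
  have hTT₀ : T ⊆ T₀ := hTdef ▸ Finset.inter_subset_left
  have hT : T ⊆ V := hTT₀.trans hT₀
  have hST : Disjoint S T := hST₀.mono_right hTT₀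
  have hi : Indep S T ρ := hi₀.mono hS hT₀ subset_rfl hTT₀
  have hTP : Disjoint T P.vars := hd.mono_left (hTdef ▸ Finset.inter_subset_right)
  have hσ := (sem_spec P hP hρ).1
  have hμ' : SatOn (sem V P ρ) μ T := satOn_sem_of_disjoint hP hd hρ hterm hT hsμ
  have hB : ∀ B : Op T, ev (sem V P ρ) (cyl V B) = ev ρ (cyl V B) :=
    ev_sem_of_disjoint P hP hT hTP hρ hterm
  rcases hside with ⟨-, hcov⟩ | hsp
  · have hX : ψ.free ∪ P.vars ⊆ S := subset_of_covers hφ hcov hρ h0 hS hsφ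
    have hPS : P.vars ⊆ S := Finset.subset_union_right.trans hX
    refine ⟨S, T, hS, hT, hST, fun A B => ?_, ?_, hμ'⟩
    · rw [hB, hterm, ev_sem P hP hρ, ev_sem P hP hρ, ← ENNReal.tsum_mul_right,
        ← ENNReal.tsum_mul_right]
      refine tsum_congr fun p => ?_
      have e1 : cyl V A ∘L kraus V P p = cyl V (A * kraus S P p) := by
        rw [cyl_mul hS, ← kraus_eq_cyl P hPS hS]; rfl
      have e2 : (cyl V A * cyl V B) ∘L kraus V P p = cyl V (A * kraus S P p) * cyl V B := by
        change cyl V A * cyl V B * kraus V P p = _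
        rw [mul_assoc, kraus_commute P hP hT hTP, ← mul_assoc, ← e1]; rfl
      rw [e1, e2, hi]
    · exact ((h V hP hψV ρ hρ h0 (hsφ.mono hS) hterm).inter_free subset_rfl).mono
        (Finset.inter_subset_right.trans (Finset.subset_union_left.trans hX))
  -- conditioning the input on `T` does not affect the precondition
  · have hsol : ∀ B : Op T, etr (conj (cyl V B) ρ) ≠ 0 →
        SatOn (conj (cyl V B) (sem V P ρ)) ψ V := fun B hB0 => by
      rw [← sem_conj P hP hT hTP hρ]
      refine h V hP hψV _ (hρ.conj _) hB0 ((hsφ.conj_of_indep hρ h0 hS hi B).mono hS) ?_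
      rw [sem_conj P hP hT hTP hρ]
      exact hB B
    have h0' : etr (sem V P ρ) ≠ 0 := by rwa [hterm]
    have hsat1 := h V hP hψV ρ hρ h0 (hsφ.mono hS) hterm
    obtain ⟨τ, hτ1, hτ2, -⟩ := exists_normalized hσ h0'
    obtain ⟨S₀, σ, hσψ, hleast⟩ := hsp ⟨V, τ, (sat_iff_satOn hψ τ).mpr
      ((satOn_iff_of_normalized hτ1 hτ2 subset_rfl).mp hsat1)⟩
    have hS₀ : S₀ ⊆ V := (below_iff.mp (hleast V τ ((sat_iff_satOn hψ τ).mpr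
      ((satOn_iff_of_normalized hτ1 hτ2 subset_rfl).mp hsat1)))).1
    -- conditioned on `T`, the output restricts to the least state satisfying the postcondition
    have hkey : ∀ (A : Op S₀) (B : Op T), ev (sem V P ρ) (cyl V A * cyl V B) =
        ev (sem V P ρ) (cyl V B) * ev σ.op A := by
      intro A B
      by_cases hB0 : etr (conj (cyl V B) ρ) = 0
      · have h1 : ev (sem V P ρ) (cyl V B) = 0 := by rw [hB]; exact hB0
        have h2 := ev_comp_le hσ.pos (cyl V A) (cyl V B)
        rw [h1, mul_zero] at h2
        rw [h1, zero_mul]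
        exact le_antisymm h2 zero_le
      · have h1 : IsTC (conj (cyl V B) (sem V P ρ)) := hσ.conj _
        have h2 : etr (conj (cyl V B) (sem V P ρ)) ≠ 0 := by
          have : etr (conj (cyl V B) (sem V P ρ)) = etr (conj (cyl V B) ρ) := hB B
          rwa [this]
        obtain ⟨κ, hκ1, hκ2, hκ3⟩ := exists_normalized h1 h2
        have hb := hleast V κ ((sat_iff_satOn hψ κ).mpr
          ((satOn_iff_of_normalized hκ1 hκ2 subset_rfl).mp (hsol B hB0)))
        have h3 : ev (sem V P ρ) (cyl V A * cyl V B) =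
            ev (conj (cyl V B) (sem V P ρ)) (cyl V A) := by rw [ev_conj]; rfl
        rw [h3, hκ3, (below_iff.mp hb).2]
        rfl
    have hkey1 : ∀ A : Op S₀, ev (sem V P ρ) (cyl V A) = etr (sem V P ρ) * ev σ.op A := by
      intro A
      have := hkey A 1
      rwa [cyl_one hT, mul_one, ev_one] at this
    refine ⟨S₀, T, hS₀, hT, disjoint_of_ev_eq hdim hσ h0' hS₀ hT hkey, fun A B => ?_, ?_, hμ'⟩
    · rw [hkey, hkey1]
      ring
    · refine ((sat_iff_satOn hψ σ).mp hσψ).transfer subset_rfl hS₀ (c := etr (sem V P ρ))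
        fun A => ?_
      rw [hkey1, cyl_self]

/-! ### Measurements -/

theorem cyl_zero (h : S ⊆ V) : cyl V (0 : Op S) = 0 := by
  simpa using cyl_smul h (0 : ℂ) (0 : Op S)

theorem ev_zero (ρ : Op V) : ev ρ (0 : Op V) = 0 := by simp [ev, etr, conj, qf]

theorem ev_sum {ι : Type*} (s : Finset ι) {F : ι → Op V} (hF : ∀ i ∈ s, IsTC (F i)) (X : Op V) :
    ev (∑ i ∈ s, F i) X = ∑ i ∈ s, ev (F i) X := by
  classical
  induction s using Finset.induction_on with
  | empty => simp [ev, etr, conj, qf]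
  | insert a s ha ih =>
    have h1 : ∀ i ∈ s, IsTC (F i) := fun i hi => hF i (Finset.mem_insert_of_mem hi)
    rw [Finset.sum_insert ha, Finset.sum_insert ha,
      ev_add (hF a (Finset.mem_insert_self a s)).pos (isTC_sum s h1).pos, ih h1]

theorem perp_mul_eq_zero {A B : Op S} (h : A * B = 0) : perp (closedKer A) * B = 0 := by
  ext1 x
  exact perp_apply_eq_zero.mpr (congrArg (fun C : Op S => C x) h)

/-- After the outcome of the projection `P`, the state is supported in the range of `P`. -/
theorem ev_conj_projAtom (hS : S ⊆ V) (ρ : Op V) {P : Op S} (hP : IsStarProjection P) :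
    ev (conj (cyl V P) ρ) (cyl V (perp (closedKer (P - 1)))) = 0 := by
  have h : perp (closedKer (P - 1)) * P = 0 := perp_mul_eq_zero <| by
    rw [sub_mul, one_mul, hP.isIdempotentElem.eq, sub_self]
  rw [ev_conj]
  change ev ρ (cyl V (perp (closedKer (P - 1))) * cyl V P) = 0
  rw [← cyl_mul hS, h, cyl_zero hS, ev_zero]

/-- A measurement of a system that is independent of `φ` does not affect `φ`, and its outcome is
certain afterwards. -/
theorem SatOn.measure {q : Finset Var} {φ : Form Var} {ρ : Op V} (hρ : IsTC ρ) (h0 : etr ρ ≠ 0)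
    (h : SatOn ρ (.star φ (.dom q)) V) {P : Op q} (hP : IsStarProjection P) :
    SatOn (conj (cyl V P) ρ) (.star φ (projAtom P)) V := by
  obtain ⟨S, T, hS, hT, hST, hi, hφ, hq⟩ := h
  have hq : q ⊆ T := hq
  refine ⟨S, T, hS, hT, hST, ?_, ?_, hq, ev_conj_projAtom (hq.trans hT) ρ hP⟩
  · rw [← cyl_cyl hq hT]
    exact hi.conj_right hρ h0 hT _
  · rw [← cyl_cyl hq hT]
    exact hφ.conj_of_indep hρ h0 hS hi _

theorem sum_etr_measurement {k : ℕ} (M : Measurement S k) (h : S ⊆ V) {ρ : Op V}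
    (hρ : ρ.IsPositive) : ∑ m, etr (conj (cyl V (M.op m)) ρ) = etr ρ := by
  rw [← ev_one ρ, ← ev_eq_tsum hρ (fun m => cyl V (M.op m)) (1 : Op V), tsum_fintype]
  · rfl
  · intro ψ
    rw [tsum_fintype, sum_enorm_sq_measurement M h]
    rfl

/-! ### The conditional -/

theorem sem_ifte {q : Finset Var} {k : ℕ} (M : Measurement q k) (P : Fin k → Prog Var)
    (h : (Prog.ifte q k M P).vars ⊆ V) (hP : ∀ m, (P m).vars ⊆ V) {ρ : Op V} (hρ : IsTC ρ) :
    sem V (.ifte q k M P) ρ = ∑ m, sem V (P m) (conj (cyl V (M.op m)) ρ) := by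
  have h1 : ∀ m ∈ Finset.univ, IsTC (sem V (P m) (conj (cyl V (M.op m)) ρ)) := fun m _ =>
    (sem_spec (P m) (hP m) (hρ.conj _)).1
  refine eq_of_ev_eq (sem_spec _ h hρ).1.pos (isTC_sum _ h1).pos fun X => ?_
  rw [ev_sem _ h hρ, ev_sum _ h1]
  change ∑' p : Σ m, Path (P m), ev ρ (X ∘L (kraus V (P p.1) p.2 * cyl V (M.op p.1))) = _
  rw [ENNReal.tsum_sigma', tsum_fintype]
  refine Finset.sum_congr rfl fun m _ => ?_
  rw [ev_sem (P m) (hP m) (hρ.conj _)]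
  refine tsum_congr fun p => ?_
  rw [ev_conj]
  rfl

theorem ennreal_eq_of_sum_eq {ι : Type*} (s : Finset ι) {f g : ι → ℝ≥0∞}
    (hle : ∀ i ∈ s, f i ≤ g i) (h : ∑ i ∈ s, f i = ∑ i ∈ s, g i) (hfin : ∑ i ∈ s, g i ≠ ∞) :
    ∀ i ∈ s, f i = g i := by
  classical
  intro i hi
  rw [← Finset.add_sum_erase s f hi, ← Finset.add_sum_erase s g hi] at h
  rw [← Finset.add_sum_erase s g hi] at hfin
  exact (ennreal_eq_of_add_eq (hle i hi)
    (Finset.sum_le_sum fun j hj => hle j (Finset.mem_of_mem_erase hj)) h.ge hfin).1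

/-- The output is the sum of the outputs of the branches; each branch terminates on its input, since
the traces of these inputs add up to the trace of `ρ`. -/
theorem sound_rif {q : Finset Var} {k : ℕ} {M : Measurement q k} {P : Fin k → Prog Var}
    {φ ψ : Form Var} (hψ : ψ.Res) (h : ∀ m, Sound (.star φ (projAtom (M.op m))) (P m) ψ)
    (hcm : ψ.CM) : Sound (.star φ (.dom q)) (.ifte q k M P) ψ := by
  intro V hV hψV ρ hρ h0 hsat hterm
  have hq : q ⊆ V := Finset.subset_union_left.trans hV
  have hP : ∀ m, (P m).vars ⊆ V := fun m =>
    ((Finset.subset_biUnion_of_mem (fun m => (P m).vars) (Finset.mem_univ m)).trans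
      Finset.subset_union_right).trans hV
  have htc : ∀ m ∈ Finset.univ, IsTC (sem V (P m) (conj (cyl V (M.op m)) ρ)) := fun m _ =>
    (sem_spec (P m) (hP m) (hρ.conj _)).1
  have hsum : ∑ m, etr (sem V (P m) (conj (cyl V (M.op m)) ρ)) =
      ∑ m, etr (conj (cyl V (M.op m)) ρ) := by
    rw [sum_etr_measurement M hq hρ.pos, ← hterm, sem_ifte M P hV hP hρ]
    simp_rw [← ev_one]
    exact (ev_sum _ htc _).symm
  have hterm' := ennreal_eq_of_sum_eq Finset.univ
    (fun m _ => etr_sem_le (P m) (hP m) (hρ.conj _)) hsum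
    (by rw [sum_etr_measurement M hq hρ.pos]; exact hρ.fin)
  have h0' : etr (sem V (.ifte q k M P) ρ) ≠ 0 := by rwa [hterm]
  rw [sem_ifte M P hV hP hρ] at h0' ⊢
  refine SatOn.sum hψ hcm _ htc (fun m hm hm0 => ?_) h0'
  have e := hterm' m hm
  exact h m V (hP m) hψV _ (hρ.conj _) (by rwa [← e]) (hsat.measure hρ h0 (M.isProj m)) e

/-! ### The loop -/

/-- One iteration of the loop `while M[q] = 1 do P od`. -/
def loopStep {q : Finset Var} (V : Finset Var) (M : Measurement q 2) (P : Prog Var) (ρ : Op V) :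
    Op V := sem V P (conj (cyl V (M.op 1)) ρ)

theorem isTC_loopStep {q : Finset Var} (M : Measurement q 2) {P : Prog Var} (hP : P.vars ⊆ V)
    {ρ : Op V} (hρ : IsTC ρ) : IsTC (loopStep V M P ρ) := (sem_spec P hP (hρ.conj _)).1

theorem isTC_iterate_loopStep {q : Finset Var} (M : Measurement q 2) {P : Prog Var}
    (hP : P.vars ⊆ V) {ρ : Op V} (hρ : IsTC ρ) (n : ℕ) : IsTC ((loopStep V M P)^[n] ρ) := by
  induction n generalizing ρ with
  | zero => exact hρ
  | succ n ih => exact ih (isTC_loopStep M hP hρ)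

/-- Prefixing a path of the loop by one more iteration. -/
theorem ev_loopStep_kraus {q : Finset Var} (M : Measurement q 2) {P : Prog Var} (hP : P.vars ⊆ V)
    {ρ : Op V} (hρ : IsTC ρ) (X : Op V) (l : List (Path P)) :
    ev (loopStep V M P ρ) (X ∘L kraus V (.while q M P) l) =
      ∑' a, ev ρ (X ∘L kraus V (.while q M P) (a :: l)) := by
  rw [loopStep, ev_sem P hP (hρ.conj _)]
  exact tsum_congr fun a => ev_conj _ _ _

/-- The output of the loop after exactly `n` iterations. -/
theorem ev_exit_loop {q : Finset Var} (M : Measurement q 2) {P : Prog Var} (hP : P.vars ⊆ V)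
    {ρ : Op V} (hρ : IsTC ρ) (X : Op V) (n : ℕ) :
    ev (conj (cyl V (M.op 0)) ((loopStep V M P)^[n] ρ)) X =
      ∑' l : List (Path P), if l.length = n then ev ρ (X ∘L kraus V (.while q M P) l) else 0 := by
  induction n generalizing ρ with
  | zero =>
    rw [tsum_list, ev_conj]
    simp [kraus]
  | succ n ih =>
    rw [Function.iterate_succ_apply, ih (isTC_loopStep M hP hρ)]
    refine Eq.trans ?_ (tsum_list _).symm
    rw [if_neg (show ¬([] : List (Path P)).length = n + 1 from (Nat.succ_ne_zero n).symm), zero_add,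
      ENNReal.tsum_comm]
    refine tsum_congr fun l => ?_
    simp only [List.length_cons, Nat.add_right_cancel_iff]
    split_ifs
    · exact ev_loopStep_kraus M hP hρ X l
    · simp

theorem tsum_ev_exit_loop {q : Finset Var} (M : Measurement q 2) {P : Prog Var}
    (h : (Prog.while q M P).vars ⊆ V) {ρ : Op V} (hρ : IsTC ρ) (X : Op V) :
    ∑' n, ev (conj (cyl V (M.op 0)) ((loopStep V M P)^[n] ρ)) X =
      ev (sem V (.while q M P) ρ) X := by
  have hP : P.vars ⊆ V := Finset.subset_union_right.trans h
  simp_rw [ev_exit_loop M hP hρ X]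
  rw [ENNReal.tsum_comm, ev_sem _ h hρ]
  refine tsum_congr fun l => ?_
  rw [tsum_eq_single l.length fun n hn => if_neg hn.symm, if_pos rfl]

theorem etr_sem_while {q : Finset Var} (M : Measurement q 2) {P : Prog Var}
    (h : (Prog.while q M P).vars ⊆ V) {ρ : Op V} (hρ : IsTC ρ) :
    etr (sem V (.while q M P) ρ) = etr (conj (cyl V (M.op 0)) ρ) +
      etr (sem V (.while q M P) (loopStep V M P ρ)) := by
  have hP : P.vars ⊆ V := Finset.subset_union_right.trans h
  rw [← ev_one, ← ev_one, ← ev_one, ← tsum_ev_exit_loop M h hρ,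
    ← tsum_ev_exit_loop M h (isTC_loopStep M hP hρ), tsum_eq_zero_add' ENNReal.summable]
  rfl

/-- If the loop terminates on `ρ`, then the body terminates on its input, and the loop terminates
after one iteration. -/
theorem loopStep_terminates {q : Finset Var} (M : Measurement q 2) {P : Prog Var}
    (h : (Prog.while q M P).vars ⊆ V) {ρ : Op V} (hρ : IsTC ρ)
    (hterm : etr (sem V (.while q M P) ρ) = etr ρ) :
    etr (loopStep V M P ρ) = etr (conj (cyl V (M.op 1)) ρ) ∧
      etr (sem V (.while q M P) (loopStep V M P ρ)) = etr (loopStep V M P ρ) := by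
  have hq : q ⊆ V := Finset.subset_union_left.trans h
  have hP : P.vars ⊆ V := Finset.subset_union_right.trans h
  have h1 := etr_sem_le P hP (hρ.conj (cyl V (M.op 1)))
  have h2 := etr_sem_le _ h (isTC_loopStep M hP hρ)
  have h3 := sum_etr_measurement M hq hρ.pos
  rw [Fin.sum_univ_two] at h3
  rw [etr_sem_while M h hρ, ← h3] at hterm
  have h4 := (ennreal_eq_of_add_eq le_rfl (h2.trans h1) hterm.ge (by rw [h3]; exact hρ.fin)).2
  exact ⟨le_antisymm h1 (h4 ▸ h2), le_antisymm h2 (h4.symm ▸ h1)⟩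

/-- The precondition of the loop holds after `n` iterations, if the loop is entered that often with
nonzero probability. -/
theorem loop_invariant {q : Finset Var} {M : Measurement q 2} {P : Prog Var} {φ : Form Var}
    (hS : Sound (.star φ (projAtom (M.op 1))) P (.star φ (.dom q)))
    (h : (Prog.while q M P).vars ⊆ V) (hφV : φ.free ⊆ V) (n : ℕ) {ρ : Op V} (hρ : IsTC ρ)
    (hsat : etr ρ ≠ 0 → SatOn ρ (.star φ (.dom q)) V)
    (hterm : etr (sem V (.while q M P) ρ) = etr ρ)
    (hn : etr ((loopStep V M P)^[n] ρ) ≠ 0) :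
    SatOn ((loopStep V M P)^[n] ρ) (.star φ (.dom q)) V := by
  have hq : q ⊆ V := Finset.subset_union_left.trans h
  have hP : P.vars ⊆ V := Finset.subset_union_right.trans h
  induction n generalizing ρ with
  | zero => exact hsat hn
  | succ n ih =>
    obtain ⟨h1, h2⟩ := loopStep_terminates M h hρ hterm
    refine ih (isTC_loopStep M hP hρ) (fun h0 => ?_) h2 hn
    rw [h1] at h0
    have h0' : etr ρ ≠ 0 := fun hz => h0 <| by
      have := ev_le_etr hρ.pos (cyl V (M.op 1))
      rw [hz, mul_zero] at this
      exact le_antisymm this zero_le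
    exact hS V hP (Finset.union_subset hφV hq) _ (hρ.conj _) h0
      ((hsat h0').measure hρ h0' (M.isProj 1)) h1

/-- The output is the limit of the sums of the outputs after `0, …, n` iterations. These sums satisfy
`φ` since `φ` is closed under mixtures, and the limit does since satisfaction is closed. -/
theorem sound_rloop {q : Finset Var} {M : Measurement q 2} {P : Prog Var} {φ : Form Var}
    (hφ : φ.Res) (hS : Sound (.star φ (projAtom (M.op 1))) P (.star φ (.dom q))) (hcm : φ.CM) :
    Sound (.star φ (.dom q)) (.while q M P) (.and φ (projAtom (M.op 0))) := by
  intro V h hfree ρ hρ h0 hsat hterm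
  have hq : q ⊆ V := Finset.subset_union_left.trans h
  have hP : P.vars ⊆ V := Finset.subset_union_right.trans h
  have hφV : φ.free ⊆ V := Finset.subset_union_left.trans hfree
  have hσ := (sem_spec _ h hρ).1
  refine ⟨?_, hq, ?_⟩
  · have htc : ∀ n, IsTC (conj (cyl V (M.op 0)) ((loopStep V M P)^[n] ρ)) := fun n =>
      (isTC_iterate_loopStep M hP hρ n).conj _
    have hlim : ∀ X : Op V, Tendsto (fun n => ev (∑ i ∈ Finset.range n,
        conj (cyl V (M.op 0)) ((loopStep V M P)^[i] ρ)) X) atTop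
          (𝓝 (ev (sem V (.while q M P) ρ) X)) := fun X => by
      rw [← tsum_ev_exit_loop M h hρ X]
      simp_rw [ev_sum _ fun i _ => htc i]
      exact ENNReal.tendsto_nat_tsum _
    refine SatOn.of_tendsto hσ hlim (Eventually.frequently ?_)
    have hne : etr (sem V (.while q M P) ρ) ≠ 0 := by rwa [hterm]
    have h1 := hlim 1
    rw [ev_one] at h1
    filter_upwards [h1.eventually_ne hne] with n hn
    rw [ev_one] at hn
    refine SatOn.sum hφ hcm _ (fun i _ => htc i) (fun i _ hi => ?_) hn
    have hi' : etr ((loopStep V M P)^[i] ρ) ≠ 0 := fun hz => hi <| by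
      have := ev_le_etr (isTC_iterate_loopStep M hP hρ i).pos (cyl V (M.op 0))
      rw [hz, mul_zero] at this
      exact le_antisymm this zero_le
    obtain ⟨S, T, hS', -, -, -, hs, -⟩ :=
      (loop_invariant hS h hφV i hρ (fun _ => hsat) hterm hi').measure
        (isTC_iterate_loopStep M hP hρ i) hi' (M.isProj 0)
    exact hs.mono hS'
  · rw [← tsum_ev_exit_loop M h hρ]
    simp_rw [ev_conj_projAtom hq _ (M.isProj 0)]
    exact tsum_zero

/-! ### Unitary transformations -/

/-- Vanishing of expectations is decided by the kernels of the observables. -/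
theorem ev_cyl_eq_zero_of {ι : Type*} {X : ι → Op S} {Y : Op S} (hS : S ⊆ V)
    (h : ∀ x, (∀ i, X i x = 0) → Y x = 0) {ρ : Op V} (hρ : ρ.IsPositive)
    (h0 : ∀ i, ev ρ (cyl V (X i)) = 0) : ev ρ (cyl V Y) = 0 := by
  obtain ⟨R, rfl⟩ := exists_sqrt hρ
  have hz : ∀ (A : Op S) (ψ : Hilb V), ‖cyl V A ψ‖ₑ ^ 2 = 0 ↔
      ∀ c, A (adjoint (sliceL hS c) ψ) = 0 := fun A ψ => by
    rw [enorm_sq_cyl hS, ENNReal.tsum_eq_zero]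
    simp
  simp_rw [ev_sqrt, ENNReal.tsum_eq_zero, hz] at h0 ⊢
  exact fun b c => h _ fun i => h0 i b c

theorem ev_cyl_eq_zero_of_perp {K : ClosedSubmodule ℂ (Hilb S)} {A : Op S} (hS : S ⊆ V)
    (h : ∀ x ∈ K, A x = 0) {ρ : Op V} (hρ : ρ.IsPositive) (h0 : ev ρ (cyl V (perp K)) = 0) :
    ev ρ (cyl V A) = 0 :=
  ev_cyl_eq_zero_of hS (X := fun _ : Unit => perp K)
    (fun x hx => h x (perp_apply_eq_zero.mp (hx ()))) hρ fun _ => h0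

theorem ev_mul_cyl_of_disjoint {q : Finset Var} (hq : q ⊆ V) (hS : S ⊆ V) (hd : Disjoint q S)
    (U : unitary (Op q)) {ρ : Op V} (hρ : ρ.IsPositive) (A : Op S) (X : Op V)
    (hX : X * cyl V U.1 = cyl V U.1 * X) :
    ev ρ (cyl V A * X * cyl V U.1) = ev ρ (cyl V A * X) := by
  rw [mul_assoc, hX, ← mul_assoc, cyl_commute hS hq hd.symm, mul_assoc]
  exact ev_congr hρ _ _ fun ψ => enorm_cyl_unitary hq U _

theorem ev_conj_unitary_of_disjoint {q : Finset Var} (hq : q ⊆ V) (hS : S ⊆ V) (hd : Disjoint q S)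
    (U : unitary (Op q)) {ρ : Op V} (hρ : ρ.IsPositive) (A : Op S) :
    ev (conj (cyl V U.1) ρ) (cyl V A) = ev ρ (cyl V A) := by
  have h := ev_mul_cyl_of_disjoint hq hS hd U hρ A 1 (by rw [one_mul, mul_one])
  rw [mul_one] at h
  rw [ev_conj]
  exact h

theorem ev_conj_unitary_of_subset {q : Finset Var} (hS : S ⊆ V) (hqS : q ⊆ S)
    (U : unitary (Op q)) (ρ : Op V) (A : Op S) :
    ev (conj (cyl V U.1) ρ) (cyl V A) = ev ρ (cyl V (A * cyl S U.1)) := by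
  rw [ev_conj, cyl_mul hS, cyl_cyl hqS hS]
  rfl

theorem cyl_unitary_mul_adjoint {q : Finset Var} (hq : q ⊆ V) (U : unitary (Op q)) :
    cyl V U.1 * adjoint (cyl V U.1) = 1 := by
  rw [adjoint_cyl hq, ← cyl_mul hq]
  have : U.1 * adjoint U.1 = 1 := Unitary.mul_star_self_of_mem U.2
  rw [this, cyl_one hq]

theorem etr_conj_unitary {q : Finset Var} (hq : q ⊆ V) (U : unitary (Op q)) {ρ : Op V}
    (hρ : ρ.IsPositive) : etr (conj (cyl V U.1) ρ) = etr ρ := by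
  rw [← ev_one ρ]
  exact ev_congr hρ _ _ fun ψ => enorm_cyl_unitary hq U ψ

theorem Indep.conj_unitary {q : Finset Var} (hq : q ⊆ V) (U : unitary (Op q)) {ρ : Op V}
    (hρ : ρ.IsPositive) (hS : S ⊆ V) (hT : T ⊆ V)
    (hqS : q ⊆ S ∨ Disjoint q S) (hqT : Disjoint q T) (hi : Indep S T ρ) :
    Indep S T (conj (cyl V U.1) ρ) := by
  intro A B
  rw [etr_conj_unitary hq U hρ, ev_conj_unitary_of_disjoint hq hT hqT U hρ]
  have hc := cyl_commute hq hT hqT U.1 B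
  rw [ev_conj ρ (cyl V U.1) (cyl V A * cyl V B)]
  rcases hqS with hqS | hqS
  · have e2 : (cyl V A * cyl V B) ∘L cyl V U.1 = cyl V (A * cyl S U.1) * cyl V B := by
      change cyl V A * cyl V B * cyl V U.1 = _
      rw [mul_assoc, ← hc, cyl_mul hS, cyl_cyl hqS hS, mul_assoc]
    rw [e2, hi, ev_conj_unitary_of_subset hS hqS]
  · have eAB : ev ρ ((cyl V A * cyl V B) ∘L cyl V U.1) = ev ρ (cyl V A * cyl V B) :=
      ev_mul_cyl_of_disjoint hq hS hqS U hρ A _ hc.symm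
    rw [eAB, hi, ev_conj_unitary_of_disjoint hq hS hqS U hρ]

/-- The restriction of a formula to variables that a unitary transformation of `q` does not split. -/
theorem exists_aligned {q : Finset Var} {φ : Form Var} (hφ : φ.Res)
    (hc : (q ⊆ φ.free ∧ φ.Covers q) ∨ Disjoint q φ.free) {ρ : Op V} (hρ : IsTC ρ)
    (h0 : etr ρ ≠ 0) (hS : S ⊆ V) (h : SatOn ρ φ S) :
    ∃ S' ⊆ S, (q ⊆ S' ∨ Disjoint q S') ∧ SatOn ρ φ S' := by
  rcases hc with ⟨-, hc⟩ | hc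
  · exact ⟨S, subset_rfl, .inl (subset_of_covers hφ hc hρ h0 hS h), h⟩
  · exact ⟨S ∩ φ.free, Finset.inter_subset_left, .inr (hc.mono_right Finset.inter_subset_right),
      h.inter_free hS⟩

/-- The modification for a unitary transformation is a precondition. For a separating conjunction,
each of the two systems can be chosen to contain `q` or to be disjoint from it. -/
theorem SatOn.conj_unitary {q : Finset Var} (hq : q ⊆ V) (U : unitary (Op q)) {ρ : Op V}
    (hρ : IsTC ρ) (h0 : etr ρ ≠ 0) {φ φ' : Form Var} (hφ : φ.Res)
    (hm : modUnit q U.1 φ = some φ') (hW : W ⊆ V) (h : SatOn ρ φ' W) :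
    SatOn (conj (cyl V U.1) ρ) φ W := by
  induction φ generalizing φ' W with
  | top => trivial
  | bot => cases hm; exact h
  | dom S => cases hm; exact h
  | proj S K =>
    rw [modUnit] at hm
    split_ifs at hm with h1 h2
    · cases hm
      obtain ⟨hSW, hz⟩ := h
      refine ⟨hSW, ?_⟩
      have hS : S ⊆ V := hSW.trans hW
      rw [ev_conj_unitary_of_subset hS h1]
      refine ev_cyl_eq_zero_of_perp hS (fun x hx => ?_) hρ.pos hz
      exact (perp_apply_eq_zero (K := K) (x := cyl S U.1 x)).mpr hx
    · cases hm
      obtain ⟨hSW, hz⟩ := h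
      refine ⟨hSW, ?_⟩
      rw [ev_conj_unitary_of_disjoint hq (hSW.trans hW) h2 U hρ.pos]
      exact hz
  | unif S hfin =>
    rw [modUnit] at hm
    split_ifs at hm with h1
    cases hm
    refine ⟨h.1, fun A => ?_⟩
    have hS : S ⊆ V := h.1.trans hW
    rw [etr_conj_unitary hq U hρ.pos]
    rcases h1 with h1 | h1
    · rw [ev_conj_unitary_of_subset hS h1, h.2]
      have e : conj (cyl S U.1) (1 : Op S) = 1 := cyl_unitary_mul_adjoint h1 U
      have e' := ev_conj (1 : Op S) (cyl S U.1) A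
      rw [e] at e'
      rw [e']
      rfl
    · rw [ev_conj_unitary_of_disjoint hq hS h1 U hρ.pos, h.2]
  | and φ ψ ih1 ih2 =>
    simp only [modUnit, Bind.bind, Option.bind_eq_some_iff] at hm
    obtain ⟨φ₁, h1, ψ₁, h2, h3⟩ := hm
    cases h3
    exact ⟨ih1 hφ.1 h1 hW h.1, ih2 hφ.2 h2 hW h.2⟩
  | or φ ψ ih1 ih2 =>
    simp only [modUnit, Bind.bind, Option.bind_eq_some_iff] at hm
    obtain ⟨φ₁, h1, ψ₁, h2, h3⟩ := hm
    cases h3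
    exact h.imp (ih1 hφ.1 h1 hW) (ih2 hφ.2 h2 hW)
  | star φ ψ ih1 ih2 =>
    rw [modUnit] at hm
    split_ifs at hm with hc
    simp only [Bind.bind, Option.bind_eq_some_iff] at hm
    obtain ⟨φ₁, h1, ψ₁, h2, h3⟩ := hm
    cases h3
    obtain ⟨S, T, hS, hT, hST, hi, hs1, hs2⟩ := h
    have hSV := hS.trans hW
    have hTV := hT.trans hW
    have h0' : etr (conj (cyl V U.1) ρ) ≠ 0 := by rwa [etr_conj_unitary hq U hρ.pos]
    obtain ⟨S', hS', hqS, hs1'⟩ := exists_aligned hφ.1 hc.1 (hρ.conj _) h0' hSV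
      (ih1 hφ.1 h1 hSV hs1)
    obtain ⟨T', hT', hqT, hs2'⟩ := exists_aligned hφ.2 hc.2 (hρ.conj _) h0' hTV
      (ih2 hφ.2 h2 hTV hs2)
    have hST' : Disjoint S' T' := hST.mono hS' hT'
    have hi' : Indep S' T' ρ := hi.mono hSV hTV hS' hT'
    refine ⟨S', T', hS'.trans hS, hT'.trans hT, hST', ?_, hs1', hs2'⟩
    rcases hqT with hqT | hqT
    · exact ((hi'.symm (hS'.trans hSV) (hT'.trans hTV) hST').conj_unitary hq U hρ.pos
        (hT'.trans hTV) (hS'.trans hSV) (.inl hqT) (hST'.symm.mono_left hqT)).symm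
          (hT'.trans hTV) (hS'.trans hSV) hST'.symm
    · exact hi'.conj_unitary hq U hρ.pos (hS'.trans hSV) (hT'.trans hTV) hqS hqT
  | imp φ ψ => exact hφ.elim
  | wand φ ψ => exact hφ.elim

theorem sem_unit {q : Finset Var} (U : unitary (Op q)) (hq : q ⊆ V) {ρ : Op V} (hρ : IsTC ρ) :
    sem V (.unit q U) ρ = conj (cyl V U.1) ρ := by
  have h : (Prog.unit q U).vars ⊆ V := hq
  refine eq_of_ev_eq (sem_spec _ h hρ).1.pos (hρ.conj _).pos fun X => ?_
  rw [ev_sem _ h hρ, ev_conj]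
  change ∑' _ : PUnit, ev ρ (X ∘L cyl V U.1) = _
  rw [tsum_fintype, Finset.univ_unique, Finset.sum_singleton]

theorem sound_unit {q : Finset Var} {U : unitary (Op q)} {φ φ' : Form Var} (hφ : φ.Res)
    (hm : modUnit q U.1 φ = some φ') : Sound φ' (.unit q U) φ := by
  intro V hq _ ρ hρ h0 hsat _
  rw [sem_unit U hq hρ]
  exact hsat.conj_unitary hq U hρ h0 hφ hm subset_rfl

/-! ### Initialization -/

theorem tsum_enorm_sq_cyl (h : S ⊆ V) {ι : Type*} {X : ι → Op S} {Y : Op S}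
    (hXY : ∀ ψ, ∑' i, ‖X i ψ‖ₑ ^ 2 = ‖Y ψ‖ₑ ^ 2) (ψ : Hilb V) :
    ∑' i, ‖cyl V (X i) ψ‖ₑ ^ 2 = ‖cyl V Y ψ‖ₑ ^ 2 := by
  simp_rw [enorm_sq_cyl h]
  rw [ENNReal.tsum_comm]
  exact tsum_congr fun c => hXY _

/-- `|a⟩⟨n| ⊗ I` replaces the slice `n` by the slice `a`. -/
theorem cyl_rankOne (h : S ⊆ V) (a n : Basis (V \ S)) :
    cyl V (InnerProductSpace.rankOne ℂ (ket a) (ket n)) = sliceL h a ∘L adjoint (sliceL h n) := by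
  classical
  have h' : V \ S ⊆ V := Finset.sdiff_subset
  refine clm_ext_ket fun x => ?_
  conv_lhs => rw [← glue_res h' x, ← sliceL_ket h', cyl_sliceL]
  rw [InnerProductSpace.rankOne_apply, inner_ket_ket, ContinuousLinearMap.comp_apply,
    adjoint_sliceL_ket]
  by_cases hn : n = res h' x
  · rw [if_pos hn, if_pos hn.symm, one_smul, sliceL_ket, sliceL_ket]
    congr 1
    funext v
    by_cases hv : v.1 ∈ S <;> simp [glue, res, hv]
  · rw [if_neg hn, if_neg (Ne.symm hn), zero_smul, map_zero, map_zero]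

/-- Measuring `A` after the variables in `Q = S \ W` have been reset amounts to measuring an operator
`C` on `W` with `C† C = B† B`, where `B = A (I ⊗ |0⟩)`. -/
theorem exists_reset_dual (h : W ⊆ S) {Q : Finset Var} (hQ : S \ W = Q) (A : Op S) :
    ∃ C : Op W, (∀ x, C x = 0 ↔ A (sliceL h (zeros (S \ W)) x) = 0) ∧
      ∀ ψ, ∑' n : Basis Q, ‖(A * cyl S (InnerProductSpace.rankOne ℂ (ket (zeros Q)) (ket n))) ψ‖ₑ ^ 2
        = ‖cyl S C ψ‖ₑ ^ 2 := by
  subst hQ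
  let B := A ∘L sliceL h (zeros (S \ W))
  have hpos : (adjoint B ∘L B).IsPositive := ContinuousLinearMap.isPositive_adjoint_comp_self B
  obtain ⟨C, hC⟩ := exists_sqrt hpos
  have hCB : ∀ x, ‖C x‖ₑ ^ 2 = ‖B x‖ₑ ^ 2 := fun x => by rw [← qf_sqrt, ← hC, qf_sqrt]
  refine ⟨C, fun x => ?_, fun ψ => ?_⟩
  · have := hCB x
    constructor
    · intro hx
      rw [hx] at this
      have hB : B x = 0 := by simpa using this.symm
      exact hB
    · intro hx
      have hx : B x = 0 := hx
      rw [hx] at this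
      simpa using this
  · rw [enorm_sq_cyl h]
    refine tsum_congr fun n => ?_
    rw [hCB, cyl_rankOne h]
    rfl

/-- The weight of `A` after the initialization of `q`, also jointly with a system `T` that does not
contain `q`, is the weight before of an operator that does not act on `q`. -/
theorem exists_reset_observable {q : Var} (hW : W ⊆ S) (hS : S ⊆ V)
    (hQ : S \ W = {q}) {ρ : Op V} (hρ : IsTC ρ) (A : Op S) :
    ∃ C : Op W, (∀ x, C x = 0 ↔ A (sliceL hW (zeros (S \ W)) x) = 0) ∧
      ∀ {T : Finset Var} (_ : T ⊆ V) (_ : Disjoint {q} T) (B : Op T),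
        ev (sem V (.init q) ρ) (cyl V A * cyl V B) = ev ρ (cyl V C * cyl V B) := by
  have hqS : {q} ⊆ S := hQ ▸ Finset.sdiff_subset
  have hqV : {q} ⊆ V := hqS.trans hS
  have hWV := hW.trans hS
  obtain ⟨C, h1, h2⟩ := exists_reset_dual hW hQ A
  refine ⟨C, h1, fun {T} hT hd B => ?_⟩
  rw [ev_sem _ hqV hρ]
  refine ev_eq_tsum hρ.pos _ _ fun ψ => ?_
  have h3 := tsum_enorm_sq_cyl hS h2 (cyl V B ψ)
  rw [cyl_cyl hW hS] at h3
  refine Eq.trans (tsum_congr fun n => ?_) h3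
  rw [cyl_mul hS, cyl_cyl hqS hS]
  congr 2
  have hc := cyl_commute hqV hT hd
    (InnerProductSpace.rankOne ℂ (ket (zeros ({q} : Finset Var))) (ket n)) B
  exact congrArg (fun X : Op V => cyl V A (X ψ)) hc.symm

/-- The initialized variable can be added to one of two independent systems. -/
theorem Indep.init {q : Var} (hq : q ∈ V) {W' : Finset Var} (hW : W ⊆ V) (hT : T ⊆ V)
    (hqW : q ∉ W) (hqT : q ∉ T) {ρ : Op V} (hρ : IsTC ρ) (hi : Indep W T ρ)
    (hterm : etr (sem V (.init q) ρ) = etr ρ) (hW' : W' ⊆ insert q W) :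
    Indep W' T (sem V (.init q) ρ) := by
  have hS : insert q W ⊆ V := Finset.insert_subset hq hW
  refine Indep.mono (S := insert q W) (T := T) (fun A B => ?_) hS hT hW' subset_rfl
  have hQ : insert q W \ W = {q} := by
    ext x
    simp only [Finset.mem_sdiff, Finset.mem_insert, Finset.mem_singleton]
    constructor
    · rintro ⟨h | h, h'⟩
      · exact h
      · exact absurd h h'
    · rintro rfl
      exact ⟨.inl rfl, hqW⟩
  have hd : Disjoint {q} T := Finset.disjoint_singleton_left.mpr hqT
  obtain ⟨C, -, hC⟩ := exists_reset_observable (Finset.subset_insert q W) hS hQ hρ A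
  have h1 := hC hT hd B
  have h2 := hC hT hd (1 : Op T)
  rw [cyl_one hT, mul_one, mul_one] at h2
  rw [h1, h2, hterm, hi]
  congr 1
  exact (ev_sem_of_disjoint (.init q) (Finset.singleton_subset_iff.mpr hq) hT hd.symm hρ hterm B).symm

theorem etr_sem_init {q : Var} (hq : q ∈ V) {ρ : Op V} (hρ : IsTC ρ) :
    etr (sem V (.init q) ρ) = etr ρ := by
  have hqV : {q} ⊆ V := Finset.singleton_subset_iff.mpr hq
  rw [← ev_one, ← ev_one ρ, ev_sem _ hqV hρ]
  exact ev_eq_tsum hρ.pos _ _ fun ψ => tsum_enorm_sq_reset hqV _ ψ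

theorem modInit_of_notMem {q : Var} {φ φ' : Form Var} (hm : modInit q φ = some φ')
    (hq : q ∉ φ.free) : φ' = φ := by
  induction φ generalizing φ' with
  | top => cases hm; rfl
  | bot => cases hm; rfl
  | dom S => cases hm; rfl
  | proj S K =>
    have hq : q ∉ S := hq
    rw [modInit, if_neg hq] at hm
    cases hm
    rfl
  | unif S hfin =>
    have hq : q ∉ S := hq
    rw [modInit, if_neg hq] at hm
    cases hm
    rfl
  | and φ ψ ih1 ih2 =>
    simp only [modInit, Bind.bind, Option.bind_eq_some_iff] at hm
    obtain ⟨φ₁, h1, ψ₁, h2, h3⟩ := hm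
    cases h3
    rw [Form.free, Finset.mem_union, not_or] at hq
    rw [ih1 h1 hq.1, ih2 h2 hq.2]
  | or φ ψ ih1 ih2 =>
    simp only [modInit, Bind.bind, Option.bind_eq_some_iff] at hm
    obtain ⟨φ₁, h1, ψ₁, h2, h3⟩ := hm
    cases h3
    rw [Form.free, Finset.mem_union, not_or] at hq
    rw [ih1 h1 hq.1, ih2 h2 hq.2]
  | star φ ψ ih1 ih2 =>
    rw [Form.free, Finset.mem_union, not_or] at hq
    simp only [modInit, Bind.bind, Option.bind_eq_some_iff] at hm
    obtain ⟨φ₁, h1, ψ₁, h2, h3⟩ := hm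
    rw [if_neg hq.1, if_neg hq.2] at h3
    cases h3
    rw [ih1 h1 hq.1, ih2 h2 hq.2]
  | imp φ ψ => cases hm
  | wand φ ψ => cases hm

theorem SatOn.init_of_notMem {q : Var} (hq : q ∈ V) {ρ : Op V} (hρ : IsTC ρ) {φ φ' : Form Var}
    (hm : modInit q φ = some φ') (hqφ : q ∉ φ.free) (hW : W ⊆ V) (h : SatOn ρ φ' W) :
    SatOn (sem V (.init q) ρ) φ W := by
  rw [modInit_of_notMem hm hqφ] at h
  exact satOn_sem_of_disjoint (P := .init q) (Finset.singleton_subset_iff.mpr hq)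
    (Finset.disjoint_singleton_right.mpr hqφ) hρ (etr_sem_init hq hρ) hW h

/-- A separating conjunction of formulas only one of which contains `q` is obtained from the
independence of the other variables before the initialization. -/
theorem SatOn.init_star {q : Var} (hq : q ∈ V) {ρ : Op V} (hρ : IsTC ρ) {φ ψ : Form Var}
    (hW : W ⊆ V) (hqψ : q ∉ ψ.free) (hs1 : SatOn (sem V (.init q) ρ) φ W)
    (hs2 : SatOn (sem V (.init q) ρ) ψ W) (hS : S ⊆ W) (hT : T ⊆ W) (hST : Disjoint S T)
    (hi : Indep S T ρ) (hφS : φ.free \ {q} ⊆ S) (hψT : ψ.free \ {q} ⊆ T) :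
    SatOn (sem V (.init q) ρ) (.star φ ψ) W := by
  have h2 : W ∩ ψ.free ⊆ T := fun x hx => by
    rw [Finset.mem_inter] at hx
    refine hψT (Finset.mem_sdiff.mpr ⟨hx.2, fun hxq => hqψ ?_⟩)
    exact Finset.mem_singleton.mp hxq ▸ hx.2
  have hqT : q ∉ W ∩ ψ.free := fun hh => hqψ (Finset.mem_inter.mp hh).2
  refine ⟨W ∩ φ.free, W ∩ ψ.free, Finset.inter_subset_left, Finset.inter_subset_left, ?_, ?_,
    hs1.inter_free hW, hs2.inter_free hW⟩
  · rw [Finset.disjoint_left]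
    intro x hx hx'
    have hxq : x ≠ q := fun e => hqT (e ▸ hx')
    rw [Finset.mem_inter] at hx
    exact Finset.disjoint_left.mp hST (hφS (Finset.mem_sdiff.mpr
      ⟨hx.2, fun e => hxq (Finset.mem_singleton.mp e)⟩)) (h2 hx')
  · refine Indep.init hq (W := φ.free \ {q}) (hφS.trans (hS.trans hW))
      (Finset.inter_subset_left.trans hW) (by simp) hqT hρ
      (hi.mono (hS.trans hW) (hT.trans hW) hφS h2) (etr_sem_init hq hρ) ?_
    intro x hx
    rw [Finset.mem_inter] at hx
    rw [Finset.mem_insert, Finset.mem_sdiff, Finset.mem_singleton]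
    by_cases hxq : x = q
    · exact .inl hxq
    · exact .inr ⟨hx.2, hxq⟩

/-- The modification for an initialization is a precondition. -/
theorem SatOn.init {q : Var} (hq : q ∈ V) {ρ : Op V} (hρ : IsTC ρ) {φ φ' : Form Var}
    (hm : modInit q φ = some φ') (hW : W ⊆ V) (h : SatOn ρ φ' W) :
    SatOn (sem V (.init q) ρ) φ W := by
  induction φ generalizing φ' W with
  | top => trivial
  | bot => cases hm; exact h
  | dom S => cases hm; exact h
  | proj S K =>
    by_cases hqS : q ∈ S
    · rw [modInit, if_pos hqS] at hm
      cases hm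
      obtain ⟨hqW, hSW, hz⟩ := h
      have hqW : {q} ⊆ W := hqW
      have hS : S ⊆ W := fun x hx => by
        by_cases hxq : x = q
        · exact hqW (Finset.mem_singleton.mpr hxq)
        · exact hSW (Finset.mem_sdiff.mpr ⟨hx, fun e => hxq (Finset.mem_singleton.mp e)⟩)
      have hSV := hS.trans hW
      refine ⟨hS, ?_⟩
      obtain ⟨C, hC0, hC⟩ := exists_reset_observable Finset.sdiff_subset hSV
        (Finset.sdiff_sdiff_eq_self (Finset.singleton_subset_iff.mpr hqS)) hρ (perp K)
      have h1 := hC (T := ∅) (Finset.empty_subset V) (Finset.disjoint_empty_right _) 1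
      rw [cyl_one (Finset.empty_subset V), mul_one, mul_one] at h1
      rw [h1]
      refine ev_cyl_eq_zero_of_perp (Finset.sdiff_subset.trans hSV) (fun x hx => ?_) hρ.pos hz
      rw [hC0, perp_apply_eq_zero]
      -- the embedding of `|0⟩` is continuous, so it maps the join into `K`
      have hle : initSubspace q K ≤
          K.comap (sliceL Finset.sdiff_subset (zeros (S \ (S \ {q})))) :=
        sSup_le fun T hT t ht => hT t ht
      exact hle hx
    · exact SatOn.init_of_notMem hq hρ hm hqS hW h
  | unif S hfin =>
    have hqS : q ∉ S := fun hqS => by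
      rw [modInit, if_pos hqS] at hm
      cases hm
    exact SatOn.init_of_notMem hq hρ hm hqS hW h
  | and φ ψ ih1 ih2 =>
    simp only [modInit, Bind.bind, Option.bind_eq_some_iff] at hm
    obtain ⟨φ₁, h1, ψ₁, h2, h3⟩ := hm
    cases h3
    exact ⟨ih1 h1 hW h.1, ih2 h2 hW h.2⟩
  | or φ ψ ih1 ih2 =>
    simp only [modInit, Bind.bind, Option.bind_eq_some_iff] at hm
    obtain ⟨φ₁, h1, ψ₁, h2, h3⟩ := hm
    cases h3
    exact h.imp (ih1 h1 hW) (ih2 h2 hW)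
  | star φ ψ ih1 ih2 =>
    by_cases hqf : q ∈ (Form.star φ ψ).free
    · simp only [modInit, Bind.bind, Option.bind_eq_some_iff] at hm
      obtain ⟨φ₁, h1, ψ₁, h2, h3⟩ := hm
      split_ifs at h3 with hqφ hqψ hqψ
      · cases h3
        obtain ⟨⟨hs1, hs2⟩, S, T, hS, hT, hST, hi, hφS, hψT⟩ := h
        exact SatOn.init_star hq hρ hW hqψ (ih1 h1 hW hs1) (ih2 h2 hW hs2) hS hT hST hi hφS hψT
      · cases h3
        obtain ⟨⟨hs1, hs2⟩, S, T, hS, hT, hST, hi, hφS, hψT⟩ := h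
        obtain ⟨S', T', hS', hT', hST', hi', hs1', hs2'⟩ := SatOn.init_star hq hρ hW hqφ
          (ih2 h2 hW hs2) (ih1 h1 hW hs1) hT hS hST.symm (hi.symm (hS.trans hW) (hT.trans hW) hST) hψT hφS
        exact ⟨T', S', hT', hS', hST'.symm, hi'.symm (hS'.trans hW) (hT'.trans hW) hST', hs2', hs1'⟩
      · exact absurd (Finset.mem_union.mp hqf) (not_or.mpr ⟨hqφ, hqψ⟩)
    · exact SatOn.init_of_notMem hq hρ hm hqf hW h
  | imp φ ψ => cases hm
  | wand φ ψ => cases hm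

theorem sound_init {q : Var} {φ φ' : Form Var} (hm : modInit q φ = some φ') :
    Sound φ' (.init q) φ := fun _ hq _ _ hρ _ hsat _ =>
  hsat.init (Finset.singleton_subset_iff.mp hq) hρ hm subset_rfl

/-! ### Quantum operations -/

/-- Strong convergence of `∑ᵢ Gᵢ† Gᵢ`: it is `G† G` for the operator `G = (Gᵢ)ᵢ` into the direct sum
of copies of the space. -/
theorem exists_hasSum_adjoint_comp {ι : Type*} (G : ι → Op S)
    (hG : ∀ ψ, ∑' i, ‖G i ψ‖ₑ ^ 2 ≤ ‖ψ‖ₑ ^ 2) :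
    ∃ T : Op S, (∀ ψ, HasSum (fun i => adjoint (G i) (G i ψ)) (T ψ)) ∧
      ∀ ψ, T ψ = 0 ↔ ∀ i, G i ψ = 0 := by
  classical
  have hsum : ∀ ψ, Summable (fun i => ‖G i ψ‖ ^ 2) ∧ ∑' i, ‖G i ψ‖ ^ 2 ≤ ‖ψ‖ ^ 2 := fun ψ => by
    have h := hG ψ
    simp_rw [enorm_sq_eq_ofReal] at h
    have hs : Summable (fun i => ‖G i ψ‖ ^ 2) := by
      have := ENNReal.summable_toReal (ne_top_of_le_ne_top ENNReal.ofReal_ne_top h)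
      refine this.congr fun i => ENNReal.toReal_ofReal (by positivity)
    refine ⟨hs, ?_⟩
    rw [← ENNReal.ofReal_tsum_of_nonneg (fun i => by positivity) hs] at h
    exact (ENNReal.ofReal_le_ofReal_iff (by positivity)).mp h
  have hmem : ∀ ψ, Memℓp (fun i => G i ψ) 2 := fun ψ => by
    refine memℓp_gen ?_
    simpa using (hsum ψ).1
  let L : Hilb S →ₗ[ℂ] lp (fun _ : ι => Hilb S) 2 :=
    { toFun := fun ψ => ⟨fun i => G i ψ, hmem ψ⟩
      map_add' := fun x y => by ext1; funext i; exact map_add (G i) x y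
      map_smul' := fun c x => by ext1; funext i; exact map_smul (G i) c x }
  have hL : ∀ ψ, ‖L ψ‖ ≤ 1 * ‖ψ‖ := fun ψ => by
    have h := lp.norm_rpow_eq_tsum (p := 2) (by norm_num) (L ψ)
    have h2 : ‖L ψ‖ ^ 2 = ∑' i, ‖(L ψ : ι → Hilb S) i‖ ^ 2 := by simpa using h
    rw [one_mul]
    exact (sq_le_sq₀ (norm_nonneg _) (norm_nonneg _)).mp (h2.trans_le (hsum ψ).2)
  let C : Hilb S →L[ℂ] lp (fun _ : ι => Hilb S) 2 := L.mkContinuous 1 hL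
  have hC : ∀ ψ i, (C ψ : ι → Hilb S) i = G i ψ := fun ψ i => rfl
  have hadj : ∀ i (y : Hilb S), adjoint C (lp.single 2 i y) = adjoint (G i) y := fun i y => by
    refine ext_inner_right ℂ fun ψ => ?_
    rw [ContinuousLinearMap.adjoint_inner_left, ContinuousLinearMap.adjoint_inner_left,
      lp.inner_single_left, hC]
  refine ⟨adjoint C ∘L C, fun ψ => ?_, fun ψ => ?_⟩
  · have h := (lp.hasSum_single (p := 2) ENNReal.ofNat_ne_top (C ψ)).mapL (adjoint C)
    simp_rw [hadj, hC] at h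
    exact h
  · have h : (adjoint C ∘L C) ψ = 0 ↔ C ψ = 0 := by
      refine ⟨fun h => ?_, fun h => by rw [ContinuousLinearMap.comp_apply, h, map_zero]⟩
      rw [← inner_self_eq_zero (𝕜 := ℂ), ← ContinuousLinearMap.adjoint_inner_right]
      change ⟪ψ, (adjoint C ∘L C) ψ⟫_ℂ = 0
      rw [h, inner_zero_right]
    rw [h]
    refine ⟨fun h i => ?_, fun h => ?_⟩
    · rw [← hC, h]; rfl
    · ext1; funext i; exact h i

theorem QuantumOperation.tsum_enorm_sq {q : Finset Var} (E : QuantumOperation q) (h : q ⊆ V)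
    (ψ : Hilb V) : ∑' i, ‖cyl V (E.kraus i) ψ‖ₑ ^ 2 = ‖ψ‖ₑ ^ 2 := by
  have h1 : ∀ ψ : Hilb q, ∑' i, ‖E.kraus i ψ‖ₑ ^ 2 = ‖(1 : Op q) ψ‖ₑ ^ 2 := fun ψ => by
    have hs := ((E.complete ψ).mapL (innerSL ℂ ψ)).mapL Complex.reCLM
    have hs' : HasSum (fun i => ‖E.kraus i ψ‖ ^ 2) (‖ψ‖ ^ 2) := by
      convert hs using 1
      · funext i
        change _ = (⟪ψ, adjoint (E.kraus i) (E.kraus i ψ)⟫_ℂ).re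
        rw [ContinuousLinearMap.adjoint_inner_right]
        exact (inner_self_eq_norm_sq (𝕜 := ℂ) _).symm
      · exact (inner_self_eq_norm_sq (𝕜 := ℂ) _).symm
    rw [enorm_sq_eq_ofReal, tsum_congr fun i => enorm_sq_eq_ofReal (E.kraus i ψ), ← ENNReal.ofReal_tsum_of_nonneg (fun i => by positivity)
      hs'.summable, hs'.tsum_eq]
    rfl
  have h2 := tsum_enorm_sq_cyl h h1 ψ
  rwa [cyl_one h] at h2

/-- The kernel of `(ℰ* ⊗ ℐ)(K^⊥)` consists of the vectors that all Kraus operators map into `K`. -/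
theorem mem_closedKer_dual {q : Finset Var} (E : QuantumOperation q) (h : q ⊆ S)
    (K : ClosedSubmodule ℂ (Hilb S)) (x : Hilb S) :
    x ∈ closedKer (E.dual (perp K)) ↔ ∀ i, perp K (cyl S (E.kraus i) x) = 0 := by
  have hproj : IsStarProjection (perp K) := isStarProjection_starProjection
  have hK : adjoint (perp K) * perp K = perp K := by
    rw [show adjoint (perp K) = perp K from hproj.isSelfAdjoint.star_eq]
    exact hproj.isIdempotentElem.eq
  obtain ⟨T, hT, hT0⟩ := exists_hasSum_adjoint_comp (fun i => perp K * cyl S (E.kraus i))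
    fun ψ => by
      rw [← E.tsum_enorm_sq h ψ]
      refine ENNReal.tsum_le_tsum fun i => ?_
      gcongr
      rw [enorm_le_iff_norm_le]
      exact Submodule.norm_starProjection_apply_le _ _
  have hT' : ∀ ψ, HasSum (fun i =>
      (adjoint (cyl S (E.kraus i)) ∘L perp K ∘L cyl S (E.kraus i)) ψ) (T ψ) := fun ψ => by
    convert hT ψ using 1
    funext i
    rw [adjoint_mul_apply]
    change _ = adjoint (cyl S (E.kraus i)) ((adjoint (perp K) * perp K) (cyl S (E.kraus i) ψ))
    rw [hK]
    rfl
  have hex : ∃ T : Op S, ∀ ψ, HasSum (fun i =>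
      (adjoint (cyl S (E.kraus i)) ∘L perp K ∘L cyl S (E.kraus i)) ψ) (T ψ) := ⟨T, hT'⟩
  have hdual : E.dual (perp K) = T := by
    rw [QuantumOperation.dual, sotSum, dif_pos hex]
    ext1 ψ
    exact (hex.choose_spec ψ).unique (hT' ψ)
  rw [hdual]
  exact hT0 x

/-- The effect of a quantum operation on a state, through the expectations in the output. -/
theorem QuantumOperation.exists_channel {q : Finset Var} (E : QuantumOperation q) (h : q ⊆ V)
    {ρ : Op V} (hρ : IsTC ρ) : ∃ σ : Op V, IsTC σ ∧
      ∀ X : Op V, ev σ X = ∑' i, ev ρ (X ∘L cyl V (E.kraus i)) := by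
  have h1 : ∑' i, etr (conj (cyl V (E.kraus i)) ρ) = etr ρ := by
    rw [← ev_one]
    exact ev_eq_tsum hρ.pos _ _ fun ψ => E.tsum_enorm_sq h ψ
  obtain ⟨σ, -, hσ, hq⟩ := exists_hasSum_of_etr (F := fun i => conj (cyl V (E.kraus i)) ρ)
    (fun i => (hρ.conj _).pos) (by rw [h1]; exact hρ.fin)
  refine ⟨σ, hσ, fun X => ?_⟩
  simp only [ev, etr, qf_conj, hq]
  rw [ENNReal.tsum_comm]
  refine tsum_congr fun p => tsum_congr fun b => ?_
  rw [ContinuousLinearMap.adjoint_comp, ContinuousLinearMap.comp_apply]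

/-- The modified formula holds for `ρ` if and only if the original one holds for `σ = ℰ(ρ)`. -/
theorem satOn_modOp_iff {q : Finset Var} (E : QuantumOperation q) (hq : q ⊆ V) {ρ σ : Op V}
    (hρ : IsTC ρ) (hσ : ∀ X : Op V, ev σ X = ∑' i, ev ρ (X ∘L cyl V (E.kraus i)))
    {φ φ' : Form Var} (hm : modOp q E φ = some φ') (hW : W ⊆ V) :
    SatOn ρ φ' W ↔ SatOn σ φ W := by
  induction φ generalizing φ' with
  | top => cases hm; exact Iff.rfl
  | bot => cases hm; exact Iff.rfl
  | dom S => cases hm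
  | unif S hfin => cases hm
  | proj S K =>
    rw [modOp] at hm
    split_ifs at hm with h1 h2
    · cases hm
      refine and_congr_right fun hSW => ?_
      have hS : S ⊆ V := hSW.trans hW
      rw [hσ, ENNReal.tsum_eq_zero]
      have e : ∀ i, cyl V (perp K) ∘L cyl V (E.kraus i) =
          cyl V (perp K * cyl S (E.kraus i)) := fun i => by
        rw [cyl_mul hS, cyl_cyl h1 hS]
        rfl
      simp_rw [e]
      refine ⟨fun h i => ?_, fun h => ?_⟩
      · exact ev_cyl_eq_zero_of_perp hS
          (fun x hx => (mem_closedKer_dual E h1 K x).mp hx i) hρ.pos h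
      · exact ev_cyl_eq_zero_of hS (fun x hx =>
          perp_apply_eq_zero.mpr ((mem_closedKer_dual E h1 K x).mpr hx)) hρ.pos h
    · cases hm
      refine and_congr_right fun hSW => ?_
      have hS : S ⊆ V := hSW.trans hW
      rw [hσ, ev_eq_tsum hρ.pos _ (cyl V (perp K)) fun ψ => ?_]
      rw [← E.tsum_enorm_sq hq (cyl V (perp K) ψ)]
      refine tsum_congr fun i => ?_
      congr 2
      exact congrArg (fun X : Op V => X ψ) (cyl_commute hS hq h2.symm (perp K) (E.kraus i))
  | and φ ψ ih1 ih2 =>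
    simp only [modOp, Bind.bind, Option.bind_eq_some_iff] at hm
    obtain ⟨φ₁, h1, ψ₁, h2, h3⟩ := hm
    cases h3
    exact and_congr (ih1 h1) (ih2 h2)
  | or φ ψ ih1 ih2 =>
    simp only [modOp, Bind.bind, Option.bind_eq_some_iff] at hm
    obtain ⟨φ₁, h1, ψ₁, h2, h3⟩ := hm
    cases h3
    exact or_congr (ih1 h1) (ih2 h2)
  | star φ ψ => cases hm
  | imp φ ψ => cases hm
  | wand φ ψ => cases hm

/-- As `P` commutes with `ℰ`, the original judgment applied to the input `ℰ(ρ)` describes `ℰ(⟦P⟧(ρ))`. -/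
theorem sound_uncr {q : Finset Var} {E : QuantumOperation q} {φ ψ φ' ψ' : Form Var}
    {P : Prog Var} (h : Sound φ P ψ) (hd : Disjoint q P.vars) (h1 : modOp q E φ = some φ')
    (h2 : modOp q E ψ = some ψ') : Sound φ' P ψ' := by
  refine sound_of_large (q ∪ ψ.free) fun V hF hP _ ρ hρ h0 hsat hterm => ?_
  have hq : q ⊆ V := Finset.subset_union_left.trans hF
  have hψ : ψ.free ⊆ V := Finset.subset_union_right.trans hF
  have hρ' := (sem_spec P hP hρ).1
  obtain ⟨σ, hσ, hσe⟩ := E.exists_channel hq hρ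
  have htr : ∀ {ρ σ : Op V}, IsTC ρ → (∀ X : Op V, ev σ X =
      ∑' i, ev ρ (X ∘L cyl V (E.kraus i))) → etr σ = etr ρ := fun {ρ σ} hρ hσ => by
    rw [← ev_one, hσ, ← ev_one ρ]
    exact ev_eq_tsum hρ.pos _ _ fun ψ => E.tsum_enorm_sq hq ψ
  -- the program commutes with the quantum operation
  have hcomm : ∀ X : Op V, ev (sem V P σ) X =
      ∑' i, ev (sem V P ρ) (X ∘L cyl V (E.kraus i)) := fun X => by
    rw [ev_sem P hP hσ]
    simp_rw [hσe]
    rw [ENNReal.tsum_comm]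
    refine tsum_congr fun i => ?_
    rw [ev_sem P hP hρ]
    refine tsum_congr fun p => ?_
    change ev ρ (X * kraus V P p * cyl V (E.kraus i)) = ev ρ (X * cyl V (E.kraus i) * kraus V P p)
    rw [mul_assoc, mul_assoc, kraus_commute P hP hq hd]
  have e1 := htr hρ hσe
  have e2 := htr hρ' hcomm
  rw [satOn_modOp_iff E hq hρ' hcomm h2 subset_rfl]
  exact h V hP hψ σ hσ (by rwa [e1]) ((satOn_modOp_iff E hq hρ hσe h1 subset_rfl).mp hsat)
    (by rw [e2, hterm, e1])

/-! ### Derivable judgments -/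

theorem Form.Res.modUnit {q : Finset Var} {U : Op q} {φ φ' : Form Var} (hφ : φ.Res)
    (hm : modUnit q U φ = some φ') : φ'.Res := by
  induction φ generalizing φ' with
  | top => cases hm; trivial
  | bot => cases hm; trivial
  | dom S => cases hm; trivial
  | proj S K =>
    rw [QSL.modUnit] at hm
    split_ifs at hm <;> cases hm <;> trivial
  | unif S hfin =>
    rw [QSL.modUnit] at hm
    split_ifs at hm
    cases hm
    trivial
  | and φ ψ ih1 ih2 =>
    simp only [QSL.modUnit, Bind.bind, Option.bind_eq_some_iff] at hm
    obtain ⟨φ₁, h1, ψ₁, h2, h3⟩ := hm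
    cases h3
    exact ⟨ih1 hφ.1 h1, ih2 hφ.2 h2⟩
  | or φ ψ ih1 ih2 =>
    simp only [QSL.modUnit, Bind.bind, Option.bind_eq_some_iff] at hm
    obtain ⟨φ₁, h1, ψ₁, h2, h3⟩ := hm
    cases h3
    exact ⟨ih1 hφ.1 h1, ih2 hφ.2 h2⟩
  | star φ ψ ih1 ih2 =>
    rw [QSL.modUnit] at hm
    split_ifs at hm
    simp only [Bind.bind, Option.bind_eq_some_iff] at hm
    obtain ⟨φ₁, h1, ψ₁, h2, h3⟩ := hm
    cases h3
    exact ⟨ih1 hφ.1 h1, ih2 hφ.2 h2⟩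
  | imp φ ψ => cases hm
  | wand φ ψ => cases hm

theorem Form.Res.modInit {q : Var} {φ φ' : Form Var} (hφ : φ.Res)
    (hm : modInit q φ = some φ') : φ'.Res := by
  induction φ generalizing φ' with
  | top => cases hm; trivial
  | bot => cases hm; trivial
  | dom S => cases hm; trivial
  | proj S K =>
    rw [QSL.modInit] at hm
    split_ifs at hm <;> cases hm
    · exact ⟨trivial, trivial⟩
    · trivial
  | unif S hfin =>
    rw [QSL.modInit] at hm
    split_ifs at hm
    cases hm
    trivial
  | and φ ψ ih1 ih2 =>
    simp only [QSL.modInit, Bind.bind, Option.bind_eq_some_iff] at hm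
    obtain ⟨φ₁, h1, ψ₁, h2, h3⟩ := hm
    cases h3
    exact ⟨ih1 hφ.1 h1, ih2 hφ.2 h2⟩
  | or φ ψ ih1 ih2 =>
    simp only [QSL.modInit, Bind.bind, Option.bind_eq_some_iff] at hm
    obtain ⟨φ₁, h1, ψ₁, h2, h3⟩ := hm
    cases h3
    exact ⟨ih1 hφ.1 h1, ih2 hφ.2 h2⟩
  | star φ ψ ih1 ih2 =>
    simp only [QSL.modInit, Bind.bind, Option.bind_eq_some_iff] at hm
    obtain ⟨φ₁, h1, ψ₁, h2, h3⟩ := hm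
    have hr1 := ih1 hφ.1 h1
    have hr2 := ih2 hφ.2 h2
    split_ifs at h3 <;> cases h3
    · exact ⟨⟨hr1, hr2⟩, trivial, trivial⟩
    · exact ⟨⟨hr1, hr2⟩, trivial, trivial⟩
    · exact ⟨hr1, hr2⟩
  | imp φ ψ => cases hm
  | wand φ ψ => cases hm

theorem Form.Res.modOp {q : Finset Var} {E : QuantumOperation q} {φ φ' : Form Var}
    (hm : modOp q E φ = some φ') : φ'.Res := by
  induction φ generalizing φ' with
  | top => cases hm; trivial
  | bot => cases hm; trivial
  | proj S K =>
    rw [QSL.modOp] at hm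
    split_ifs at hm <;> cases hm <;> trivial
  | and φ ψ ih1 ih2 =>
    simp only [QSL.modOp, Bind.bind, Option.bind_eq_some_iff] at hm
    obtain ⟨φ₁, h1, ψ₁, h2, h3⟩ := hm
    cases h3
    exact ⟨ih1 h1, ih2 h2⟩
  | or φ ψ ih1 ih2 =>
    simp only [QSL.modOp, Bind.bind, Option.bind_eq_some_iff] at hm
    obtain ⟨φ₁, h1, ψ₁, h2, h3⟩ := hm
    cases h3
    exact ⟨ih1 h1, ih2 h2⟩
  | dom S => cases hm
  | unif S hfin => cases hm
  | star φ ψ => cases hm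
  | imp φ ψ => cases hm
  | wand φ ψ => cases hm

/-- A measurement has at least one outcome. -/
theorem Measurement.pos {q : Finset Var} {k : ℕ} (M : Measurement q k) : 0 < k := by
  rcases Nat.eq_zero_or_pos k with rfl | h
  · have h1 := M.complete
    rw [Fin.sum_univ_zero] at h1
    have h2 := congrArg (fun A : Op q => ‖A (ket (zeros q))‖) h1
    simp [norm_ket] at h2
  · exact h

/-- All judgments of the proof system have restrictive pre- and postconditions. -/
theorem Derivable.res {φ ψ : Form Var} {P : Prog Var} (hd : Derivable φ P ψ) : φ.Res ∧ ψ.Res := by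
  induction hd with
  | skip h => exact ⟨h, h⟩
  | init h hm => exact ⟨h.modInit hm, h⟩
  | unit h hm => exact ⟨h.modUnit hm, h⟩
  | seq _ _ ih1 ih2 => exact ⟨ih1.1, ih2.2⟩
  -- a measurement has an outcome, so there is a premise that determines `φ` and `ψ`
  | @rif q k M P φ ψ _ _ ih =>
    have h := ih ⟨0, M.pos⟩
    exact ⟨⟨h.1.1, trivial⟩, h.2⟩
  | rloop _ _ ih => exact ⟨⟨ih.1.1, trivial⟩, ih.1.1, trivial⟩
  | weak h1 h2 => exact ⟨h1, h2⟩
  | conj _ _ ih1 ih2 => exact ⟨⟨ih1.1, ih2.1⟩, ih1.2, ih2.2⟩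
  | disj _ _ ih1 ih2 => exact ⟨⟨ih1.1, ih2.1⟩, ih1.2, ih2.2⟩
  | const hμ _ _ ih => exact ⟨⟨ih.1, hμ⟩, ih.2, hμ⟩
  | frame hμ _ _ _ ih => exact ⟨⟨ih.1, hμ⟩, ih.2, hμ⟩
  | uncr _ _ h1 h2 => exact ⟨Form.Res.modOp h1, Form.Res.modOp h2⟩

theorem Derivable.sound (hdim : ∀ q : Var, Nontrivial (Label q)) {φ ψ : Form Var} {P : Prog Var}
    (hd : Derivable φ P ψ) : Sound φ P ψ := by
  induction hd with
  | skip => exact sound_skip _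
  | init _ hm => exact sound_init hm
  | unit h hm => exact sound_unit h hm
  | seq _ _ ih1 ih2 => exact sound_seq ih1 ih2
  | @rif q k M P φ ψ h hcm ih => exact sound_rif (h ⟨0, M.pos⟩).res.2 ih hcm
  | rloop h hcm ih => exact sound_rloop h.res.1.1 ih hcm
  | weak h1 h2 hv1 h hv2 ih => exact sound_weak h1 h.res.1 h2 h.res.2 hv1 ih hv2
  | conj _ _ ih1 ih2 => exact sound_conj ih1 ih2
  | disj _ _ ih1 ih2 => exact sound_disj ih1 ih2
  | const _ _ hdis ih => exact sound_const ih hdis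
  | frame _ h hdis hside ih => exact sound_frame hdim h.res.1 h.res.2 ih hdis hside
  | uncr _ hdis h1 h2 ih => exact sound_uncr ih hdis h1 h2

/-- Almost sure termination provides the termination that `Sound` asks for. -/
theorem Sound.validTriple {φ ψ : Form Var} {P : Prog Var} (hφ : φ.Res) (hψ : ψ.Res)
    (h : Sound φ P ψ) (hP : AlmostSurelyTerminating P) : ValidTriple φ P ψ := by
  intro V _ hψV hPV ρ hsat
  have hσ := (sem_spec P hPV ρ.isTC).1
  have hterm : etr (sem V P ρ.op) = etr ρ.op := by
    have h1 := hP V hPV ρ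
    rw [trace, trace, (hasSum_trace hσ).tsum_eq, (hasSum_trace ρ.isTC).tsum_eq] at h1
    exact (ENNReal.toReal_eq_toReal_iff' hσ.fin ρ.isTC.fin).mp (Complex.ofReal_injective h1)
  refine ⟨mkState hσ (hterm.trans ρ.etr_eq_one), rfl, (sat_iff_satOn hψ _).mpr ?_⟩
  exact h V hPV hψV ρ.op ρ.isTC (by rw [ρ.etr_eq_one]; exact one_ne_zero)
    ((sat_iff_satOn hφ ρ).mp hsat) hterm

end QSL

end

theorem mainTheorem1 {Var : Type*} [DecidableEq Var] [QuantumVariables Var]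
    (hdim : ∀ q : Var, Nontrivial (QuantumVariables.Label q))
    (P : QSL.Prog Var) (hP : QSL.AlmostSurelyTerminating P)
    (φ ψ : QSL.Form Var) (hd : QSL.Derivable φ P ψ) :
    QSL.ValidTriple φ P ψ := by
  exact (hd.sound hdim).validTriple hd.res.1 hd.res.2 hP
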